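/- **Setting.** Let $(E_n)_{n\ge 0}$ be measurable spaces and $\mathcal B(E_n)$ the space of bounded measurable functions $f:E_n\to\mathbb R$. Let $M_{n+1}$ be Markov transitions from $E_n$ to $E_{n+1}$, let $G_n:E_n\to\mathbb R$ be measurable functions with $0<\inf G_n\le\sup G_n<\infty$, and let $\mu_n$ be finite measures on $E_n$ with $\mu_0\ne 0$ (for $n\ge1$, $\mu_n=0$ is allowed). Put $Q_{n+1}(x,dy)=G_n(x)M_{n+1}(x,dy)$, $Q_{p,n}=Q_{p+1}\cdots Q_n$, $Q_{n,n}=\mathrm{Id}$, and $$\gamma_0=\mu_0,\qquad \gamma_{n+1}=\gamma_nQ_{n+1}+\mu_{n+1},\qquad \eta_n=\gamma_n/\gamma_n(1).$$ For $m>0$ and a probability measure $\eta$ on $E_n$ put $\Psi_{G_n}(\eta)(dx)=G_n(x)\eta(dx)/\eta(G_n)$, $\alpha_n(m,\eta)=\frac{m\eta(G_n)}{m\eta(G_n)+\mu_{n+1}(1)}$, $M_{n+1,(m,\eta)}=\alpha_n(m,\eta)M_{n+1}+(1-\alpha_n(m,\eta))\,\mu_{n+1}/\mu_{n+1}(1)$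 (only the first term if $\mu_{n+1}=0$) and $\Gamma^2_{n+1}(m,\eta)=\Psi_{G_n}(\eta)M_{n+1,(m,\eta)}$; thus $\eta_{n+1}=\Gamma^2_{n+1}(\gamma_n(1),\eta_n)$. **McKean transitions.** Let $K_{n+1,(m,\eta)}$ be Markov kernels from $E_n$ to $E_{n+1}$ with $\eta K_{n+1,(m,\eta)}=\Gamma^2_{n+1}(m,\eta)$ for all $m>0$ and all probability measures $\eta$ on $E_n$, such that $(m,(x^j)_{1\le j\le N})\mapsto K_{n+1,(m,\frac1N\sum_j\delta_{x^j})}(x^i,A)$ is measurable for all $N\ge1$, $i\le N$ and measurable $A\subset E_{n+1}$. Assume moreover that $K$ is continuous at the limiting flow: for all $n$ and $f\in\mathcal B(E_{n+1})$ there is a measurable $A\subset E_n$ with $\eta_n(A)=1$ such that for every $\varepsilon>0$ there are $\delta>0$ and a finite set $H\subset\mathcal B(E_n)$ with $$\int\bigl|K_{n+1,(m',\eta')}(f)-K_{n+1,(\gamma_n(1),\eta_n)}(f)\bigr|\,d\eta'<\varepsilon$$ for all $m'>0$ and all probability measures $\eta'$ with $\eta'(A)=1$, $|m'-\gamma_n(1)|<\delta$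 and $|\eta'(h)-\eta_n(h)|<\delta$ for all $h\in H$. **Particles.** For each $N\ge1$ let $(\xi_n^i)_{1\le i\le N}$, $n\ge0$, be random variables in $E_n$ (on a probability space that may depend on $N$), and put $\eta_n^N=\frac1N\sum_i\delta_{\xi_n^i}$, $\gamma_0^N(1)=\gamma_0(1)$, $\gamma_{n+1}^N(1)=\gamma_n^N(1)\eta_n^N(G_n)+\mu_{n+1}(1)$, $\gamma_n^N=\gamma_n^N(1)\,\eta_n^N$. Suppose that $(\xi_0^i)_i$ are i.i.d. with law $\eta_0$, and that, conditionally on $\xi_0,\dots,\xi_n$, the vector $\xi_{n+1}$ has law $\prod_{i=1}^NK_{n+1,(\gamma_n^N(1),\eta_n^N)}(\xi_n^i,dx^i)$. The local error fields are $W_0^N=\sqrt N(\eta_0^N-\eta_0)$ and, for $n\ge1$, $$W_n^N=\sqrt N\bigl(\eta_n^N-\eta_{n-1}^NK_{n,(\gamma_{n-1}^N(1),\eta_{n-1}^N)}\bigr).$$ Put also $V_n^{\gamma,N}=\sqrt N(\gamma_n^N-\gamma_n)$ and $V_n^{\eta,N}=\sqrt N(\eta_n^N-\eta_n)$. Random fields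 are indexed by bounded measurable functions, and their convergence in law means convergence in distribution of the values at every finite list of indices. **Theorem.** As $N\to\infty$, the sequence of fields $(W_n^N)_{n\ge0}$ converges in law (jointly in $n$) to a sequence $(W_n)_{n\ge0}$ of independent centered Gaussian fields with, for $f,g\in\mathcal B(E_n)$, $$\mathbb E(W_n(f)W_n(g))=\eta_{n-1}K_{n,(\gamma_{n-1}(1),\eta_{n-1})}\bigl([f-K_{n,(\gamma_{n-1}(1),\eta_{n-1})}(f)][g-K_{n,(\gamma_{n-1}(1),\eta_{n-1})}(g)]\bigr)\quad(n\ge1),$$ where $K([f-K(f)][g-K(g)])(x)$ means $\int K(x,dy)\,[f(y)-K(f)(x)][g(y)-K(g)(x)]$, and $\mathbb E(W_0(f)W_0(g))=\eta_0([f-\eta_0(f)][g-\eta_0(g)])$. In addition, for every $n$, the pair of fields $(V_n^{\gamma,N},V_n^{\eta,N})$ converges in law as $N\to\infty$ to the pair of (jointly Gaussian) centered Gaussian fields $$V_n^\gamma(f)=\sum_{p=0}^n\gamma_p(1)\,W_p(Q_{p,n}(f)),\qquad V_n^\eta(f)=V_n^\gamma\Bigl(\frac1{\gamma_n(1)}(f-\eta_n(f))\Bigr).$$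 -/

import Mathlib

open MeasureTheory ProbabilityTheory Filter Topology
open scoped ENNReal

universe u v w

noncomputable section

namespace SpatialBranching

/-- `𝓑(E)`: the vector space of bounded measurable real functions on `E`. -/
def BddMeas (E : Type u) [MeasurableSpace E] : Submodule ℝ (E → ℝ) where
  carrier := {f | Measurable f ∧ ∃ C : ℝ, ∀ x, |f x| ≤ C}
  zero_mem' := ⟨measurable_const, 0, fun x => by simp⟩
  add_mem' := by
    rintro f g ⟨hf, C, hC⟩ ⟨hg, D, hD⟩
    exact ⟨hf.add hg, C + D, fun x => (abs_add_le _ _).trans (add_le_add (hC x) (hD x))⟩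
  smul_mem' := by
    rintro c f ⟨hf, C, hC⟩
    refine ⟨hf.const_smul c, |c| * C, fun x => ?_⟩
    simpa [abs_mul] using mul_le_mul_of_nonneg_left (hC x) (abs_nonneg c)

/-- The constant function `c`, as an element of `𝓑(E)`. -/
def BddMeas.const (E : Type u) [MeasurableSpace E] (c : ℝ) : BddMeas E :=
  ⟨fun _ => c, measurable_const, |c|, fun _ => le_rfl⟩

/-- The operator `𝓑(F) → 𝓑(E)`, `f ↦ (x ↦ ∫ f(y) κ(x, dy))`, of a bounded kernel `κ`. -/
def kernelOp {E F : Type u} [MeasurableSpace E] [MeasurableSpace F]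
    (κ : Kernel E F) [IsFiniteKernel κ] (f : BddMeas F) : BddMeas E :=
  ⟨fun x => ∫ y, f.1 y ∂(κ x), by
    obtain ⟨f, hf, C, hC⟩ := f
    refine ⟨hf.stronglyMeasurable.integral_kernel.measurable, C * (κ.bound).toReal,
      fun x => ?_⟩
    have h0 : 0 ≤ C ∨ (κ x) Set.univ = 0 := by
      by_cases hF : Nonempty F
      · exact Or.inl ((abs_nonneg _).trans (hC hF.some))
      · right
        have := not_nonempty_iff.mp hF
        simp [Set.univ_eq_empty_iff.mpr this]
    rcases h0 with h0 | h0
    · have h1 : ‖∫ y, f y ∂(κ x)‖ ≤ C * (κ x).real Set.univ :=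
        norm_integral_le_of_norm_le_const (Filter.Eventually.of_forall hC)
      have h2 : (κ x).real Set.univ ≤ (κ.bound).toReal :=
        ENNReal.toReal_mono (Kernel.bound_ne_top κ) (Kernel.measure_le_bound κ x Set.univ)
      exact h1.trans (mul_le_mul_of_nonneg_left h2 h0)
    · have h3 : κ x = 0 := Measure.measure_univ_eq_zero.mp h0
      by_cases hC0 : 0 ≤ C
      · simpa [h3] using mul_nonneg hC0 ENNReal.toReal_nonneg
      · have hF : IsEmpty F := ⟨fun y => hC0 ((abs_nonneg _).trans (hC y))⟩
        have hκ : κ = 0 := by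
          ext z s hs
          simp [Set.eq_empty_of_isEmpty s]
        subst hκ
        simp⟩

/-- The empirical measure `N⁻¹ ∑ᵢ δ_{xᵢ}`. -/
def empirical {E : Type u} [MeasurableSpace E] {N : ℕ} (x : Fin N → E) : Measure E :=
  (N : ℝ≥0∞)⁻¹ • ∑ i, Measure.dirac (x i)

/-- Data of a spatial branching model with spontaneous births on the state spaces `E n`.
`M n` is the Markov transition from `E n` to `E (n + 1)`, `G n` is the potential function on `E n`
(bounded, and bounded away from zero), `μ n` is the (finite) intensity of the births at time `n`.
The initial intensity `μ 0` is not zero. -/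
structure Model (E : ℕ → Type u) [∀ n, MeasurableSpace (E n)] where
  M : ∀ n, Kernel (E n) (E (n + 1))
  isMarkov_M : ∀ n, IsMarkovKernel (M n)
  G : ∀ n, E n → ℝ
  measurable_G : ∀ n, Measurable (G n)
  G_lower : ∀ n, ∃ c : ℝ, 0 < c ∧ ∀ x, c ≤ G n x
  G_upper : ∀ n, ∃ C : ℝ, ∀ x, G n x ≤ C
  μ : ∀ n, Measure (E n)
  isFinite_μ : ∀ n, IsFiniteMeasure (μ n)
  μ_zero_ne : μ 0 ≠ 0

namespace Model

variable {E : ℕ → Type u} [∀ n, MeasurableSpace (E n)] (S : Model E)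

/-- The integral kernel `G_n(x) M_{n+1}(x, dy)` from `E n` to `E (n + 1)`. -/
def Q (n : ℕ) : Kernel (E n) (E (n + 1)) where
  toFun x := ENNReal.ofReal (S.G n x) • S.M n x
  measurable' := by
    refine Measure.measurable_of_measurable_coe _ fun s hs => ?_
    simp only [Measure.smul_apply, smul_eq_mul]
    exact (S.measurable_G n).ennreal_ofReal.mul ((S.M n).measurable_coe hs)

instance (n : ℕ) : IsFiniteKernel (S.Q n) := by
  obtain ⟨C, hC⟩ := S.G_upper n
  have := S.isMarkov_M n
  refine ⟨⟨ENNReal.ofReal C, ENNReal.ofReal_lt_top, fun x => ?_⟩⟩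
  change (ENNReal.ofReal (S.G n x) • S.M n x) Set.univ ≤ _
  simpa using ENNReal.ofReal_le_ofReal (hC x)

/-- The semigroup `Q_{p,n} = Q_{p+1} ⋯ Q_n : 𝓑(E n) → 𝓑(E p)` for `p ≤ n`, with `Q_{n,n} = Id`
(and, by convention, `0` for `p > n`). -/
def Qsg (p : ℕ) : (n : ℕ) → BddMeas (E n) → BddMeas (E p)
  | 0, f => if h : p = 0 then h ▸ f else 0
  | n + 1, f => if h : p = n + 1 then h ▸ f else Qsg p n (kernelOp (S.Q n) f)

/-- The intensity measures: `γ_0 = μ_0` and `γ_{n+1} = γ_n Q_{n+1} + μ_{n+1}`. -/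
def γ : (n : ℕ) → Measure (E n)
  | 0 => S.μ 0
  | n + 1 => (γ n).bind (S.Q n) + S.μ (n + 1)

/-- The total mass `γ_n(1)`. -/
def mass (n : ℕ) : ℝ := (S.γ n).real Set.univ

/-- The normalised measure `η_n = γ_n / γ_n(1)`. -/
def η (n : ℕ) : Measure (E n) := (S.γ n Set.univ)⁻¹ • S.γ n

/-- The Boltzmann-Gibbs transformation `Ψ_{G_n}(η)(dx) = G_n(x) η(dx) / η(G_n)`. -/
def boltzmannGibbs (n : ℕ) (η : Measure (E n)) : Measure (E n) :=
  (∫⁻ x, ENNReal.ofReal (S.G n x) ∂η)⁻¹ • η.withDensity fun x => ENNReal.ofReal (S.G n x)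

/-- `α_n(m, η) = m η(G_n) / (m η(G_n) + μ_{n+1}(1))`. -/
def α (n : ℕ) (m : ℝ) (η : Measure (E n)) : ℝ :=
  m * (∫ x, S.G n x ∂η) / (m * (∫ x, S.G n x ∂η) + (S.μ (n + 1)).real Set.univ)

/-- The normalised birth law `μ_n / μ_n(1)` (the zero measure if `μ_n = 0`). -/
def birthLaw (n : ℕ) : Measure (E n) := (S.μ n Set.univ)⁻¹ • S.μ n

/-- The kernel
`M_{n+1,(m,η)}(x, dy) = α_n(m,η) M_{n+1}(x, dy) + (1 - α_n(m,η)) (μ_{n+1}/μ_{n+1}(1))(dy)`. -/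
def mutation (n : ℕ) (m : ℝ) (η : Measure (E n)) : Kernel (E n) (E (n + 1)) where
  toFun x := ENNReal.ofReal (S.α n m η) • S.M n x
    + ENNReal.ofReal (1 - S.α n m η) • S.birthLaw (n + 1)
  measurable' := by
    refine Measure.measurable_of_measurable_coe _ fun s hs => ?_
    simp only [Measure.add_apply, Measure.smul_apply, smul_eq_mul]
    exact (((S.M n).measurable_coe hs).const_mul _).add_const _

/-- The second component `Γ²_{n+1}(m, η) = Ψ_{G_n}(η) M_{n+1,(m,η)}` of the evolution map of
`(γ_n(1), η_n)`. -/
def Γ₂ (n : ℕ) (m : ℝ) (η : Measure (E n)) : Measure (E (n + 1)) :=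
  (S.boltzmannGibbs n η).bind (S.mutation n m η)

/-- `K n m η` stands for `K_{n+1,(m,η)}`. It is a family of McKean transitions: Markov kernels
with `η K_{n+1,(m,η)} = Γ²_{n+1}(m, η)`, depending measurably on the mass and on the particles.
Nothing is asked when `m ≤ 0` or `η` is not a probability measure. -/
structure IsMcKean (K : ∀ n, ℝ → Measure (E n) → Kernel (E n) (E (n + 1))) : Prop where
  isMarkov : ∀ n (m : ℝ) (η : Measure (E n)), 0 < m → IsProbabilityMeasure η →
    IsMarkovKernel (K n m η)
  transport : ∀ n (m : ℝ) (η : Measure (E n)), 0 < m → IsProbabilityMeasure η →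
    η.bind (K n m η) = S.Γ₂ n m η
  measurable : ∀ n (N : ℕ), 1 ≤ N → ∀ (i : Fin N) (A : Set (E (n + 1))), MeasurableSet A →
    Measurable fun p : Set.Ioi (0 : ℝ) × (Fin N → E n) => K n p.1 (empirical p.2) (p.2 i) A

/-- Continuity of the McKean transitions at the limiting flow. For `f ∈ 𝓑(E_{n+1})`, as `m'` tends
to `γ_n(1)` and `η'` tends to `η_n` in the topology generated by the maps `η' ↦ η'(h)`,
`h ∈ 𝓑(E_n)`, the function `K_{n+1,(m',η')}(f)` tends to `K_{n+1,(γ_n(1),η_n)}(f)` in `L¹(η')`.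
Only probability measures `η'` carried by a suitable set `A` of full `η_n`-measure need be
considered. -/
def IsContinuousAtFlow (K : ∀ n, ℝ → Measure (E n) → Kernel (E n) (E (n + 1))) : Prop :=
  ∀ (n : ℕ) (f : BddMeas (E (n + 1))), ∃ A : Set (E n), MeasurableSet A ∧ S.η n Aᶜ = 0 ∧
    ∀ ε : ℝ, 0 < ε → ∃ δ : ℝ, 0 < δ ∧ ∃ H : Finset (BddMeas (E n)),
      ∀ (m' : ℝ) (η' : Measure (E n)), 0 < m' → IsProbabilityMeasure η' → η' Aᶜ = 0 →
        |m' - S.mass n| < δ →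
        (∀ h ∈ H, |(∫ x, h.1 x ∂η') - ∫ x, h.1 x ∂(S.η n)| < δ) →
        ∫ x, |(∫ y, f.1 y ∂(K n m' η' x)) - ∫ y, f.1 y ∂(K n (S.mass n) (S.η n) x)| ∂η' < ε

section Particles

variable {Ω : Type v} {N : ℕ}

/-- The particle mass `γ_n^N(1)`: `γ_0^N(1) = γ_0(1)` and
`γ_{n+1}^N(1) = γ_n^N(1) η_n^N(G_n) + μ_{n+1}(1)`. -/
def massN (ξ : ∀ n, Fin N → Ω → E n) : ℕ → Ω → ℝ
  | 0, _ => S.mass 0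
  | n + 1, ω => massN ξ n ω * (∫ x, S.G n x ∂(empirical fun i => ξ n i ω))
      + (S.μ (n + 1)).real Set.univ

/-- The σ-field generated by `ξ_0, …, ξ_n`. -/
abbrev history (ξ : ∀ n, Fin N → Ω → E n) (n : ℕ) : MeasurableSpace Ω :=
  ⨆ p : Fin (n + 1), ⨆ i : Fin N, MeasurableSpace.comap (ξ p i) inferInstance

/-- `ξ` is an `N`-particle mean field interpretation of the McKean transitions `K`: the particles
`ξ_0^i` are i.i.d. with law `η_0`, and given `ξ_0, …, ξ_n` the law of `ξ_{n+1}` is the product of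
the measures `K_{n+1,(γ_n^N(1),η_n^N)}(ξ_n^i, ·)`. -/
structure IsParticleSystem [MeasurableSpace Ω] (P : Measure Ω)
    (K : ∀ n, ℝ → Measure (E n) → Kernel (E n) (E (n + 1)))
    (ξ : ∀ n, Fin N → Ω → E n) : Prop where
  measurable : ∀ n i, Measurable (ξ n i)
  initial : P.map (fun ω i => ξ 0 i ω) = Measure.pi fun _ : Fin N => S.η 0
  transition : ∀ (n : ℕ) (B : Set (Fin N → E (n + 1))), MeasurableSet B →
    P[Set.indicator {ω | (fun i => ξ (n + 1) i ω) ∈ B} (fun _ => (1 : ℝ)) | history ξ n]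
      =ᵐ[P] fun ω => (Measure.pi fun i =>
        K n (S.massN ξ n ω) (empirical fun j => ξ n j ω) (ξ n i ω)).real B

/-- The local error field: `W_0^N = √N (η_0^N - η_0)` and
`W_{n+1}^N = √N (η_{n+1}^N - η_n^N K_{n+1,(γ_n^N(1),η_n^N)})`. -/
def WN (K : ∀ n, ℝ → Measure (E n) → Kernel (E n) (E (n + 1)))
    (ξ : ∀ n, Fin N → Ω → E n) : (n : ℕ) → BddMeas (E n) → Ω → ℝ
  | 0, f, ω => √(N : ℝ) * ((∫ x, f.1 x ∂(empirical fun i => ξ 0 i ω)) - ∫ x, f.1 x ∂(S.η 0))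
  | n + 1, f, ω => √(N : ℝ) * ((∫ x, f.1 x ∂(empirical fun i => ξ (n + 1) i ω))
      - ∫ x, (∫ y, f.1 y ∂(K n (S.massN ξ n ω) (empirical fun i => ξ n i ω) x))
          ∂(empirical fun i => ξ n i ω))

/-- `V_n^{γ,N} = √N (γ_n^N - γ_n)`, where `γ_n^N = γ_n^N(1) η_n^N`. -/
def VγN (ξ : ∀ n, Fin N → Ω → E n) (n : ℕ) (f : BddMeas (E n)) (ω : Ω) : ℝ :=
  √(N : ℝ) * (S.massN ξ n ω * (∫ x, f.1 x ∂(empirical fun i => ξ n i ω))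
    - ∫ x, f.1 x ∂(S.γ n))

/-- `V_n^{η,N} = √N (η_n^N - η_n)`. -/
def VηN (ξ : ∀ n, Fin N → Ω → E n) (n : ℕ) (f : BddMeas (E n)) (ω : Ω) : ℝ :=
  √(N : ℝ) * ((∫ x, f.1 x ∂(empirical fun i => ξ n i ω)) - ∫ x, f.1 x ∂(S.η n))

end Particles

/-- The limiting covariance: `η_0([f - η_0(f)][g - η_0(g)])` at time `0`, and
`η_n K ([f - K(f)][g - K(g)])` with `K = K_{n+1,(γ_n(1),η_n)}` at time `n + 1`. -/
def limitCov (K : ∀ n, ℝ → Measure (E n) → Kernel (E n) (E (n + 1))) :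
    (n : ℕ) → BddMeas (E n) → BddMeas (E n) → ℝ
  | 0, f, g => ∫ x, (f.1 x - ∫ y, f.1 y ∂(S.η 0)) * (g.1 x - ∫ y, g.1 y ∂(S.η 0)) ∂(S.η 0)
  | n + 1, f, g => ∫ x, (∫ y,
      (f.1 y - ∫ z, f.1 z ∂(K n (S.mass n) (S.η n) x))
        * (g.1 y - ∫ z, g.1 z ∂(K n (S.mass n) (S.η n) x))
      ∂(K n (S.mass n) (S.η n) x)) ∂(S.η n)

section Limits

variable {Ω' : Type w}

/-- `V_n^γ(f) = ∑_{p=0}^n γ_p(1) W_p(Q_{p,n}(f))`. -/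
def Vγ (W : ∀ n, BddMeas (E n) → Ω' → ℝ) (n : ℕ) (f : BddMeas (E n)) (ω : Ω') : ℝ :=
  ∑ p ∈ Finset.range (n + 1), S.mass p * W p (S.Qsg p n f) ω

/-- `V_n^η(f) = V_n^γ((f - η_n(f)) / γ_n(1))`. -/
def Vη (W : ∀ n, BddMeas (E n) → Ω' → ℝ) (n : ℕ) (f : BddMeas (E n)) (ω : Ω') : ℝ :=
  S.Vγ W n ((S.mass n)⁻¹ • (f - BddMeas.const (E n) (∫ x, f.1 x ∂(S.η n)))) ω

/-- `(W_n)` is a sequence of independent centered Gaussian fields on the spaces `𝓑(E n)`, with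
covariance functions `limitCov`. -/
structure IsLimitField [MeasurableSpace Ω'] (P' : Measure Ω')
    (K : ∀ n, ℝ → Measure (E n) → Kernel (E n) (E (n + 1)))
    (W : ∀ n, BddMeas (E n) → Ω' → ℝ) : Prop where
  measurable : ∀ n f, Measurable (W n f)
  gaussian : ∀ n, IsGaussianProcess (W n) P'
  centered : ∀ n f, ∫ ω, W n f ω ∂P' = 0
  indep : iIndepFun (fun n ω f => W n f ω) P'
  covariance : ∀ n f g, ∫ ω, W n f ω * W n g ω ∂P' = S.limitCov K n f g

end Limits

end Model

/-- Convergence in law of random fields indexed by `I`: for every finite list of indices, the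
random vectors of the values of the fields converge in distribution. -/
def FieldsTendstoInLaw {I : Type u} {Ω : ℕ → Type v} [∀ N, MeasurableSpace (Ω N)]
    {Ω' : Type w} [MeasurableSpace Ω'] (X : ∀ N, I → Ω N → ℝ) (Z : I → Ω' → ℝ)
    (P : ∀ N, Measure (Ω N)) [∀ N, IsProbabilityMeasure (P N)]
    (P' : Measure Ω') [IsProbabilityMeasure P'] : Prop :=
  ∀ (d : ℕ) (s : Fin d → I),
    TendstoInDistribution (fun N ω i => X N (s i) ω) atTop (fun ω i => Z (s i) ω) P P'

end SpatialBranching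

end

/-!
The fluctuations of the particle measures are an explicit function of the local errors, and the
local errors are, conditionally on the past, normalised sums of independent centered bounded
variables.

**Decomposition.** The measures `m η Q_{n+1} + μ_{n+1}` are proportional to `Γ²_{n+1}(m, η)`, so
that the compatibility of the McKean transitions gives, with no error term,
`V_n^{γ,N}(f) = ∑_{p ≤ n} γ_p^N(1) W_p^N(Q_{p,n} f)` (`Model.VγN_eq_sum`). The particle masses `γ_p^N(1)` lie between
positive constants (`Model.exists_massN_bounds`) and the local errors are bounded in `L²`
(`Model.integral_WN_sq_le`). Hence the fluctuations are bounded in `L²`, which is a law of large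
numbers with rate `1 / N` for the masses and the empirical measures
(`Model.exists_integral_sqDev_le`).

**Central limit theorem.** Characteristic functions are computed one time step after the other.
Given the past, a product of characteristic functions of bounded centered variables divided by
`√N` is within `O(N ^ (-1/2))` of the Gaussian characteristic function of the same variance
(`norm_prod_integral_exp_sub_exp_le`). The conditional variance is nearly deterministic, by
continuity of the transitions at the limiting flow and the law of large numbers
(`Model.exists_abs_condVar_sub_limitCov_le`); away from the flow, where continuity says nothing,
the deviation of the variance is bounded by a multiple of the squared distance to the flow, whose
mean is `O(1 / N)`. Continuity is only assumed along measures carried by a set of full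
`η_n`-measure; the particles stay in it because they avoid the null sets of the flow
(`Model.ae_notMem_of_η_eq_zero`). The Gaussian factors of the successive times multiply
(`Model.tendsto_integral_exp_sum_WN`), which gives the independence of the limits.

**Limit.** The limiting covariance at time `n + 1` is the scalar product of the functions
`f(y) - K(f)(x)` in `L²(η_n(dx) K(x, dy))` (`Model.exists_featureMap`). The limiting field is the
composition of these feature maps, put in orthogonal summands of one Hilbert space, with an
isonormal Gaussian process (`exists_isonormal`), so it is almost surely linear, jointly Gaussian,
and independent at different times (`Model.exists_limitField`).

**Conclusion.** Replacing `γ_p^N(1)` by `γ_p(1)` in the decomposition, and the factor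
`γ_n(1) / γ_n^N(1)` that relates `V^{η,N}` to `V^{γ,N}` by `1`, costs `O(N ^ (-1/2))` in `L¹`. The
Cramér–Wold device and Lévy's theorem (`fieldsTendstoInLaw_of_integral_exp`) conclude.
-/

/-! ### Isonormal Gaussian processes -/

namespace SpatialBranching

/-- The map `x ↦ exp (i x)` is `1`-Lipschitz. -/
theorem norm_exp_mul_I_sub_exp_mul_I_le (a b : ℝ) :
    ‖Complex.exp (a * Complex.I) - Complex.exp (b * Complex.I)‖ ≤ |a - b| := by
  have h : Complex.exp (a * Complex.I) - Complex.exp (b * Complex.I)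
      = Complex.exp (b * Complex.I) * (Complex.exp (Complex.I * ((a - b : ℝ) : ℂ)) - 1) := by
    rw [mul_sub, ← Complex.exp_add]
    push_cast
    ring_nf
  rw [h, norm_mul, Complex.norm_exp_ofReal_mul_I, one_mul]
  simpa using Real.norm_exp_I_mul_ofReal_sub_one_le (x := a - b)

section Isonormal

/-- The map `X ↦ 𝔼 exp (i X)` is `1`-Lipschitz on `L²`. -/
theorem continuous_integral_exp_Lp {Ω : Type u} [MeasurableSpace Ω] (P : Measure Ω)
    [IsProbabilityMeasure P] :
    Continuous fun X : Lp ℝ 2 P => ∫ ω, Complex.exp (X ω * Complex.I) ∂P := by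
  have hint : ∀ X : Lp ℝ 2 P, Integrable (fun ω => Complex.exp (X ω * Complex.I)) P := fun X => by
    refine Integrable.of_bound (C := 1) ?_ (ae_of_all _ fun ω => by
      rw [Complex.norm_exp_ofReal_mul_I])
    have := (Lp.aestronglyMeasurable X).aemeasurable
    exact (by fun_prop :
      AEMeasurable (fun ω => Complex.exp (X ω * Complex.I)) P).aestronglyMeasurable
  refine LipschitzWith.continuous (K := 1) (LipschitzWith.of_dist_le_mul fun X Y => ?_)
  rw [dist_eq_norm, dist_eq_norm, ← integral_sub (hint X) (hint Y), NNReal.coe_one, one_mul]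
  have hXY : MemLp (fun ω => X ω - Y ω) 2 P := (Lp.memLp X).sub (Lp.memLp Y)
  calc ‖∫ ω, (Complex.exp (X ω * Complex.I) - Complex.exp (Y ω * Complex.I)) ∂P‖
      ≤ ∫ ω, ‖X ω - Y ω‖ ∂P :=
        norm_integral_le_of_norm_le (hXY.integrable (by norm_num)).norm
          (ae_of_all _ fun ω => norm_exp_mul_I_sub_exp_mul_I_le _ _)
    _ = (eLpNorm (fun ω => X ω - Y ω) 1 P).toReal := by
        rw [integral_norm_eq_lintegral_enorm hXY.1, eLpNorm_one_eq_lintegral_enorm]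
    _ ≤ (eLpNorm (fun ω => X ω - Y ω) 2 P).toReal :=
        ENNReal.toReal_mono hXY.eLpNorm_ne_top
          (eLpNorm_le_eLpNorm_of_exponent_le (by norm_num) hXY.1)
    _ = ‖X - Y‖ := by
        rw [Lp.norm_def]
        congr 1
        exact eLpNorm_congr_ae (Lp.coeFn_sub X Y).symm

theorem coeFn_finset_sum_Lp {Ω : Type u} [MeasurableSpace Ω] {P : Measure Ω} {κ : Type v}
    (s : Finset κ) (X : κ → Lp ℝ 2 P) :
    ((∑ i ∈ s, X i : Lp ℝ 2 P) : Ω → ℝ) =ᵐ[P] fun ω => ∑ i ∈ s, X i ω := by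
  classical
  induction s using Finset.induction_on with
  | empty => simpa using! Lp.coeFn_zero ℝ 2 P
  | insert a s ha ih =>
    rw [Finset.sum_insert ha]
    filter_upwards [Lp.coeFn_add (X a) (∑ i ∈ s, X i), ih] with ω h1 h2
    rw [h1, Finset.sum_insert ha, Pi.add_apply, h2]

variable (ι : Type u)

/-- The product, over an index set of any size, of standard Gaussian laws. -/
noncomputable abbrev stdGaussianPi : Measure (ι → ℝ) :=
  Measure.infinitePi fun _ => gaussianReal 0 1

theorem map_eval_stdGaussianPi (i : ι) :
    (stdGaussianPi ι).map (fun ω => ω i) = gaussianReal 0 1 :=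
  Measure.infinitePi_map_eval _ i

theorem hasGaussianLaw_eval_stdGaussianPi (i : ι) :
    HasGaussianLaw (fun ω : ι → ℝ => ω i) (stdGaussianPi ι) :=
  ⟨by rw [map_eval_stdGaussianPi]; infer_instance⟩

/-- The coordinates, as elements of `L²`. -/
noncomputable def coordLp (i : ι) : Lp ℝ 2 (stdGaussianPi ι) :=
  (hasGaussianLaw_eval_stdGaussianPi ι i).memLp_two.toLp _

theorem orthonormal_coordLp : Orthonormal ℝ (coordLp ι) := by
  classical
  have hmean : ∀ i, ∫ ω : ι → ℝ, ω i ∂(stdGaussianPi ι) = 0 := fun i => by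
    have := integral_map (μ := stdGaussianPi ι) (φ := fun ω => ω i) (f := fun x : ℝ => x)
      (measurable_pi_apply i).aemeasurable (by fun_prop)
    rw [← this, map_eval_stdGaussianPi, integral_id_gaussianReal]
  have hsq : ∀ i, ∫ ω : ι → ℝ, ω i * ω i ∂(stdGaussianPi ι) = 1 := fun i => by
    have := integral_map (μ := stdGaussianPi ι) (φ := fun ω => ω i) (f := fun x : ℝ => x * x)
      (measurable_pi_apply i).aemeasurable (by fun_prop)
    rw [← this, map_eval_stdGaussianPi]
    have hv := variance_fun_id_gaussianReal (μ := 0) (v := 1)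
    rw [variance_of_integral_eq_zero (by fun_prop) integral_id_gaussianReal] at hv
    simpa [sq] using hv
  rw [orthonormal_iff_ite]
  intro i j
  rw [MeasureTheory.L2.inner_def]
  have h : ∫ ω, inner ℝ ((coordLp ι i) ω) ((coordLp ι j) ω) ∂(stdGaussianPi ι)
      = ∫ ω : ι → ℝ, ω i * ω j ∂(stdGaussianPi ι) := by
    refine integral_congr_ae ?_
    filter_upwards [(hasGaussianLaw_eval_stdGaussianPi ι i).memLp_two.coeFn_toLp,
      (hasGaussianLaw_eval_stdGaussianPi ι j).memLp_two.coeFn_toLp] with ω h1 h2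
    simp only [coordLp, h1, h2]
    simp [mul_comm]
  rw [h]
  split_ifs with hij
  · rw [hij, hsq]
  · have hind : iIndepFun (fun (i : ι) (ω : ι → ℝ) => ω i) (stdGaussianPi ι) :=
      iIndepFun_infinitePi (X := fun _ x => x) (fun _ => measurable_id)
    have := (hind.indepFun hij).integral_fun_mul_eq_mul_integral
      (measurable_pi_apply i).aestronglyMeasurable (measurable_pi_apply j).aestronglyMeasurable
    rw [this, hmean, zero_mul]

/-- The characteristic function of a finite linear combination of independent standard Gaussian
variables. -/
theorem integral_exp_sum_stdGaussianPi (s : Finset ι) (c : ι → ℝ) :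
    ∫ ω, Complex.exp ((∑ i ∈ s, c i * ω i : ℝ) * Complex.I) ∂(stdGaussianPi ι)
      = Complex.exp (-((∑ i ∈ s, c i ^ 2 : ℝ) : ℂ) / 2) := by
  have hind : iIndepFun (fun (i : s) (ω : ι → ℝ) => ω i) (stdGaussianPi ι) :=
    (iIndepFun_infinitePi (P := fun _ : ι => gaussianReal 0 1) (X := fun _ x => x)
      (fun _ => measurable_id)).precomp Subtype.val_injective
  have h1 : ∀ ω : ι → ℝ, Complex.exp ((∑ i ∈ s, c i * ω i : ℝ) * Complex.I)
      = ∏ i : s, Complex.exp ((c i : ℂ) * ω i * Complex.I) := fun ω => by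
    rw [← Complex.exp_sum, ← Finset.sum_coe_sort, ← Finset.sum_mul]
    push_cast
    rfl
  simp_rw [h1]
  rw [hind.integral_fun_prod_comp
    (f := fun (i : s) (x : ℝ) => Complex.exp ((c i : ℂ) * x * Complex.I))
    (fun i => (measurable_pi_apply (i : ι)).aemeasurable) (by fun_prop)]
  have h2 : ∀ i : s, ∫ ω : ι → ℝ, Complex.exp ((c i : ℂ) * ω i * Complex.I) ∂(stdGaussianPi ι)
      = Complex.exp (-(c i : ℂ) ^ 2 / 2) := fun i => by
    have := integral_map (μ := stdGaussianPi ι) (φ := fun ω => ω i)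
      (f := fun x : ℝ => Complex.exp ((c i : ℂ) * x * Complex.I))
      (measurable_pi_apply (i : ι)).aemeasurable (by fun_prop)
    rw [← this, map_eval_stdGaussianPi, ← charFun_apply_real, charFun_gaussianReal]
    congr 1
    simp
    ring
  rw [Finset.prod_congr rfl fun i _ => h2 i, ← Complex.exp_sum,
    Finset.sum_coe_sort s (fun i => -(c i : ℂ) ^ 2 / 2)]
  push_cast
  rw [← Finset.sum_div, Finset.sum_neg_distrib]

/-- **Isonormal Gaussian process.** Every real Hilbert space embeds isometrically into a space of
square integrable random variables, each vector `h` being sent to a centered Gaussian variable of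
variance `‖h‖²`. -/
theorem exists_isonormal (H : Type u) [NormedAddCommGroup H] [InnerProductSpace ℝ H]
    [CompleteSpace H] :
    ∃ (Ω : Type u) (_ : MeasurableSpace Ω) (P : Measure Ω) (_ : IsProbabilityMeasure P)
      (T : H →ₗᵢ[ℝ] Lp ℝ 2 P),
      ∀ h, ∫ ω, Complex.exp (T h ω * Complex.I) ∂P = Complex.exp (-((‖h‖ ^ 2 : ℝ) : ℂ) / 2) := by
  obtain ⟨w, b, -⟩ := exists_hilbertBasis ℝ H
  let T₀ := (orthonormal_coordLp w).orthogonalFamily.linearIsometry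
  let T : H →ₗᵢ[ℝ] Lp ℝ 2 (stdGaussianPi w) := T₀.comp b.repr.toLinearIsometry
  have hTb : ∀ i, T (b i) = coordLp w i := fun i => by
    classical
    simp only [T, T₀, LinearIsometry.coe_comp, Function.comp_apply,
      LinearIsometryEquiv.coe_toLinearIsometry, HilbertBasis.repr_self]
    rw [OrthogonalFamily.linearIsometry_apply_single]
    simp
  refine ⟨w → ℝ, inferInstance, stdGaussianPi w, inferInstance, T, ?_⟩
  have hdense : Dense (Submodule.span ℝ (Set.range b) : Set H) :=
    Submodule.dense_iff_topologicalClosure_eq_top.2 b.dense_span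
  -- both sides are continuous in `h`, so finite combinations of the basis vectors suffice
  refine fun h => congrFun (Continuous.ext_on hdense
    (f := fun h => ∫ ω, Complex.exp (T h ω * Complex.I) ∂(stdGaussianPi w))
    ((continuous_integral_exp_Lp _).comp T.continuous)
    (g := fun h => Complex.exp (-((‖h‖ ^ 2 : ℝ) : ℂ) / 2)) (by fun_prop) ?_) h
  intro x hx
  obtain ⟨c, rfl⟩ := (Finsupp.mem_span_range_iff_exists_finsupp).1 hx
  have hT : T (c.sum fun i a => a • b i) = ∑ i ∈ c.support, c i • coordLp w i := by
    simp [Finsupp.sum, hTb]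
  have hnorm : ‖c.sum fun i a => a • b i‖ ^ 2 = ∑ i ∈ c.support, c i ^ 2 := by
    rw [← real_inner_self_eq_norm_sq, Finsupp.sum, b.orthonormal.inner_sum]
    simp [sq]
  have hae : (T (c.sum fun i a => a • b i) : (w → ℝ) → ℝ) =ᵐ[stdGaussianPi w]
      fun ω => ∑ i ∈ c.support, c i * ω i := by
    rw [hT]
    refine (coeFn_finset_sum_Lp _ _).trans ?_
    have : ∀ i ∈ c.support, ∀ᵐ ω ∂(stdGaussianPi w),
        (c i • coordLp w i : Lp ℝ 2 _) ω = c i * ω i := by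
      intro i _
      filter_upwards [Lp.coeFn_smul (c i) (coordLp w i),
        (hasGaussianLaw_eval_stdGaussianPi w i).memLp_two.coeFn_toLp] with ω h1 h2
      rw [h1, Pi.smul_apply, coordLp, h2, smul_eq_mul]
    filter_upwards [(Finset.eventually_all _).2 this] with ω hω
    exact Finset.sum_congr rfl hω
  beta_reduce
  rw [hnorm, ← integral_exp_sum_stdGaussianPi w c.support c]
  refine integral_congr_ae ?_
  filter_upwards [hae] with ω hω
  rw [hω]

/-- In an isonormal process, the law of `T h` is recovered from the values of the characteristic
function at `1`, because `t • T h = T (t • h)`. -/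
theorem hasLaw_of_isonormal {H : Type u} [NormedAddCommGroup H] [InnerProductSpace ℝ H]
    {Ω : Type u} [MeasurableSpace Ω] {P : Measure Ω} [IsProbabilityMeasure P]
    {T : H →ₗᵢ[ℝ] Lp ℝ 2 P}
    (hT : ∀ h, ∫ ω, Complex.exp (T h ω * Complex.I) ∂P
      = Complex.exp (-((‖h‖ ^ 2 : ℝ) : ℂ) / 2)) (h : H) :
    P.map (T h) = gaussianReal 0 (‖h‖ ^ 2).toNNReal := by
  have hm : AEMeasurable (T h) P := (Lp.aestronglyMeasurable (T h)).aemeasurable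
  have := Measure.isProbabilityMeasure_map hm
  refine Measure.ext_of_charFun (funext fun t => ?_)
  rw [charFun_apply_real, integral_map hm (by fun_prop), charFun_gaussianReal]
  have h1 : ∫ ω, Complex.exp ((t : ℂ) * (T h ω : ℂ) * Complex.I) ∂P
      = ∫ ω, Complex.exp (T (t • h) ω * Complex.I) ∂P := by
    refine integral_congr_ae ?_
    rw [map_smul]
    filter_upwards [Lp.coeFn_smul t (T h)] with ω hω
    rw [hω]
    simp
  rw [h1, hT, norm_smul, mul_pow]
  congr 1
  simp only [Real.norm_eq_abs, sq_abs, Real.coe_toNNReal', sq_nonneg, sup_of_le_left]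
  push_cast
  ring

end Isonormal
end SpatialBranching

/-! ### Characteristic functions and conditional laws -/

namespace SpatialBranching

section CramerWold

/-- **Cramér–Wold device** combined with Lévy's continuity theorem: convergence in law of random
fields follows from the convergence of `𝔼 exp (i ∑ t_i X(s_i))` for all finite lists of indices
`s` and of coefficients `t`. -/
theorem fieldsTendstoInLaw_of_integral_exp {I : Type u} {Ω : ℕ → Type v}
    [∀ N, MeasurableSpace (Ω N)] {Ω' : Type w} [MeasurableSpace Ω']
    {X : ∀ N, I → Ω N → ℝ} {Z : I → Ω' → ℝ}
    {P : ∀ N, Measure (Ω N)} [∀ N, IsProbabilityMeasure (P N)]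
    {P' : Measure Ω'} [IsProbabilityMeasure P']
    (hX : ∀ N i, Measurable (X N i)) (hZ : ∀ i, Measurable (Z i))
    (h : ∀ (d : ℕ) (s : Fin d → I) (t : Fin d → ℝ),
      Tendsto (fun N => ∫ ω, Complex.exp ((∑ i, t i * X N (s i) ω : ℝ) * Complex.I) ∂(P N)) atTop
        (𝓝 (∫ ω, Complex.exp ((∑ i, t i * Z (s i) ω : ℝ) * Complex.I) ∂P'))) :
    FieldsTendstoInLaw X Z P P' := by
  intro d s
  have hmX : ∀ N, Measurable fun ω => WithLp.toLp 2 fun i => X N (s i) ω := fun N =>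
    (WithLp.measurable_toLp 2 _).comp (measurable_pi_lambda _ fun i => hX N (s i))
  have hmZ : Measurable fun ω => WithLp.toLp 2 fun i => Z (s i) ω :=
    (WithLp.measurable_toLp 2 _).comp (measurable_pi_lambda _ fun i => hZ (s i))
  have key : TendstoInDistribution (E := EuclideanSpace ℝ (Fin d))
      (fun N ω => WithLp.toLp 2 fun i => X N (s i) ω) atTop
      (fun ω => WithLp.toLp 2 fun i => Z (s i) ω) P P' := by
    refine ⟨fun N => (hmX N).aemeasurable, hmZ.aemeasurable, ?_⟩
    refine ProbabilityMeasure.tendsto_iff_tendsto_charFun.2 fun t => ?_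
    have e1 : ∀ N, charFun ((P N).map fun ω => WithLp.toLp 2 fun i => X N (s i) ω) t
        = ∫ ω, Complex.exp ((∑ i, t i * X N (s i) ω : ℝ) * Complex.I) ∂(P N) := fun N => by
      rw [charFun_apply, integral_map (hmX N).aemeasurable (by fun_prop)]
      simp [PiLp.inner_apply]
    have e2 : charFun (P'.map fun ω => WithLp.toLp 2 fun i => Z (s i) ω) t
        = ∫ ω, Complex.exp ((∑ i, t i * Z (s i) ω : ℝ) * Complex.I) ∂P' := by
      rw [charFun_apply, integral_map hmZ.aemeasurable (by fun_prop)]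
      simp [PiLp.inner_apply]
    simpa only [ProbabilityMeasure.coe_mk, e1, e2] using h d s t
  exact key.continuous_comp (g := fun x : EuclideanSpace ℝ (Fin d) => (x : Fin d → ℝ))
    (PiLp.continuous_ofLp 2 _)

end CramerWold

section CharacteristicFunction

theorem norm_prod_sub_prod_le_sum {ι : Type*} (s : Finset ι) (a b : ι → ℂ)
    (ha : ∀ i ∈ s, ‖a i‖ ≤ 1) (hb : ∀ i ∈ s, ‖b i‖ ≤ 1) :
    ‖∏ i ∈ s, a i - ∏ i ∈ s, b i‖ ≤ ∑ i ∈ s, ‖a i - b i‖ := by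
  classical
  induction s using Finset.induction_on with
  | empty => simp
  | insert j s hj ih =>
    rw [Finset.prod_insert hj, Finset.prod_insert hj, Finset.sum_insert hj]
    have hs : ‖∏ i ∈ s, b i‖ ≤ 1 := by
      rw [norm_prod]
      exact Finset.prod_le_one (fun _ _ => norm_nonneg _)
        fun i hi => hb i (Finset.mem_insert_of_mem hi)
    have ih' := ih (fun i hi => ha i (Finset.mem_insert_of_mem hi))
      (fun i hi => hb i (Finset.mem_insert_of_mem hi))
    have haj := ha j (Finset.mem_insert_self j s)
    calc ‖a j * ∏ i ∈ s, a i - b j * ∏ i ∈ s, b i‖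
        = ‖(a j - b j) * ∏ i ∈ s, b i + a j * (∏ i ∈ s, a i - ∏ i ∈ s, b i)‖ := by ring_nf
      _ ≤ ‖a j - b j‖ * ‖∏ i ∈ s, b i‖ + ‖a j‖ * ‖∏ i ∈ s, a i - ∏ i ∈ s, b i‖ := by
          refine (norm_add_le _ _).trans ?_
          rw [norm_mul, norm_mul]
      _ ≤ ‖a j - b j‖ * 1 + 1 * ‖∏ i ∈ s, a i - ∏ i ∈ s, b i‖ := by gcongr
      _ ≤ _ := by linarith

theorem integrable_of_measurable_of_abs_le {F : Type*} [MeasurableSpace F] (ν : Measure F)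
    [IsFiniteMeasure ν] {g : F → ℝ} (hg : Measurable g) {B : ℝ} (hB : ∀ y, |g y| ≤ B) :
    Integrable g ν :=
  Integrable.of_bound hg.aestronglyMeasurable B (ae_of_all _ hB)

/-- Second order expansion of the characteristic function of a bounded centered variable,
compared with the Gaussian characteristic function of the same variance. Both are close to
`1 - σ² / 2`. -/
theorem norm_integral_exp_sub_exp_variance_le {F : Type*} [MeasurableSpace F] (ν : Measure F)
    [IsProbabilityMeasure ν] {g : F → ℝ} (hg : Measurable g) {B : ℝ} (hB : ∀ y, |g y| ≤ B)
    (hg0 : ∫ y, g y ∂ν = 0) :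
    ‖∫ y, Complex.exp (g y * Complex.I) ∂ν - Complex.exp (-((∫ y, g y ^ 2 ∂ν : ℝ) : ℂ) / 2)‖
      ≤ B ^ 3 * Real.exp B + B ^ 4 * Real.exp (B ^ 2) := by
  have hB0 : 0 ≤ B := by
    have : Nonempty F := nonempty_of_isProbabilityMeasure ν
    exact (abs_nonneg _).trans (hB this.some)
  have hi1 := integrable_of_measurable_of_abs_le ν hg hB
  have hi2 : Integrable (fun y => g y ^ 2) ν :=
    integrable_of_measurable_of_abs_le ν (hg.pow_const 2) (B := B ^ 2) fun y => by
      rw [abs_pow]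
      exact pow_le_pow_left₀ (abs_nonneg _) (hB y) 2
  set σ := ∫ y, g y ^ 2 ∂ν with hσ
  have hσ0 : 0 ≤ σ := integral_nonneg fun y => sq_nonneg _
  have hσB : σ ≤ B ^ 2 := by
    calc σ ≤ ∫ _, B ^ 2 ∂ν := integral_mono hi2 (integrable_const _) fun y => by
          rw [← sq_abs]
          exact pow_le_pow_left₀ (abs_nonneg _) (hB y) 2
      _ = B ^ 2 := by simp
  have hie : Integrable (fun y => Complex.exp (g y * Complex.I)) ν :=
    Integrable.of_bound (C := 1) (by fun_prop) (ae_of_all _ fun ω => by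
      rw [Complex.norm_exp_ofReal_mul_I])
  have hiq : Integrable (fun y => (1 + (g y : ℂ) * Complex.I - ((g y ^ 2 : ℝ) : ℂ) / 2)) ν :=
    ((integrable_const _).add (hi1.ofReal.mul_const _)).sub (hi2.ofReal.div_const _)
  have hq : ∫ y, (1 + (g y : ℂ) * Complex.I - ((g y ^ 2 : ℝ) : ℂ) / 2) ∂ν = 1 - (σ : ℂ) / 2 := by
    rw [integral_sub ((integrable_const _).add (hi1.ofReal.mul_const _)) (hi2.ofReal.div_const _),
      integral_add (integrable_const _) (hi1.ofReal.mul_const _), integral_mul_const,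
      integral_div, integral_complex_ofReal, integral_complex_ofReal, hg0]
    simp [hσ]
  have h1 : ‖∫ y, Complex.exp (g y * Complex.I) ∂ν - (1 - (σ : ℂ) / 2)‖ ≤ B ^ 3 * Real.exp B := by
    rw [← hq, ← integral_sub hie hiq]
    refine (norm_integral_le_of_norm_le_const (C := B ^ 3 * Real.exp B)
      (ae_of_all _ fun y => ?_)).trans (by simp)
    have := Complex.norm_exp_sub_sum_le_norm_mul_exp ((g y : ℂ) * Complex.I) 3
    simp only [Finset.sum_range_succ, Finset.sum_range_zero, norm_mul, Complex.norm_real,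
      Complex.norm_I, mul_one, Real.norm_eq_abs] at this
    have e : (1 + (g y : ℂ) * Complex.I - ((g y ^ 2 : ℝ) : ℂ) / 2)
        = 0 + ((g y : ℂ) * Complex.I) ^ 0 / (Nat.factorial 0 : ℂ)
          + ((g y : ℂ) * Complex.I) ^ 1 / (Nat.factorial 1 : ℂ)
          + ((g y : ℂ) * Complex.I) ^ 2 / (Nat.factorial 2 : ℂ) := by
      rw [mul_pow _ _ 2, Complex.I_sq]
      simp [Nat.factorial]
      ring
    rw [e]
    refine this.trans ?_
    gcongr
    · exact hB y
    · exact hB y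
  have h2 : ‖(1 - (σ : ℂ) / 2) - Complex.exp (-(σ : ℂ) / 2)‖ ≤ B ^ 4 * Real.exp (B ^ 2) := by
    have := Complex.norm_exp_sub_sum_le_norm_mul_exp (-(σ : ℂ) / 2) 2
    simp only [Finset.sum_range_succ, Finset.sum_range_zero, norm_div, norm_neg, Complex.norm_real,
      Real.norm_eq_abs, abs_of_nonneg hσ0, Complex.norm_ofNat] at this
    rw [norm_sub_rev]
    have e : (1 - (σ : ℂ) / 2) = 0 + (-(σ : ℂ) / 2) ^ 0 / (Nat.factorial 0 : ℂ)
          + (-(σ : ℂ) / 2) ^ 1 / (Nat.factorial 1 : ℂ) := by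
      simp
      ring
    rw [e]
    refine this.trans ?_
    have h3 : σ / 2 ≤ B ^ 2 := by linarith
    calc (σ / 2) ^ 2 * Real.exp (σ / 2) ≤ (B ^ 2) ^ 2 * Real.exp (B ^ 2) := by gcongr
      _ = _ := by ring
  calc _ ≤ ‖∫ y, Complex.exp (g y * Complex.I) ∂ν - (1 - (σ : ℂ) / 2)‖
      + ‖(1 - (σ : ℂ) / 2) - Complex.exp (-(σ : ℂ) / 2)‖ := norm_sub_le_norm_sub_add_norm_sub _ _ _
    _ ≤ _ := add_le_add h1 h2

/-- Normal approximation for a normalised sum of `N` independent variables bounded by `C`,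
centered at their means: the error is `O(N ^ (-1/2))`, uniformly in the laws. -/
theorem norm_prod_integral_exp_sub_exp_le {F : Type*} [MeasurableSpace F] {N : ℕ} (hN : 1 ≤ N)
    (ν : Fin N → Measure F) [∀ j, IsProbabilityMeasure (ν j)] {f : F → ℝ} (hf : Measurable f)
    {C : ℝ} (hC : ∀ y, |f y| ≤ C) :
    ‖∏ j, ∫ y, Complex.exp (((f y - ∫ z, f z ∂(ν j)) / √(N : ℝ) : ℝ) * Complex.I) ∂(ν j)
      - Complex.exp (-(((N : ℝ)⁻¹ * ∑ j, ∫ y, (f y - ∫ z, f z ∂(ν j)) ^ 2 ∂(ν j) : ℝ) : ℂ) / 2)‖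
      ≤ ((2 * C) ^ 3 * Real.exp (2 * C) + (2 * C) ^ 4 * Real.exp ((2 * C) ^ 2)) / √(N : ℝ) := by
  have hN0 : (0 : ℝ) < N := by exact_mod_cast hN
  have hC0 : 0 ≤ C := by
    have : Nonempty F := nonempty_of_isProbabilityMeasure (ν ⟨0, hN⟩)
    exact (abs_nonneg _).trans (hC this.some)
  have hs1 : (1 : ℝ) ≤ √(N : ℝ) := by
    rw [Real.one_le_sqrt]
    exact_mod_cast hN
  have hs0 : 0 < √(N : ℝ) := by linarith
  have hss : √(N : ℝ) ^ 2 = N := Real.sq_sqrt hN0.le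
  have hint : ∀ j, Integrable f (ν j) := fun j => integrable_of_measurable_of_abs_le _ hf hC
  have hc : ∀ j, |∫ z, f z ∂(ν j)| ≤ C := fun j => by
    simpa using norm_integral_le_of_norm_le_const (μ := ν j) (f := f) (ae_of_all _ hC)
  set g : Fin N → F → ℝ := fun j y => (f y - ∫ z, f z ∂(ν j)) / √(N : ℝ) with hg
  have hgm : ∀ j, Measurable (g j) := fun j => (hf.sub_const _).div_const _
  set B := 2 * C / √(N : ℝ) with hB
  have hB0 : 0 ≤ B := by positivity
  have hB2 : B ≤ 2 * C := div_le_self (by positivity) hs1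
  have hgB : ∀ j y, |g j y| ≤ B := fun j y => by
    rw [hg, hB, abs_div, abs_of_pos hs0]
    gcongr
    exact (abs_sub _ _).trans (by linarith [hC y, hc j])
  have hg0 : ∀ j, ∫ y, g j y ∂(ν j) = 0 := fun j => by
    simp only [hg]
    rw [integral_div, integral_sub (hint j) (integrable_const _)]
    simp
  have hg2 : ∀ j, ∫ y, g j y ^ 2 ∂(ν j)
      = (N : ℝ)⁻¹ * ∫ y, (f y - ∫ z, f z ∂(ν j)) ^ 2 ∂(ν j) := fun j => by
    simp only [hg, div_pow, hss]
    rw [integral_div]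
    field_simp
  have e : Complex.exp (-(((N : ℝ)⁻¹ * ∑ j, ∫ y, (f y - ∫ z, f z ∂(ν j)) ^ 2 ∂(ν j) : ℝ) : ℂ) / 2)
      = ∏ j, Complex.exp (-((∫ y, g j y ^ 2 ∂(ν j) : ℝ) : ℂ) / 2) := by
    rw [← Complex.exp_sum]
    simp_rw [hg2]
    congr 1
    push_cast
    rw [← Finset.sum_div, Finset.sum_neg_distrib, Finset.mul_sum]
  rw [e]
  refine (norm_prod_sub_prod_le_sum _ _ _ (fun j _ => ?_) (fun j _ => ?_)).trans ?_
  · refine (norm_integral_le_of_norm_le_const (C := 1) (ae_of_all _ fun y => ?_)).trans (by simp)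
    rw [Complex.norm_exp_ofReal_mul_I]
  · rw [Complex.norm_exp]
    have : 0 ≤ ∫ y, g j y ^ 2 ∂(ν j) := integral_nonneg fun y => sq_nonneg _
    rw [Real.exp_le_one_iff, ← Complex.ofReal_neg, ← Complex.ofReal_ofNat, ← Complex.ofReal_div,
      Complex.ofReal_re]
    linarith
  · calc ∑ j, ‖_‖ ≤ ∑ j : Fin N, (B ^ 3 * Real.exp B + B ^ 4 * Real.exp (B ^ 2)) :=
          Finset.sum_le_sum fun j _ =>
            norm_integral_exp_sub_exp_variance_le (ν j) (hgm j) (hgB j) (hg0 j)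
      _ = N * (B ^ 3 * Real.exp B + B ^ 4 * Real.exp (B ^ 2)) := by
          rw [Finset.sum_const, Finset.card_univ, Fintype.card_fin, nsmul_eq_mul]
      _ ≤ N * (((2 * C) ^ 3 / (N * √(N : ℝ))) * Real.exp (2 * C)
            + ((2 * C) ^ 4 / (N * √(N : ℝ))) * Real.exp ((2 * C) ^ 2)) := by
          have e3 : B ^ 3 = (2 * C) ^ 3 / (N * √(N : ℝ)) := by
            rw [hB, div_pow, pow_succ (√(N : ℝ)) 2, hss]
          have e4 : B ^ 4 ≤ (2 * C) ^ 4 / (N * √(N : ℝ)) := by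
            calc B ^ 4 = B ^ 3 * B := by ring
              _ ≤ B ^ 3 * (2 * C) := by gcongr
              _ = _ := by rw [e3]; ring
          rw [e3]
          gcongr
      _ = _ := by
          field_simp

end CharacteristicFunction

section ConditionalLaw

/-- If the conditional probabilities of the events `X ∈ B` given a σ-field are given by a Markov
kernel, then integrals of functions of the past and of `X` can be computed by first integrating
against that kernel. The past is represented by a map `τ` generating the σ-field. -/
theorem map_prodMk_eq_compProd_of_condExp {Ω Ω₀ F : Type*} [MeasurableSpace Ω]
    [mΩ₀ : MeasurableSpace Ω₀] [MeasurableSpace F] {P : Measure Ω} [IsProbabilityMeasure P]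
    {τ : Ω → Ω₀} (hτ : Measurable τ) {X : Ω → F} (hX : Measurable X) (κ : Kernel Ω₀ F)
    [IsMarkovKernel κ]
    (h : ∀ B, MeasurableSet B →
      P[Set.indicator {ω | X ω ∈ B} (fun _ => (1 : ℝ)) | mΩ₀.comap τ]
        =ᵐ[P] fun ω => (κ (τ ω)).real B) :
    P.map (fun ω => (τ ω, X ω)) = (P.map τ) ⊗ₘ κ := by
  have := Measure.isProbabilityMeasure_map (μ := P) hτ.aemeasurable
  have := Measure.isProbabilityMeasure_map (μ := P) (hτ.prodMk hX).aemeasurable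
  refine Measure.ext_prod fun {A B} hA hB => ?_
  rw [Measure.map_apply (hτ.prodMk hX) (hA.prod hB), Measure.compProd_apply_prod hA hB,
    setLIntegral_map hA (κ.measurable_coe hB) hτ]
  have hm : mΩ₀.comap τ ≤ ‹MeasurableSpace Ω› := hτ.comap_le
  have hint : Integrable (Set.indicator {ω | X ω ∈ B} (fun _ => (1 : ℝ))) P :=
    (integrable_const _).indicator (hX hB)
  have h1 := setIntegral_condExp hm hint (s := τ ⁻¹' A) ⟨A, hA, rfl⟩
  rw [setIntegral_congr_ae (hτ hA) ((h B hB).mono fun ω hω _ => hω),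
    integral_indicator (show MeasurableSet {ω | X ω ∈ B} from hX hB),
    Measure.restrict_restrict (show MeasurableSet {ω | X ω ∈ B} from hX hB),
    setIntegral_const] at h1
  have h2 : ENNReal.ofReal (∫ ω in τ ⁻¹' A, (κ (τ ω)).real B ∂P)
      = ∫⁻ ω in τ ⁻¹' A, κ (τ ω) B ∂P := by
    have hmk : Measurable fun ω => κ (τ ω) B := (κ.measurable_coe hB).comp hτ
    simp only [Measure.real]
    rw [integral_toReal hmk.aemeasurable (ae_of_all _ fun ω => measure_lt_top _ _),
      ENNReal.ofReal_toReal]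
    refine ne_of_lt (lt_of_le_of_lt (lintegral_mono fun ω => prob_le_one) ?_)
    simp
  rw [← h2, h1, smul_eq_mul, mul_one, ofReal_measureReal]
  congr 1
  ext ω
  simp [and_comm]

theorem measurable_measurePi {Ω F : Type*} [MeasurableSpace Ω] [MeasurableSpace F] {ι : Type*}
    [Fintype ι] (κ : ι → Ω → Measure F) [∀ j ω, IsProbabilityMeasure (κ j ω)]
    (h : ∀ j B, MeasurableSet B → Measurable fun ω => κ j ω B) :
    Measurable fun ω => Measure.pi fun j => κ j ω := by
  refine Measurable.measure_of_isPiSystem_of_isProbabilityMeasure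
    (S := Set.pi Set.univ '' Set.pi Set.univ fun _ : ι => {s : Set F | MeasurableSet s})
    generateFrom_pi.symm isPiSystem_pi ?_
  rintro _ ⟨s, hs, rfl⟩
  simp_rw [Measure.pi_pi]
  exact Finset.measurable_prod _ fun j _ => h j (s j) (hs j (Set.mem_univ j))

end ConditionalLaw
end SpatialBranching

/-! ### Bounded functions, empirical measures and the limiting flow -/

namespace SpatialBranching

section BddMeas
variable {E F : Type u} [MeasurableSpace E] [MeasurableSpace F]

theorem BddMeas.measurable (f : BddMeas E) : Measurable f.1 := f.2.1

theorem BddMeas.exists_bound (f : BddMeas E) : ∃ C : ℝ, 0 ≤ C ∧ ∀ x, |f.1 x| ≤ C := by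
  obtain ⟨C, hC⟩ := f.2.2
  exact ⟨max C 0, le_max_right _ _, fun x => (hC x).trans (le_max_left _ _)⟩

theorem BddMeas.integrable (f : BddMeas E) (ν : Measure E) [IsFiniteMeasure ν] :
    Integrable f.1 ν := by
  obtain ⟨C, -, hC⟩ := BddMeas.exists_bound f
  exact integrable_of_measurable_of_abs_le ν (BddMeas.measurable f) hC

theorem BddMeas.abs_integral_le {f : BddMeas E} {C : ℝ} (hC : ∀ x, |f.1 x| ≤ C) (ν : Measure E)
    [IsProbabilityMeasure ν] : |∫ x, f.1 x ∂ν| ≤ C := by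
  simpa using norm_integral_le_of_norm_le_const (μ := ν) (f := f.1) (ae_of_all _ hC)

/-- The pointwise product in `𝓑(E)`. -/
def BddMeas.mul (f g : BddMeas E) : BddMeas E :=
  ⟨fun x => f.1 x * g.1 x, (BddMeas.measurable f).mul (BddMeas.measurable g), by
    obtain ⟨C, hC0, hC⟩ := BddMeas.exists_bound f
    obtain ⟨D, -, hD⟩ := BddMeas.exists_bound g
    exact ⟨C * D, fun x => by
      rw [abs_mul]
      exact mul_le_mul (hC x) (hD x) (abs_nonneg _) hC0⟩⟩

/-- Integration against a finite measure, as a linear functional on `𝓑(E)`. -/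
noncomputable def integralLin (ν : Measure E) [IsFiniteMeasure ν] : BddMeas E →ₗ[ℝ] ℝ where
  toFun f := ∫ x, f.1 x ∂ν
  map_add' f g := integral_add (BddMeas.integrable f ν) (BddMeas.integrable g ν)
  map_smul' c f := integral_const_mul c f.1

/-- The operator `kernelOp κ`, as a linear map. -/
noncomputable def kernelLin (κ : Kernel E F) [IsFiniteKernel κ] : BddMeas F →ₗ[ℝ] BddMeas E where
  toFun f := kernelOp κ f
  map_add' f g := Subtype.ext <| funext fun x => (integralLin (κ x)).map_add f g
  map_smul' c f := Subtype.ext <| funext fun x => (integralLin (κ x)).map_smul c f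

theorem integral_bind_kernel {ν : Measure E} [IsFiniteMeasure ν] {κ : Kernel E F}
    [IsFiniteKernel κ] {f : BddMeas F} :
    ∫ y, f.1 y ∂(ν.bind κ) = ∫ x, (∫ y, f.1 y ∂(κ x)) ∂ν := by
  rw [← Kernel.const_apply ν (), ← Kernel.comp_apply κ (Kernel.const Unit ν) (),
    Kernel.integral_comp (BddMeas.integrable f _)]

end BddMeas

section Empirical
variable {E : Type u} [MeasurableSpace E] {N : ℕ}

theorem isProbabilityMeasure_empirical (hN : 1 ≤ N) (x : Fin N → E) :
    IsProbabilityMeasure (empirical x) := by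
  refine ⟨?_⟩
  have : (N : ℝ≥0∞) ≠ 0 := by
    have : N ≠ 0 := by omega
    exact_mod_cast this
  simp [empirical, ENNReal.inv_mul_cancel this]

theorem integral_empirical (x : Fin N → E) {f : E → ℝ} (hf : Measurable f) :
    ∫ y, f y ∂(empirical x) = (N : ℝ)⁻¹ * ∑ i, f (x i) := by
  rw [empirical, integral_smul_measure, integral_finsetSum_measure]
  · simp [integral_dirac' f _ hf.stronglyMeasurable]
  · exact fun i _ => integrable_dirac' hf.stronglyMeasurable (by simp)

theorem empirical_apply_eq_zero {x : Fin N → E} {A : Set E} (hA : MeasurableSet A)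
    (h : ∀ i, x i ∉ A) : empirical x A = 0 := by
  simp [empirical, Measure.dirac_apply' _ hA, h]

end Empirical

namespace Model
variable {E : ℕ → Type u} [∀ n, MeasurableSpace (E n)] (S : Model E)

instance (n : ℕ) : IsMarkovKernel (S.M n) := S.isMarkov_M n
instance (n : ℕ) : IsFiniteMeasure (S.μ n) := S.isFinite_μ n

/-- The potential function, as an element of `𝓑(E n)`. -/
def Gb (n : ℕ) : BddMeas (E n) :=
  ⟨S.G n, S.measurable_G n, by
    obtain ⟨c, hc, h⟩ := S.G_lower n
    obtain ⟨C, hC⟩ := S.G_upper n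
    exact ⟨C, fun x => abs_le.2 ⟨by linarith [h x, hC x], hC x⟩⟩⟩

theorem G_pos (n : ℕ) (x : E n) : 0 < S.G n x := by
  obtain ⟨c, hc, h⟩ := S.G_lower n
  exact hc.trans_le (h x)

theorem kernelOp_Q_apply (n : ℕ) (f : BddMeas (E (n + 1))) (x : E n) :
    (kernelOp (S.Q n) f).1 x = S.G n x * ∫ y, f.1 y ∂(S.M n x) := by
  change ∫ y, f.1 y ∂(ENNReal.ofReal (S.G n x) • S.M n x) = _
  rw [integral_smul_measure, ENNReal.toReal_ofReal (S.G_pos n x).le, smul_eq_mul]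

instance isFiniteMeasure_γ : ∀ n, IsFiniteMeasure (S.γ n)
  | 0 => S.isFinite_μ 0
  | n + 1 => by
    have := isFiniteMeasure_γ n
    unfold γ
    infer_instance

theorem integral_γ_succ (n : ℕ) (f : BddMeas (E (n + 1))) :
    ∫ x, f.1 x ∂(S.γ (n + 1))
      = ∫ x, (kernelOp (S.Q n) f).1 x ∂(S.γ n) + ∫ x, f.1 x ∂(S.μ (n + 1)) := by
  change ∫ x, f.1 x ∂((S.γ n).bind (S.Q n) + S.μ (n + 1)) = _
  rw [integral_add_measure (BddMeas.integrable f _) (BddMeas.integrable f _),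
    integral_bind_kernel]
  rfl

theorem mass_eq_integral (n : ℕ) : S.mass n = ∫ x, (BddMeas.const (E n) 1).1 x ∂(S.γ n) := by
  simp [mass, BddMeas.const]

theorem mass_succ (n : ℕ) :
    S.mass (n + 1) = ∫ x, S.G n x ∂(S.γ n) + (S.μ (n + 1)).real Set.univ := by
  rw [mass_eq_integral, integral_γ_succ]
  congr 1
  · refine integral_congr_ae (ae_of_all _ fun x => ?_)
    rw [kernelOp_Q_apply]
    simp [BddMeas.const]
  · simp [BddMeas.const]

theorem mass_pos : ∀ n, 0 < S.mass n
  | 0 => by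
    have := S.μ_zero_ne
    refine lt_of_le_of_ne measureReal_nonneg fun h => this ?_
    simpa [mass, measureReal_eq_zero_iff, γ] using h.symm
  | n + 1 => by
    obtain ⟨c, hc, h⟩ := S.G_lower n
    rw [mass_succ]
    have h1 : c * S.mass n ≤ ∫ x, S.G n x ∂(S.γ n) := by
      calc c * S.mass n = ∫ _, c ∂(S.γ n) := by simp [mass, mul_comm]
        _ ≤ _ := integral_mono (integrable_const _) (BddMeas.integrable (S.Gb n) _) h
    have h2 : 0 < c * S.mass n := mul_pos hc (mass_pos n)
    have h3 : 0 ≤ (S.μ (n + 1)).real Set.univ := measureReal_nonneg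
    linarith

instance isProbabilityMeasure_η (n : ℕ) : IsProbabilityMeasure (S.η n) := by
  have h := S.mass_pos n
  have : NeZero (S.γ n) := ⟨fun h0 => by simp [mass, h0] at h⟩
  exact isProbabilityMeasureSMul

theorem integral_γ (n : ℕ) (f : E n → ℝ) :
    ∫ x, f x ∂(S.γ n) = S.mass n * ∫ x, f x ∂(S.η n) := by
  have h := S.mass_pos n
  rw [η, integral_smul_measure, smul_eq_mul, ENNReal.toReal_inv]
  change _ = S.mass n * ((S.mass n)⁻¹ * _)
  field_simp

theorem η_eq_zero_iff (n : ℕ) (B : Set (E n)) : S.η n B = 0 ↔ S.γ n B = 0 := by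
  simp [η, measure_ne_top]

variable (n : ℕ) {m : ℝ} {η : Measure (E n)} [IsProbabilityMeasure η]

theorem integral_G_pos (η : Measure (E n)) [IsProbabilityMeasure η] : 0 < ∫ x, S.G n x ∂η := by
  obtain ⟨c, hc, h⟩ := S.G_lower n
  calc 0 < c := hc
    _ = ∫ _, c ∂η := by simp
    _ ≤ _ := integral_mono (integrable_const _) (BddMeas.integrable (S.Gb n) _) h

theorem lintegral_G (η : Measure (E n)) [IsProbabilityMeasure η] :
    ∫⁻ x, ENNReal.ofReal (S.G n x) ∂η = ENNReal.ofReal (∫ x, S.G n x ∂η) :=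
  (ofReal_integral_eq_lintegral_ofReal (BddMeas.integrable (S.Gb n) η)
    (ae_of_all _ fun x => (S.G_pos n x).le)).symm

theorem isProbabilityMeasure_boltzmannGibbs (η : Measure (E n)) [IsProbabilityMeasure η] :
    IsProbabilityMeasure (S.boltzmannGibbs n η) := by
  refine ⟨?_⟩
  have h := S.integral_G_pos n η
  rw [boltzmannGibbs, Measure.smul_apply, withDensity_apply _ MeasurableSet.univ,
    Measure.restrict_univ, smul_eq_mul, lintegral_G]
  exact ENNReal.inv_mul_cancel (by simpa using h) ENNReal.ofReal_ne_top

theorem integral_boltzmannGibbs (η : Measure (E n)) [IsProbabilityMeasure η] (f : E n → ℝ) :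
    ∫ x, f x ∂(S.boltzmannGibbs n η)
      = (∫ x, S.G n x ∂η)⁻¹ * ∫ x, S.G n x * f x ∂η := by
  rw [boltzmannGibbs, integral_smul_measure, lintegral_G,
    integral_withDensity_eq_integral_toReal_smul₀
      (S.measurable_G n).ennreal_ofReal.aemeasurable (ae_of_all _ fun _ => ENNReal.ofReal_lt_top)]
  simp [ENNReal.toReal_ofReal, (S.integral_G_pos n η).le, (S.G_pos n _).le]

theorem α_mem (hm : 0 < m) (η : Measure (E n)) [IsProbabilityMeasure η] :
    0 ≤ S.α n m η ∧ S.α n m η ≤ 1 := by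
  have h1 : 0 < m * ∫ x, S.G n x ∂η := mul_pos hm (S.integral_G_pos n η)
  have h3 : 0 ≤ (S.μ (n + 1)).real Set.univ := measureReal_nonneg
  refine ⟨by unfold α; positivity, ?_⟩
  exact div_le_one_of_le₀ (by linarith) (by positivity)

theorem isFiniteMeasure_birthLaw : IsFiniteMeasure (S.birthLaw n) := by
  rcases eq_or_ne (S.μ n) 0 with h | h
  · rw [birthLaw, h]
    simp
    infer_instance
  · have : NeZero (S.μ n) := ⟨h⟩
    have : IsProbabilityMeasure (S.birthLaw n) := isProbabilityMeasureSMul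
    infer_instance

theorem integral_birthLaw (f : E n → ℝ) :
    (S.μ n).real Set.univ * ∫ x, f x ∂(S.birthLaw n) = ∫ x, f x ∂(S.μ n) := by
  rcases eq_or_ne (S.μ n) 0 with h | h
  · simp [h]
  · rw [birthLaw, integral_smul_measure, smul_eq_mul, ENNReal.toReal_inv]
    have : (S.μ n).real Set.univ ≠ 0 := by
      simpa [measureReal_eq_zero_iff] using h
    change (S.μ n).real Set.univ * (((S.μ n).real Set.univ)⁻¹ * _) = _
    field_simp

theorem isFiniteKernel_mutation (m : ℝ) (η : Measure (E n)) :
    IsFiniteKernel (S.mutation n m η) := by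
  have := S.isFiniteMeasure_birthLaw (n + 1)
  refine ⟨⟨ENNReal.ofReal (S.α n m η)
      + ENNReal.ofReal (1 - S.α n m η) * S.birthLaw (n + 1) Set.univ,
    ENNReal.add_lt_top.2 ⟨ENNReal.ofReal_lt_top,
      ENNReal.mul_lt_top ENNReal.ofReal_lt_top (measure_lt_top _ _)⟩, fun x => ?_⟩⟩
  change (ENNReal.ofReal (S.α n m η) • S.M n x
    + ENNReal.ofReal (1 - S.α n m η) • S.birthLaw (n + 1)) Set.univ ≤ _
  simp

/-- `Γ²_{n+1}(m, η)` is the probability measure proportional to `m η Q_{n+1} + μ_{n+1}`. -/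
theorem integral_Γ₂ (hm : 0 < m) (η : Measure (E n)) [IsProbabilityMeasure η]
    (f : BddMeas (E (n + 1))) :
    (m * (∫ x, S.G n x ∂η) + (S.μ (n + 1)).real Set.univ) * ∫ x, f.1 x ∂(S.Γ₂ n m η)
      = m * (∫ x, (kernelOp (S.Q n) f).1 x ∂η) + ∫ x, f.1 x ∂(S.μ (n + 1)) := by
  have := S.isProbabilityMeasure_boltzmannGibbs n η
  have := S.isFiniteKernel_mutation n m η
  have := S.isFiniteMeasure_birthLaw (n + 1)
  obtain ⟨ha0, ha1⟩ := S.α_mem n hm η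
  have hG := S.integral_G_pos n η
  have h1 : 0 < m * ∫ x, S.G n x ∂η := mul_pos hm hG
  have h3 : 0 ≤ (S.μ (n + 1)).real Set.univ := measureReal_nonneg
  have hmut : ∀ x, ∫ y, f.1 y ∂(S.mutation n m η x)
      = S.α n m η * (kernelOp (S.M n) f).1 x
        + (1 - S.α n m η) * ∫ y, f.1 y ∂(S.birthLaw (n + 1)) := fun x => by
    change ∫ y, f.1 y ∂(ENNReal.ofReal (S.α n m η) • S.M n x
      + ENNReal.ofReal (1 - S.α n m η) • S.birthLaw (n + 1)) = _
    rw [integral_add_measure ((BddMeas.integrable f _).smul_measure ENNReal.ofReal_ne_top)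
      ((BddMeas.integrable f _).smul_measure ENNReal.ofReal_ne_top), integral_smul_measure,
      integral_smul_measure, ENNReal.toReal_ofReal ha0, ENNReal.toReal_ofReal (by linarith)]
    rfl
  have hΓ : ∫ x, f.1 x ∂(S.Γ₂ n m η)
      = S.α n m η * ((∫ x, S.G n x ∂η)⁻¹ * ∫ x, (kernelOp (S.Q n) f).1 x ∂η)
        + (1 - S.α n m η) * ∫ y, f.1 y ∂(S.birthLaw (n + 1)) := by
    rw [Γ₂, integral_bind_kernel]
    simp_rw [hmut]
    rw [integral_add ((BddMeas.integrable (kernelOp (S.M n) f) _).const_mul _) (integrable_const _),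
      integral_const_mul, integral_boltzmannGibbs]
    simp_rw [kernelOp_Q_apply]
    simp [kernelOp]
  rw [hΓ, mul_add, α]
  have hb := S.integral_birthLaw (n + 1) f.1
  have hpos : 0 < m * (∫ x, S.G n x ∂η) + (S.μ (n + 1)).real Set.univ := by linarith
  congr 1
  · field_simp
  · rw [← hb]
    field_simp
    ring

section Particles
variable {K : ∀ n, ℝ → Measure (E n) → Kernel (E n) (E (n + 1))} (hK : S.IsMcKean K)
include hK

/-- The compatibility `η K_{n+1,(m,η)} = Γ²_{n+1}(m, η)` of the McKean transitions, multiplied by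
the total mass of `m η Q_{n+1} + μ_{n+1}`. When `η` is the empirical measure and `m` the particle
mass at time `n`, this factor is the particle mass at time `n + 1`. -/
theorem IsMcKean.integral_transport (hm : 0 < m) (f : BddMeas (E (n + 1))) :
    (m * (∫ x, S.G n x ∂η) + (S.μ (n + 1)).real Set.univ)
        * ∫ x, (∫ y, f.1 y ∂(K n m η x)) ∂η
      = m * (∫ x, (kernelOp (S.Q n) f).1 x ∂η) + ∫ x, f.1 x ∂(S.μ (n + 1)) := by
  have := hK.isMarkov n m η hm inferInstance
  rw [← S.integral_Γ₂ n hm η f, ← hK.transport n m η hm inferInstance,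
    integral_bind_kernel]

end Particles
end Model
end SpatialBranching

/-! ### The particle masses and the decomposition of the fluctuations -/

namespace SpatialBranching
namespace Model
variable {E : ℕ → Type u} [∀ n, MeasurableSpace (E n)] (S : Model E)

section Semigroup

theorem Qsg_self (n : ℕ) (f : BddMeas (E n)) : S.Qsg n n f = f := by
  cases n <;> simp [Qsg]

theorem Qsg_succ {p n : ℕ} (h : p ≤ n) (f : BddMeas (E (n + 1))) :
    S.Qsg p (n + 1) f = S.Qsg p n (kernelOp (S.Q n) f) := by
  have : p ≠ n + 1 := by omega
  simp [Qsg, this]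

theorem isLinearMap_Qsg {p n : ℕ} (h : p ≤ n) : IsLinearMap ℝ (S.Qsg p n) := by
  induction n, h using Nat.le_induction with
  | base => exact ⟨fun f g => by simp only [Qsg_self], fun c f => by simp only [Qsg_self]⟩
  | succ n hpn ih =>
    refine ⟨fun f g => ?_, fun c f => ?_⟩
    · rw [Qsg_succ S hpn, Qsg_succ S hpn, Qsg_succ S hpn, ← ih.map_add]
      exact congrArg _ ((kernelLin (S.Q n)).map_add f g)
    · rw [Qsg_succ S hpn, Qsg_succ S hpn, ← ih.map_smul]
      exact congrArg _ ((kernelLin (S.Q n)).map_smul c f)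

end Semigroup

section Deterministic

/-- The particle masses are bounded, and bounded away from zero, by constants that do not depend on
the number and on the positions of the particles. -/
theorem exists_massN_bounds (n : ℕ) : ∃ a b : ℝ, 0 < a ∧ ∀ (N : ℕ), 1 ≤ N → ∀ (Ω : Type v)
    (ξ : ∀ n, Fin N → Ω → E n) (ω : Ω), a ≤ S.massN ξ n ω ∧ S.massN ξ n ω ≤ b := by
  induction n with
  | zero => exact ⟨S.mass 0, S.mass 0, S.mass_pos 0, fun _ _ _ _ _ => ⟨le_rfl, le_rfl⟩⟩
  | succ n ih =>
    obtain ⟨a, b, ha, h⟩ := ih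
    obtain ⟨c, hc, hG⟩ := S.G_lower n
    obtain ⟨C, hC⟩ := S.G_upper n
    refine ⟨a * c, b * C + (S.μ (n + 1)).real Set.univ, mul_pos ha hc, fun N hN Ω ξ ω => ?_⟩
    obtain ⟨h1, h2⟩ := h N hN Ω ξ ω
    have := isProbabilityMeasure_empirical hN fun i => ξ n i ω
    set ν := empirical fun i => ξ n i ω with hν
    have hl : c ≤ ∫ x, S.G n x ∂ν := by
      calc c = ∫ _, c ∂ν := by simp
        _ ≤ _ := integral_mono (integrable_const _) (BddMeas.integrable (S.Gb n) _) hG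
    have hu : ∫ x, S.G n x ∂ν ≤ C := by
      calc _ ≤ ∫ _, C ∂ν :=
            integral_mono (BddMeas.integrable (S.Gb n) _) (integrable_const _) hC
        _ = C := by simp
    have h3 : 0 ≤ (S.μ (n + 1)).real Set.univ := measureReal_nonneg
    rw [massN, ← hν]
    constructor
    · have := mul_le_mul h1 hl hc.le (ha.le.trans h1)
      linarith
    · have := mul_le_mul h2 hu (hc.le.trans hl) (ha.le.trans (h1.trans h2))
      linarith

/-- The centered and normalised function `(f - η_n(f)) / γ_n(1)`. -/
noncomputable def normalised (n : ℕ) (f : BddMeas (E n)) : BddMeas (E n) :=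
  (S.mass n)⁻¹ • (f - BddMeas.const (E n) (∫ x, f.1 x ∂(S.η n)))

variable {Ω : Type v} {N : ℕ} (hN : 1 ≤ N) (ξ : ∀ n, Fin N → Ω → E n)
include hN

theorem massN_pos (n : ℕ) (ω : Ω) : 0 < S.massN ξ n ω := by
  obtain ⟨a, b, ha, h⟩ := S.exists_massN_bounds n
  exact ha.trans_le (h N hN Ω ξ ω).1

variable {K : ∀ n, ℝ → Measure (E n) → Kernel (E n) (E (n + 1))} (hK : S.IsMcKean K)

omit hN in
theorem VγN_zero (f : BddMeas (E 0)) (ω : Ω) :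
    S.VγN ξ 0 f ω = S.massN ξ 0 ω * S.WN K ξ 0 f ω := by
  simp only [VγN, WN, massN, integral_γ]
  ring

include hK in
/-- One step of the decomposition of the fluctuations of the unnormalised measures: the fluctuation
at time `n` is transported by `Q_{n+1}`, and a new local error is added. -/
theorem VγN_succ (n : ℕ) (f : BddMeas (E (n + 1))) (ω : Ω) :
    S.VγN ξ (n + 1) f ω
      = S.massN ξ (n + 1) ω * S.WN K ξ (n + 1) f ω + S.VγN ξ n (kernelOp (S.Q n) f) ω := by
  have := isProbabilityMeasure_empirical hN fun i => ξ n i ω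
  have h := IsMcKean.integral_transport S n (η := empirical fun i => ξ n i ω) hK
    (S.massN_pos hN ξ n ω) f
  have h2 : S.massN ξ (n + 1) ω
      = S.massN ξ n ω * (∫ x, S.G n x ∂(empirical fun i => ξ n i ω))
        + (S.μ (n + 1)).real Set.univ := rfl
  rw [← h2] at h
  simp only [VγN, WN, integral_γ_succ]
  linear_combination √(N : ℝ) * h

include hK in
/-- The exact decomposition of the fluctuations of the unnormalised measures along the local
errors. It is `VγN_succ`, iterated. -/
theorem VγN_eq_sum (n : ℕ) (f : BddMeas (E n)) (ω : Ω) :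
    S.VγN ξ n f ω
      = ∑ p ∈ Finset.range (n + 1), S.massN ξ p ω * S.WN K ξ p (S.Qsg p n f) ω := by
  induction n with
  | zero => simp [S.VγN_zero (K := K) ξ f ω, Qsg_self]
  | succ n ih =>
    rw [Finset.sum_range_succ, Qsg_self, VγN_succ S hN ξ hK, ih, add_comm]
    congr 1
    refine Finset.sum_congr rfl fun p hp => ?_
    rw [Qsg_succ S (by simpa [Nat.lt_succ_iff] using hp)]

theorem isLinearMap_VγN (n : ℕ) (ω : Ω) : IsLinearMap ℝ fun f => S.VγN ξ n f ω := by
  have := isProbabilityMeasure_empirical hN fun i => ξ n i ω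
  exact ((√(N : ℝ)) • (S.massN ξ n ω • integralLin (empirical fun i => ξ n i ω)
    - integralLin (S.γ n))).isLinear

include hK in
theorem isLinearMap_WN (n : ℕ) (ω : Ω) : IsLinearMap ℝ fun f => S.WN K ξ n f ω := by
  have := fun n => isProbabilityMeasure_empirical hN fun i => ξ n i ω
  cases n with
  | zero =>
    exact ((√(N : ℝ)) • (integralLin (empirical fun i => ξ 0 i ω)
      - integralLin (S.η 0))).isLinear
  | succ n =>
    have := hK.isMarkov n _ (empirical fun i => ξ n i ω) (S.massN_pos hN ξ n ω) inferInstance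
    exact ((√(N : ℝ)) • (integralLin (empirical fun i => ξ (n + 1) i ω)
      - (integralLin (empirical fun i => ξ n i ω)).comp
        (kernelLin (K n (S.massN ξ n ω) (empirical fun i => ξ n i ω))))).isLinear

/-- The fluctuations of the normalised measures are, up to a random factor close to `1`, those of
the unnormalised measures tested on `S.normalised n f`. -/
theorem VηN_eq (n : ℕ) (f : BddMeas (E n)) (ω : Ω) :
    S.VηN ξ n f ω = (S.mass n / S.massN ξ n ω) * S.VγN ξ n (S.normalised n f) ω := by
  have := isProbabilityMeasure_empirical hN fun i => ξ n i ω
  have h1 := S.mass_pos n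
  have h2 := S.massN_pos hN ξ n ω
  rw [normalised, (S.isLinearMap_VγN hN ξ n ω).map_smul, (S.isLinearMap_VγN hN ξ n ω).map_sub]
  have h3 : ∀ ν : Measure (E n), IsProbabilityMeasure ν →
      ∫ x, (BddMeas.const (E n) (∫ x, f.1 x ∂(S.η n))).1 x ∂ν = ∫ x, f.1 x ∂(S.η n) := by
    intro ν _
    simp [BddMeas.const]
  simp only [VηN, VγN, integral_γ, h3 _ this, h3 _ (S.isProbabilityMeasure_η n), smul_eq_mul]
  field_simp
  ring

/-- The fluctuation of the particle mass is that of the unnormalised measure tested on `1`. -/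
theorem massN_sub_mass (n : ℕ) (ω : Ω) :
    √(N : ℝ) * (S.massN ξ n ω - S.mass n) = S.VγN ξ n (BddMeas.const (E n) 1) ω := by
  have := isProbabilityMeasure_empirical hN fun i => ξ n i ω
  rw [VγN, ← mass_eq_integral]
  simp [BddMeas.const]

end Deterministic

section Measurability

/-- The law of the `i`-th particle at time `n + 1`, given the particles up to time `n`. -/
noncomputable def stepLaw {Ω : Type v} {N : ℕ}
    (K : ∀ n, ℝ → Measure (E n) → Kernel (E n) (E (n + 1)))
    (ξ : ∀ n, Fin N → Ω → E n) (n : ℕ) (i : Fin N) (ω : Ω) : Measure (E (n + 1)) :=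
  K n (S.massN ξ n ω) (empirical fun j => ξ n j ω) (ξ n i ω)

variable {Ω : Type v} {mΩ : MeasurableSpace Ω} {N : ℕ} (hN : 1 ≤ N) {ξ : ∀ n, Fin N → Ω → E n}
  {K : ∀ n, ℝ → Measure (E n) → Kernel (E n) (E (n + 1))}

include hN in
theorem IsMcKean.isProbabilityMeasure_stepLaw (hK : S.IsMcKean K) (n : ℕ) (i : Fin N) (ω : Ω) :
    IsProbabilityMeasure (S.stepLaw K ξ n i ω) := by
  have := isProbabilityMeasure_empirical hN fun i => ξ n i ω
  have := hK.isMarkov n _ (empirical fun i => ξ n i ω) (S.massN_pos hN ξ n ω) inferInstance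
  exact IsMarkovKernel.isProbabilityMeasure _

theorem measurable_integral_empirical {n : ℕ} (hξ : ∀ i, Measurable (ξ n i)) {f : E n → ℝ}
    (hf : Measurable f) : Measurable fun ω => ∫ x, f x ∂(empirical fun i => ξ n i ω) := by
  simp_rw [integral_empirical _ hf]
  exact (Finset.measurable_sum _ fun i _ => hf.comp (hξ i)).const_mul _

theorem measurable_massN {n : ℕ} (hξ : ∀ p ≤ n, ∀ i, Measurable (ξ p i)) :
    Measurable (S.massN ξ n) := by
  induction n with
  | zero => exact measurable_const
  | succ n ih =>
    exact ((ih fun p hp => hξ p (by omega)).mul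
      (measurable_integral_empirical (hξ n (by omega)) (S.measurable_G n))).add_const _

include hN in
theorem measurable_stepLaw (hK : S.IsMcKean K) {n : ℕ} (hξ : ∀ p ≤ n, ∀ i, Measurable (ξ p i))
    (i : Fin N) : Measurable (S.stepLaw K ξ n i) := by
  refine Measure.measurable_of_measurable_coe _ fun A hA => ?_
  have h : Measurable fun ω =>
      ((⟨S.massN ξ n ω, S.massN_pos hN ξ n ω⟩, fun i => ξ n i ω) :
        Set.Ioi (0 : ℝ) × (Fin N → E n)) :=
    ((S.measurable_massN hξ).subtype_mk).prodMk (measurable_pi_lambda _ fun i => hξ n le_rfl i)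
  exact (hK.measurable n N hN i A hA).comp h

theorem measurable_integral_of_measurable {F : Type*} [MeasurableSpace F] {κ : Ω → Measure F}
    (hκ : Measurable κ) {f : F → ℝ} (hf : Measurable f) :
    Measurable fun ω => ∫ y, f y ∂(κ ω) :=
  (StronglyMeasurable.integral_kernel (κ := (⟨κ, hκ⟩ : Kernel Ω F))
    hf.stronglyMeasurable).measurable

include hN in
/-- The local errors as normalised sums of conditionally centered variables. -/
theorem WN_succ_eq (hK : S.IsMcKean K) (n : ℕ) (f : BddMeas (E (n + 1))) (ω : Ω) :
    S.WN K ξ (n + 1) f ω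
      = ∑ j, (f.1 (ξ (n + 1) j ω) - ∫ y, f.1 y ∂(S.stepLaw K ξ n j ω)) / √(N : ℝ) := by
  have := isProbabilityMeasure_empirical hN fun i => ξ n i ω
  have := hK.isMarkov n _ (empirical fun i => ξ n i ω) (S.massN_pos hN ξ n ω) inferInstance
  have hN0 : (0 : ℝ) < N := by exact_mod_cast hN
  have hs : √(N : ℝ) ≠ 0 := (Real.sqrt_pos.2 hN0).ne'
  have hss : √(N : ℝ) * √(N : ℝ) = N := Real.mul_self_sqrt hN0.le
  have h : ∫ x, (∫ y, f.1 y ∂(K n (S.massN ξ n ω) (empirical fun i => ξ n i ω) x))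
      ∂(empirical fun i => ξ n i ω) = (N : ℝ)⁻¹ * ∑ j, ∫ y, f.1 y ∂(S.stepLaw K ξ n j ω) :=
    integral_empirical _ (BddMeas.measurable
      (kernelOp (K n (S.massN ξ n ω) (empirical fun i => ξ n i ω)) f))
  rw [WN, integral_empirical _ (BddMeas.measurable f), h, ← mul_sub,
    ← Finset.sum_sub_distrib, ← Finset.sum_div, eq_div_iff hs, mul_right_comm, hss]
  field_simp

include hN in
theorem WN_zero_eq (f : BddMeas (E 0)) (ω : Ω) :
    S.WN K ξ 0 f ω = ∑ j, (f.1 (ξ 0 j ω) - ∫ y, f.1 y ∂(S.η 0)) / √(N : ℝ) := by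
  have hN0 : (0 : ℝ) < N := by exact_mod_cast hN
  have hs : √(N : ℝ) ≠ 0 := (Real.sqrt_pos.2 hN0).ne'
  have hss : √(N : ℝ) * √(N : ℝ) = N := Real.mul_self_sqrt hN0.le
  rw [WN, integral_empirical _ (BddMeas.measurable f), ← Finset.sum_div, eq_div_iff hs,
    Finset.sum_sub_distrib, Finset.sum_const, Finset.card_univ, Fintype.card_fin, nsmul_eq_mul,
    mul_right_comm, hss]
  field_simp

include hN in
theorem measurable_WN (hK : S.IsMcKean K) {n : ℕ} (hξ : ∀ p ≤ n, ∀ i, Measurable (ξ p i))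
    (f : BddMeas (E n)) : Measurable (S.WN K ξ n f) := by
  cases n with
  | zero =>
    exact ((measurable_integral_empirical (hξ 0 le_rfl) (BddMeas.measurable f)).sub_const
      _).const_mul _
  | succ n =>
    rw [funext (S.WN_succ_eq hN hK n f)]
    refine Finset.measurable_sum _ fun j _ => Measurable.div_const (Measurable.sub ?_ ?_) _
    · exact (BddMeas.measurable f).comp (hξ (n + 1) le_rfl j)
    · exact measurable_integral_of_measurable
        (S.measurable_stepLaw hN hK (fun p hp => hξ p (by omega)) j) (BddMeas.measurable f)

theorem measurable_VγN {n : ℕ} (hξ : ∀ p ≤ n, ∀ i, Measurable (ξ p i))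
    (f : BddMeas (E n)) : Measurable (S.VγN ξ n f) :=
  (((S.measurable_massN hξ).mul (measurable_integral_empirical (hξ n le_rfl)
    (BddMeas.measurable f))).sub_const _).const_mul _

theorem measurable_VηN {n : ℕ} (hξ : ∀ p ≤ n, ∀ i, Measurable (ξ p i))
    (f : BddMeas (E n)) : Measurable (S.VηN ξ n f) :=
  ((measurable_integral_empirical (hξ n le_rfl) (BddMeas.measurable f)).sub_const _).const_mul _

end Measurability

end Model
end SpatialBranching

/-! ### Integration over one transition of the particle system -/

namespace SpatialBranching

/-- The integral form of `map_prodMk_eq_compProd_of_condExp`. -/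
theorem integral_prodMk_of_condExp {Ω Ω₀ F H : Type*} [MeasurableSpace Ω]
    [mΩ₀ : MeasurableSpace Ω₀] [MeasurableSpace F] [NormedAddCommGroup H] [NormedSpace ℝ H]
    {P : Measure Ω} [IsProbabilityMeasure P]
    {τ : Ω → Ω₀} (hτ : Measurable τ) {X : Ω → F} (hX : Measurable X) (κ : Kernel Ω₀ F)
    [IsMarkovKernel κ]
    (h : ∀ B, MeasurableSet B →
      P[Set.indicator {ω | X ω ∈ B} (fun _ => (1 : ℝ)) | mΩ₀.comap τ]
        =ᵐ[P] fun ω => (κ (τ ω)).real B)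
    {φ : Ω₀ × F → H} (hφ : StronglyMeasurable φ) {C : ℝ} (hC : ∀ q, ‖φ q‖ ≤ C) :
    ∫ ω, φ (τ ω, X ω) ∂P = ∫ ω, (∫ y, φ (τ ω, y) ∂(κ (τ ω))) ∂P := by
  have := Measure.isProbabilityMeasure_map (μ := P) hτ.aemeasurable
  rw [← integral_map (φ := fun ω => (τ ω, X ω)) (f := φ) (hτ.prodMk hX).aemeasurable
      hφ.aestronglyMeasurable,
    map_prodMk_eq_compProd_of_condExp hτ hX κ h,
    Measure.integral_compProd (Integrable.of_bound hφ.aestronglyMeasurable C (ae_of_all _ hC)),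
    integral_map (f := fun z => ∫ y, φ (z, y) ∂(κ z)) hτ.aemeasurable
      hφ.integral_kernel_prod_right'.aestronglyMeasurable]

/-- The second moment of a normalised sum of independent centered bounded variables. -/
theorem integral_sq_sum_pi_le {F : Type*} [MeasurableSpace F] {N : ℕ} (hN : 1 ≤ N)
    (ν : Fin N → Measure F) [∀ j, IsProbabilityMeasure (ν j)] {f : F → ℝ} (hf : Measurable f)
    {C : ℝ} (hC : ∀ y, |f y| ≤ C) :
    ∫ y, (∑ j, (f (y j) - ∫ z, f z ∂(ν j)) / √(N : ℝ)) ^ 2 ∂(Measure.pi ν) ≤ C ^ 2 := by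
  have hN0 : (0 : ℝ) < N := by exact_mod_cast hN
  have hint : ∀ j, Integrable f (ν j) := fun j => integrable_of_measurable_of_abs_le _ hf hC
  have hL : ∀ j, MemLp f 2 (ν j) := fun j =>
    MemLp.of_bound hf.aestronglyMeasurable C (ae_of_all _ hC)
  set X : Fin N → F → ℝ := fun j y => (f y - ∫ z, f z ∂(ν j)) / √(N : ℝ) with hX
  have hXL : ∀ j, MemLp (X j) 2 (ν j) := fun j => by
    have := ((hL j).sub (memLp_const (∫ z, f z ∂(ν j)))).const_mul (√(N : ℝ))⁻¹
    refine this.ae_eq (ae_of_all _ fun y => ?_)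
    simp [hX, div_eq_inv_mul]
  have hX0 : ∀ j, ∫ y, X j y ∂(ν j) = 0 := fun j => by
    simp only [hX]
    rw [integral_div, integral_sub (hint j) (integrable_const _)]
    simp
  have hXv : ∀ j, Var[X j; ν j] ≤ C ^ 2 / N := fun j => by
    have e : X j = fun y => (√(N : ℝ))⁻¹ * (f y - ∫ z, f z ∂(ν j)) := by
      funext y
      simp [hX, div_eq_inv_mul]
    rw [e, variance_const_mul, variance_sub_const hf.aestronglyMeasurable, inv_pow,
      Real.sq_sqrt hN0.le, div_eq_inv_mul]
    gcongr
    refine (variance_le_expectation_sq hf.aestronglyMeasurable).trans ?_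
    calc ∫ y, (f ^ 2) y ∂(ν j) ≤ ∫ _, C ^ 2 ∂(ν j) :=
          integral_mono (hL j).integrable_sq (integrable_const _) fun y => by
            simp only [Pi.pow_apply]
            rw [← sq_abs]
            exact pow_le_pow_left₀ (abs_nonneg _) (hC y) 2
      _ = C ^ 2 := by simp
  have hsum := variance_sum_pi hXL
  have hmp : ∀ j, MeasurePreserving (fun y : Fin N → F => y j) (Measure.pi ν) (ν j) :=
    fun j => measurePreserving_eval ν j
  have hL2 : ∀ j, MemLp (fun y : Fin N → F => X j (y j)) 2 (Measure.pi ν) :=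
    fun j => (hXL j).comp_measurePreserving (hmp j)
  have hmean : ∫ y, (∑ j, fun y : Fin N → F => X j (y j)) y ∂(Measure.pi ν) = 0 := by
    simp only [Finset.sum_apply]
    rw [integral_finsetSum _ fun j _ => (hL2 j).integrable (by norm_num)]
    refine Finset.sum_eq_zero fun j _ => ?_
    rw [← hX0 j, ← (hmp j).map_eq, integral_map (hmp j).aemeasurable]
    rw [(hmp j).map_eq]
    exact (hXL j).1
  rw [variance_of_integral_eq_zero
    (memLp_finsetSum' _ fun j _ => hL2 j).aestronglyMeasurable.aemeasurable hmean] at hsum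
  simp only [Finset.sum_apply] at hsum
  rw [hsum]
  calc ∑ j, Var[X j; ν j] ≤ ∑ _j : Fin N, C ^ 2 / N := Finset.sum_le_sum fun j _ => hXv j
    _ = C ^ 2 := by
      rw [Finset.sum_const, Finset.card_univ, Fintype.card_fin, nsmul_eq_mul]
      field_simp

namespace Model
variable {E : ℕ → Type u} [∀ n, MeasurableSpace (E n)] (S : Model E)
  {Ω : Type v} {mΩ : MeasurableSpace Ω} {N : ℕ} {ξ : ∀ n, Fin N → Ω → E n}
  {K : ∀ n, ℝ → Measure (E n) → Kernel (E n) (E (n + 1))}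

theorem measurable_history {n p : ℕ} (hp : p ≤ n) (i : Fin N) :
    @Measurable _ _ (history ξ n) _ (ξ p i) := by
  refine Measurable.mono (comap_measurable (ξ p i)) ?_ le_rfl
  exact le_iSup₂_of_le (f := fun (p : Fin (n + 1)) (i : Fin N) =>
    MeasurableSpace.comap (ξ p i) inferInstance) ⟨p, by omega⟩ i le_rfl

theorem history_le {n : ℕ} (hξ : ∀ p i, Measurable (ξ p i)) : history ξ n ≤ mΩ :=
  iSup₂_le fun p i => (hξ p i).comap_le

variable (hN : 1 ≤ N) (hK : S.IsMcKean K) {P : Measure Ω} [IsProbabilityMeasure P]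
  (hξ : S.IsParticleSystem P K ξ)
include hN hK hξ

/-- Integrals of functions of the past and of the particles at time `n + 1`: given the past, the
particles are integrated out against the product of their step laws. The σ-field `history ξ n`
plays the role of the space of the past, with the identity map. -/
theorem IsParticleSystem.integral_transition {H : Type*} [NormedAddCommGroup H] [NormedSpace ℝ H]
    (n : ℕ) {φ : Ω × (Fin N → E (n + 1)) → H}
    (hφ : @StronglyMeasurable _ _ _ ((history ξ n).prod inferInstance) φ)
    {C : ℝ} (hC : ∀ q, ‖φ q‖ ≤ C) :
    ∫ ω, φ (ω, fun i => ξ (n + 1) i ω) ∂P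
      = ∫ ω, (∫ y, φ (ω, y) ∂(Measure.pi fun i => S.stepLaw K ξ n i ω)) ∂P := by
  have := IsMcKean.isProbabilityMeasure_stepLaw S hN (ξ := ξ) hK
  have hm : @Measurable _ _ (history ξ n) _ fun ω => Measure.pi fun i => S.stepLaw K ξ n i ω :=
    @measurable_measurePi _ _ (history ξ n) _ _ _ (fun i ω => S.stepLaw K ξ n i ω) (this n)
      fun j B hB => (Measure.measurable_coe hB).comp
        (S.measurable_stepLaw (mΩ := history ξ n) hN hK
          (fun p hp i => measurable_history hp i) j)
  let κ : @Kernel Ω (Fin N → E (n + 1)) (history ξ n) _ :=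
    @Kernel.mk _ _ (history ξ n) _ (fun ω => Measure.pi fun i => S.stepLaw K ξ n i ω) hm
  have hκ : @IsMarkovKernel _ _ (history ξ n) _ κ :=
    @IsMarkovKernel.mk _ _ (history ξ n) _ κ fun ω => by
      have := this n
      change IsProbabilityMeasure (Measure.pi fun i => S.stepLaw K ξ n i ω)
      infer_instance
  refine @integral_prodMk_of_condExp Ω Ω _ H _ (history ξ n) _ _ _ P _ id
    (measurable_id'' (history_le hξ.measurable)) (fun ω i => ξ (n + 1) i ω)
    (measurable_pi_lambda _ fun i => hξ.measurable _ i) κ hκ ?_ φ hφ C hC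
  intro B hB
  rw [MeasurableSpace.comap_id]
  exact hξ.transition n B hB

end Model
end SpatialBranching

/-! ### Second moments and the law of large numbers -/

namespace SpatialBranching

/-- The indicator function of a measurable set, as an element of `𝓑(E)`. -/
noncomputable def BddMeas.indicator {E : Type u} [MeasurableSpace E] {B : Set E}
    (hB : MeasurableSet B) : BddMeas E :=
  ⟨B.indicator fun _ => 1, measurable_const.indicator hB, 1, fun x => by
    by_cases hx : x ∈ B <;> simp [hx]⟩

namespace Model
variable {E : ℕ → Type u} [∀ n, MeasurableSpace (E n)] (S : Model E)
  {K : ∀ n, ℝ → Measure (E n) → Kernel (E n) (E (n + 1))}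

section SingleSystem

variable {Ω : Type v} {mΩ : MeasurableSpace Ω} {N : ℕ} {ξ : ∀ n, Fin N → Ω → E n}
variable (hN : 1 ≤ N) (hK : S.IsMcKean K) {P : Measure Ω} [IsProbabilityMeasure P]

include hN hK in
theorem abs_WN_le (n : ℕ) {f : BddMeas (E n)} {C : ℝ} (hC : ∀ x, |f.1 x| ≤ C) (ω : Ω) :
    |S.WN K ξ n f ω| ≤ √(N : ℝ) * (2 * C) := by
  have := fun n => isProbabilityMeasure_empirical hN fun i => ξ n i ω
  cases n with
  | zero =>
    rw [WN, abs_mul, abs_of_nonneg (Real.sqrt_nonneg _)]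
    gcongr
    refine (abs_sub _ _).trans ?_
    linarith [BddMeas.abs_integral_le hC (empirical fun i => ξ 0 i ω),
      BddMeas.abs_integral_le hC (S.η 0)]
  | succ n =>
    have := hK.isMarkov n _ (empirical fun i => ξ n i ω) (S.massN_pos hN ξ n ω) inferInstance
    rw [WN, abs_mul, abs_of_nonneg (Real.sqrt_nonneg _)]
    gcongr
    refine (abs_sub _ _).trans ?_
    have h := BddMeas.abs_integral_le
      (f := kernelOp (K n (S.massN ξ n ω) (empirical fun i => ξ n i ω)) f) (C := C)
      (fun x => BddMeas.abs_integral_le hC _) (empirical fun i => ξ n i ω)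
    change |∫ x, (∫ y, f.1 y ∂(K n (S.massN ξ n ω) (empirical fun i => ξ n i ω) x))
      ∂(empirical fun i => ξ n i ω)| ≤ C at h
    linarith [BddMeas.abs_integral_le hC (empirical fun i => ξ (n + 1) i ω)]

variable (hξ : S.IsParticleSystem P K ξ)
include hN hK hξ

theorem memLp_WN (n : ℕ) (f : BddMeas (E n)) : MemLp (S.WN K ξ n f) 2 P := by
  obtain ⟨C, -, hC⟩ := BddMeas.exists_bound f
  exact MemLp.of_bound (S.measurable_WN hN hK (fun p _ => hξ.measurable p)
    f).aestronglyMeasurable _ (ae_of_all _ (S.abs_WN_le hN hK n hC))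

/-- The local errors are bounded in `L²`, uniformly in the number of particles. -/
theorem integral_WN_sq_le (n : ℕ) {f : BddMeas (E n)} {C : ℝ} (hC : ∀ x, |f.1 x| ≤ C) :
    ∫ ω, S.WN K ξ n f ω ^ 2 ∂P ≤ C ^ 2 := by
  cases n with
  | zero =>
    have h := integral_sq_sum_pi_le hN (fun _ => S.η 0) (BddMeas.measurable f) hC
    have hm : Measurable fun ω i => ξ 0 i ω := measurable_pi_lambda _ (hξ.measurable 0)
    have hfm := BddMeas.measurable f
    have hφ : Measurable fun y : Fin N → E 0 =>
        (∑ j, (f.1 (y j) - ∫ z, f.1 z ∂(S.η 0)) / √(N : ℝ)) ^ 2 :=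
      (Finset.measurable_sum _ fun j _ => ((hfm.comp (measurable_pi_apply j)).sub_const
        _).div_const _).pow_const 2
    rw [← hξ.initial, integral_map hm.aemeasurable hφ.aestronglyMeasurable] at h
    simpa only [S.WN_zero_eq hN] using h
  | succ n =>
    have hstep := IsMcKean.isProbabilityMeasure_stepLaw S hN (ξ := ξ) hK n
    have hm : @StronglyMeasurable _ _ _ ((history ξ n).prod inferInstance)
        (fun q : Ω × (Fin N → E (n + 1)) =>
          (∑ j, (f.1 (q.2 j) - ∫ y, f.1 y ∂(S.stepLaw K ξ n j q.1)) / √(N : ℝ)) ^ 2) := by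
      let _ : MeasurableSpace Ω := history ξ n
      have hc : ∀ j, Measurable fun ω => ∫ y, f.1 y ∂(S.stepLaw K ξ n j ω) := fun j =>
        measurable_integral_of_measurable
          (S.measurable_stepLaw hN hK (fun p hp i => measurable_history hp i) j)
          (BddMeas.measurable f)
      have hf := BddMeas.measurable f
      refine Measurable.stronglyMeasurable ?_
      refine (Finset.measurable_sum _ fun j _ => Measurable.div_const (Measurable.sub ?_ ?_)
        _).pow_const 2
      · exact hf.comp ((measurable_pi_apply j).comp measurable_snd)
      · exact (hc j).comp measurable_fst
    simp_rw [S.WN_succ_eq hN hK]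
    have hb : ∀ q : Ω × (Fin N → E (n + 1)),
        ‖(∑ j, (f.1 (q.2 j) - ∫ y, f.1 y ∂(S.stepLaw K ξ n j q.1)) / √(N : ℝ)) ^ 2‖
          ≤ (∑ _j : Fin N, (2 * C) / √(N : ℝ)) ^ 2 := fun q => by
      rw [norm_pow]
      refine pow_le_pow_left₀ (norm_nonneg _) ((norm_sum_le _ _).trans
        (Finset.sum_le_sum fun j _ => ?_)) 2
      rw [norm_div, Real.norm_eq_abs, Real.norm_eq_abs, abs_of_nonneg (Real.sqrt_nonneg _)]
      gcongr
      have := hstep j q.1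
      exact (abs_sub _ _).trans (by
        linarith [hC (q.2 j), BddMeas.abs_integral_le hC (S.stepLaw K ξ n j q.1)])
    rw [IsParticleSystem.integral_transition S hN hK hξ n hm hb]
    have h2 : ∀ ω, ∫ y, (∑ j, (f.1 (y j) - ∫ z, f.1 z ∂(S.stepLaw K ξ n j ω)) / √(N : ℝ)) ^ 2
        ∂(Measure.pi fun i => S.stepLaw K ξ n i ω) ≤ C ^ 2 := fun ω => by
      have := fun j => hstep j ω
      exact integral_sq_sum_pi_le hN _ (BddMeas.measurable f) hC
    calc _ ≤ ∫ _, C ^ 2 ∂P := integral_mono_of_nonneg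
          (ae_of_all _ fun ω => integral_nonneg fun y => sq_nonneg _) (integrable_const _)
          (ae_of_all _ h2)
      _ = C ^ 2 := by simp

/-- The particles avoid the null sets of the limiting flow. By induction: an `η_{n+1}`-null set is
null for `μ_{n+1}` and for `Q_{n+1}(x, ·)` at `η_n`-almost every `x`, so at the positions of the
particles at time `n`; the McKean transitions then do not charge it, by `integral_transport`. -/
theorem ae_notMem_of_η_eq_zero (n : ℕ) : ∀ {B : Set (E n)}, MeasurableSet B → S.η n B = 0 →
    ∀ i, ∀ᵐ ω ∂P, ξ n i ω ∉ B := by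
  induction n with
  | zero =>
    intro B hB h0 i
    have hm : Measurable fun ω i => ξ 0 i ω := measurable_pi_lambda _ (hξ.measurable 0)
    have h1 : P ((fun ω i => ξ 0 i ω) ⁻¹' ((fun x : Fin N → E 0 => x i) ⁻¹' B)) = 0 := by
      rw [← Measure.map_apply hm (measurable_pi_apply i hB), hξ.initial,
        (measurePreserving_eval (fun _ : Fin N => S.η 0) i).measure_preimage hB.nullMeasurableSet,
        h0]
    filter_upwards [measure_eq_zero_iff_ae_notMem.1 h1] with ω hω using hω
  | succ n ih =>
    intro B hB h0 i
    have hstep := IsMcKean.isProbabilityMeasure_stepLaw S hN (ξ := ξ) hK n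
    rw [η_eq_zero_iff, γ, Measure.add_apply, add_eq_zero,
      Measure.bind_apply hB (S.Q n).aemeasurable,
      lintegral_eq_zero_iff ((S.Q n).measurable_coe hB)] at h0
    obtain ⟨hQ, hμ⟩ := h0
    set A : Set (E n) := {x | S.Q n x B ≠ 0} with hA
    have hAm : MeasurableSet A :=
      (((S.Q n).measurable_coe hB) (measurableSet_singleton 0)).compl
    have hA0 : S.η n A = 0 := by
      rw [η_eq_zero_iff]
      exact ae_iff.1 hQ
    have hae : ∀ᵐ ω ∂P, S.stepLaw K ξ n i ω B = 0 := by
      filter_upwards [ae_all_iff.2 (ih hAm hA0)] with ω hω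
      have := isProbabilityMeasure_empirical hN fun i => ξ n i ω
      have := hK.isMarkov n _ (empirical fun i => ξ n i ω) (S.massN_pos hN ξ n ω) inferInstance
      have h := IsMcKean.integral_transport S n (η := empirical fun i => ξ n i ω) hK
        (S.massN_pos hN ξ n ω) (BddMeas.indicator hB)
      have e1 : ∫ x, (kernelOp (S.Q n) (BddMeas.indicator hB)).1 x
          ∂(empirical fun i => ξ n i ω) = 0 := by
        rw [integral_empirical _ (BddMeas.measurable _)]
        refine mul_eq_zero_of_right _ (Finset.sum_eq_zero fun j _ => ?_)
        have hj : S.Q n (ξ n j ω) B = 0 := by simpa [hA] using hω j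
        change ∫ y, B.indicator (fun _ => (1 : ℝ)) y ∂(S.Q n (ξ n j ω)) = 0
        rw [integral_indicator_const _ hB, Measure.real, hj]
        simp
      have e2 : ∫ x, (BddMeas.indicator hB).1 x ∂(S.μ (n + 1)) = 0 := by
        change ∫ y, B.indicator (fun _ => (1 : ℝ)) y ∂(S.μ (n + 1)) = 0
        rw [integral_indicator_const _ hB, Measure.real, hμ]
        simp
      have e3 : ∫ x, (∫ y, (BddMeas.indicator hB).1 y
          ∂(K n (S.massN ξ n ω) (empirical fun i => ξ n i ω) x)) ∂(empirical fun i => ξ n i ω)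
          = (N : ℝ)⁻¹ * ∑ j, (S.stepLaw K ξ n j ω).real B := by
        refine (integral_empirical _ (BddMeas.measurable (kernelOp (K n (S.massN ξ n ω)
          (empirical fun i => ξ n i ω)) (BddMeas.indicator hB)))).trans ?_
        congr 1
        refine Finset.sum_congr rfl fun j _ => ?_
        change ∫ y, B.indicator (fun _ => (1 : ℝ)) y ∂(S.stepLaw K ξ n j ω) = _
        rw [integral_indicator_const _ hB]
        simp
      rw [e1, e2, e3, mul_zero, add_zero] at h
      have hpos : S.massN ξ n ω * (∫ x, S.G n x ∂(empirical fun i => ξ n i ω))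
          + (S.μ (n + 1)).real Set.univ ≠ 0 := (S.massN_pos hN ξ (n + 1) ω).ne'
      have hN0 : (N : ℝ)⁻¹ ≠ 0 := by
        have : (0 : ℝ) < N := by exact_mod_cast hN
        positivity
      have h4 := (mul_eq_zero.1 ((mul_eq_zero.1 h).resolve_left hpos)).resolve_left hN0
      have h5 := (Finset.sum_eq_zero_iff_of_nonneg fun j _ => measureReal_nonneg).1 h4 i
        (Finset.mem_univ i)
      have := hstep i ω
      exact (measureReal_eq_zero_iff).1 h5
    have hmeas : MeasurableSet {y : Fin N → E (n + 1) | y i ∈ B} := measurable_pi_apply i hB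
    have htr := IsParticleSystem.integral_transition S hN hK hξ n
      (φ := fun q => Set.indicator {y : Fin N → E (n + 1) | y i ∈ B} (fun _ => (1 : ℝ)) q.2)
      (by
        let _ : MeasurableSpace Ω := history ξ n
        exact ((measurable_const.indicator hmeas).comp measurable_snd).stronglyMeasurable)
      (C := 1) (fun q => by
        by_cases hq : q.2 i ∈ B <;> simp [Set.indicator, hq])
    have hm : Measurable fun ω i => ξ (n + 1) i ω := measurable_pi_lambda _ (hξ.measurable _)
    have hl : ∫ ω, Set.indicator {y : Fin N → E (n + 1) | y i ∈ B} (fun _ => (1 : ℝ))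
        (fun i => ξ (n + 1) i ω) ∂P = P.real {ω | ξ (n + 1) i ω ∈ B} := by
      have : (fun ω => Set.indicator {y : Fin N → E (n + 1) | y i ∈ B} (fun _ => (1 : ℝ))
          (fun i => ξ (n + 1) i ω)) = Set.indicator {ω | ξ (n + 1) i ω ∈ B} fun _ => 1 := rfl
      rw [this, integral_indicator_const _
        (show MeasurableSet {ω | ξ (n + 1) i ω ∈ B} from hξ.measurable _ i hB)]
      simp
    have hr : ∀ᵐ ω ∂P, ∫ y, Set.indicator {y : Fin N → E (n + 1) | y i ∈ B} (fun _ => (1 : ℝ)) y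
        ∂(Measure.pi fun i => S.stepLaw K ξ n i ω) = 0 := by
      filter_upwards [hae] with ω hω
      have := fun j => hstep j ω
      have h6 : (Measure.pi fun i => S.stepLaw K ξ n i ω) {y | y i ∈ B} = 0 := by
        rw [← hω]
        exact (measurePreserving_eval (fun i => S.stepLaw K ξ n i ω) i).measure_preimage
          hB.nullMeasurableSet
      rw [integral_indicator_const _ hmeas, Measure.real, h6]
      simp
    rw [hl, integral_congr_ae hr, integral_zero] at htr
    exact measure_eq_zero_iff_ae_notMem.1 ((measureReal_eq_zero_iff).1 htr)

end SingleSystem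

section Moments

/-- The fluctuations of the unnormalised measures are bounded in `L²`, uniformly in the number of
particles and in the particle system. -/
theorem exists_integral_VγN_sq_le (hK : S.IsMcKean K) (n : ℕ) (f : BddMeas (E n)) :
    ∃ C : ℝ, 0 ≤ C ∧ ∀ (N : ℕ), 1 ≤ N → ∀ (Ω : Type v) [MeasurableSpace Ω] (P : Measure Ω)
      [IsProbabilityMeasure P] (ξ : ∀ n, Fin N → Ω → E n), S.IsParticleSystem P K ξ →
      Integrable (fun ω => S.VγN ξ n f ω ^ 2) P ∧ ∫ ω, S.VγN ξ n f ω ^ 2 ∂P ≤ C := by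
  choose a b ha hab using fun p => S.exists_massN_bounds.{u, v} p
  choose D hD0 hD using fun p => BddMeas.exists_bound (S.Qsg p n f)
  refine ⟨(n + 1) * ∑ p ∈ Finset.range (n + 1), b p ^ 2 * D p ^ 2, by positivity,
    fun N hN Ω _ P _ ξ hξ => ?_⟩
  have hint : ∀ p, Integrable (fun ω => b p ^ 2 * S.WN K ξ p (S.Qsg p n f) ω ^ 2) P := fun p =>
    (S.memLp_WN hN hK hξ p _).integrable_sq.const_mul _
  have hint2 : Integrable (fun ω => ((n : ℝ) + 1) * ∑ p ∈ Finset.range (n + 1),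
      b p ^ 2 * S.WN K ξ p (S.Qsg p n f) ω ^ 2) P :=
    (integrable_finsetSum _ fun p _ => hint p).const_mul _
  have hle : ∀ ω, S.VγN ξ n f ω ^ 2 ≤ ((n : ℝ) + 1) * ∑ p ∈ Finset.range (n + 1),
      b p ^ 2 * S.WN K ξ p (S.Qsg p n f) ω ^ 2 := fun ω => by
    rw [S.VγN_eq_sum hN ξ hK]
    refine (sq_sum_le_card_mul_sum_sq (s := Finset.range (n + 1))).trans ?_
    rw [Finset.card_range]
    push_cast
    gcongr with p hp
    rw [mul_pow]
    gcongr
    · exact (ha p).le.trans (hab p N hN Ω ξ ω).1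
    · exact (hab p N hN Ω ξ ω).2
  refine ⟨hint2.mono' ((S.measurable_VγN (fun p _ => hξ.measurable p)
    f).pow_const 2).aestronglyMeasurable (ae_of_all _ fun ω => ?_), ?_⟩
  · rw [Real.norm_eq_abs, abs_of_nonneg (sq_nonneg _)]
    exact hle ω
  · refine (integral_mono_of_nonneg (ae_of_all _ fun ω => sq_nonneg _) hint2
      (ae_of_all _ hle)).trans ?_
    rw [integral_const_mul, integral_finsetSum _ fun p _ => hint p]
    gcongr with p hp
    rw [integral_const_mul]
    gcongr
    exact S.integral_WN_sq_le hN hK hξ p (hD p)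

/-- The squared distance of the particle mass and of the empirical measure to the limiting flow,
tested on finitely many functions. -/
noncomputable def sqDev {Ω : Type v} {N : ℕ} (ξ : ∀ n, Fin N → Ω → E n) (n : ℕ)
    (H : Finset (BddMeas (E n))) (ω : Ω) : ℝ :=
  (S.massN ξ n ω - S.mass n) ^ 2
    + ∑ h ∈ H, ((∫ x, h.1 x ∂(empirical fun i => ξ n i ω)) - ∫ x, h.1 x ∂(S.η n)) ^ 2

/-- The law of large numbers, with rate `1 / N`. -/
theorem exists_integral_sqDev_le (hK : S.IsMcKean K) (n : ℕ) (H : Finset (BddMeas (E n))) :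
    ∃ C : ℝ, 0 ≤ C ∧ ∀ (N : ℕ), 1 ≤ N → ∀ (Ω : Type v) [MeasurableSpace Ω] (P : Measure Ω)
      [IsProbabilityMeasure P] (ξ : ∀ n, Fin N → Ω → E n), S.IsParticleSystem P K ξ →
      Integrable (S.sqDev ξ n H) P ∧ ∫ ω, S.sqDev ξ n H ω ∂P ≤ C / N := by
  obtain ⟨a, b, ha, hab⟩ := S.exists_massN_bounds.{u, v} n
  obtain ⟨C₀, hC₀, h₀⟩ := S.exists_integral_VγN_sq_le.{u, v} hK n (BddMeas.const (E n) 1)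
  choose C hC hCg using fun f => S.exists_integral_VγN_sq_le.{u, v} hK n (S.normalised n f)
  refine ⟨C₀ + ∑ h ∈ H, (S.mass n / a) ^ 2 * C h, add_nonneg hC₀
    (Finset.sum_nonneg fun h _ => mul_nonneg (sq_nonneg _) (hC h)), fun N hN Ω _ P _ ξ hξ => ?_⟩
  have hN0 : (0 : ℝ) < N := by exact_mod_cast hN
  have hss : √(N : ℝ) ^ 2 = N := Real.sq_sqrt hN0.le
  obtain ⟨i₀, e₀⟩ := h₀ N hN Ω P ξ hξ
  have i₁ := fun f => (hCg f N hN Ω P ξ hξ).1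
  have e₁ := fun f => (hCg f N hN Ω P ξ hξ).2
  have hm := S.mass_pos n
  have hR : Integrable (fun ω => (N : ℝ)⁻¹ * (S.VγN ξ n (BddMeas.const (E n) 1) ω ^ 2
      + ∑ h ∈ H, (S.mass n / a) ^ 2 * S.VγN ξ n (S.normalised n h) ω ^ 2)) P :=
    (i₀.add (integrable_finsetSum _ fun h _ => (i₁ h).const_mul _)).const_mul _
  have hle : ∀ ω, S.sqDev ξ n H ω ≤ (N : ℝ)⁻¹ * (S.VγN ξ n (BddMeas.const (E n) 1) ω ^ 2
      + ∑ h ∈ H, (S.mass n / a) ^ 2 * S.VγN ξ n (S.normalised n h) ω ^ 2) := fun ω => by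
    rw [mul_add, Finset.mul_sum, sqDev]
    gcongr with h hh
    · rw [← S.massN_sub_mass hN, mul_pow, hss]
      field_simp
      exact le_rfl
    · have h1 : ((∫ x, h.1 x ∂(empirical fun i => ξ n i ω)) - ∫ x, h.1 x ∂(S.η n)) ^ 2
          = (N : ℝ)⁻¹ * S.VηN ξ n h ω ^ 2 := by
        rw [VηN, mul_pow, hss]
        field_simp
      rw [h1, S.VηN_eq hN, mul_pow]
      have h2 := (hab N hN Ω ξ ω).1
      have h3 : 0 ≤ S.mass n / S.massN ξ n ω := div_nonneg hm.le (ha.le.trans h2)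
      gcongr
  have hmeas : Measurable (S.sqDev ξ n H) := by
    refine Measurable.add (((S.measurable_massN fun p _ => hξ.measurable p).sub_const
      _).pow_const 2) (Finset.measurable_sum _ fun h _ => Measurable.pow_const
        (Measurable.sub_const (measurable_integral_empirical (hξ.measurable n)
          (BddMeas.measurable h)) _) 2)
  have hnn : ∀ ω, 0 ≤ S.sqDev ξ n H ω := fun ω => by unfold sqDev; positivity
  refine ⟨hR.mono' hmeas.aestronglyMeasurable (ae_of_all _ fun ω => ?_), ?_⟩
  · rw [Real.norm_eq_abs, abs_of_nonneg (hnn ω)]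
    exact hle ω
  · refine (integral_mono_of_nonneg (ae_of_all _ hnn) hR (ae_of_all _ hle)).trans ?_
    rw [integral_const_mul, integral_add i₀ (integrable_finsetSum _ fun h _ => (i₁ h).const_mul _),
      integral_finsetSum _ fun h _ => (i₁ h).const_mul _,
      div_eq_inv_mul _ (N : ℝ)]
    refine mul_le_mul_of_nonneg_left (add_le_add e₀ (Finset.sum_le_sum fun h _ => ?_))
      (inv_nonneg.2 hN0.le)
    rw [integral_const_mul]
    exact mul_le_mul_of_nonneg_left (e₁ h) (sq_nonneg _)

end Moments

end Model
end SpatialBranching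

/-! ### The central limit theorem for the local errors -/

namespace SpatialBranching

theorem abs_le_add_sq_div {x ε : ℝ} (hε : 0 < ε) : |x| ≤ ε + ε⁻¹ * x ^ 2 := by
  rw [← sq_abs x]
  have h : ε⁻¹ * ε = 1 := inv_mul_cancel₀ hε.ne'
  have h2 : ε⁻¹ * |x| ^ 2 - |x| + ε = ε⁻¹ * ((|x| - ε / 2) ^ 2 + 3 / 4 * ε ^ 2) := by
    field_simp
    ring
  have h3 : 0 ≤ ε⁻¹ * ((|x| - ε / 2) ^ 2 + 3 / 4 * ε ^ 2) := by positivity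
  linarith

theorem norm_exp_neg_half_sub_le {a b : ℝ} (ha : 0 ≤ a) (hb : 0 ≤ b) :
    ‖Complex.exp (-(a : ℂ) / 2) - Complex.exp (-(b : ℂ) / 2)‖ ≤ |a - b| := by
  have key : ∀ x y : ℝ, 0 ≤ x → x ≤ y → |Real.exp (-x / 2) - Real.exp (-y / 2)| ≤ |x - y| := by
    intro x y hx hxy
    have h1 : Real.exp (-y / 2) ≤ Real.exp (-x / 2) := Real.exp_le_exp.2 (by linarith)
    have h2 : Real.exp (-y / 2) = Real.exp (-x / 2) * Real.exp (-(y - x) / 2) := by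
      rw [← Real.exp_add]
      ring_nf
    have h3 : -(y - x) / 2 + 1 ≤ Real.exp (-(y - x) / 2) := Real.add_one_le_exp _
    have h4 : Real.exp (-x / 2) ≤ 1 := Real.exp_le_one_iff.2 (by linarith)
    have h5 := Real.exp_pos (-x / 2)
    rw [abs_of_nonneg (by linarith), abs_of_nonpos (by linarith), h2]
    nlinarith
  have e : Complex.exp (-(a : ℂ) / 2) - Complex.exp (-(b : ℂ) / 2)
      = ((Real.exp (-a / 2) - Real.exp (-b / 2) : ℝ) : ℂ) := by
    push_cast
    rfl
  rw [e, Complex.norm_real, Real.norm_eq_abs]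
  rcases le_total a b with h | h
  · exact key a b ha h
  · rw [abs_sub_comm, abs_sub_comm a b]
    exact key b a hb h

theorem integral_sq_sub_integral {F : Type u} [MeasurableSpace F] (ν : Measure F)
    [IsProbabilityMeasure ν] (f : BddMeas F) :
    ∫ y, (f.1 y - ∫ z, f.1 z ∂ν) ^ 2 ∂ν
      = ∫ y, (BddMeas.mul f f).1 y ∂ν - (∫ y, f.1 y ∂ν) ^ 2 := by
  set c := ∫ z, f.1 z ∂ν with hc
  have e : ∀ y, (f.1 y - c) ^ 2 = (BddMeas.mul f f).1 y - (2 * c * f.1 y - c ^ 2) := fun y => by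
    simp only [BddMeas.mul]
    ring
  have hi : Integrable (fun y => 2 * c * f.1 y) ν := (BddMeas.integrable f ν).const_mul _
  have hi2 : Integrable (fun y => 2 * c * f.1 y - c ^ 2) ν := hi.sub (integrable_const _)
  simp_rw [e]
  rw [integral_sub (BddMeas.integrable _ _) hi2, integral_sub hi (integrable_const _),
    integral_const_mul, ← hc]
  simp
  ring

namespace Model
variable {E : ℕ → Type u} [∀ n, MeasurableSpace (E n)] (S : Model E)
  {K : ∀ n, ℝ → Measure (E n) → Kernel (E n) (E (n + 1))}

section Continuity

theorem sqDev_nonneg {Ω : Type v} {N : ℕ} (ξ : ∀ n, Fin N → Ω → E n) (n : ℕ)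
    (H : Finset (BddMeas (E n))) (ω : Ω) : 0 ≤ S.sqDev ξ n H ω := by
  unfold sqDev
  positivity

theorem sqDev_mono {Ω : Type v} {N : ℕ} (ξ : ∀ n, Fin N → Ω → E n) (n : ℕ)
    {H H' : Finset (BddMeas (E n))} (h : H ⊆ H') (ω : Ω) : S.sqDev ξ n H ω ≤ S.sqDev ξ n H' ω := by
  unfold sqDev
  gcongr

/-- The continuity of the McKean transitions at the limiting flow, in a form that can be
integrated: outside the small neighbourhood of the flow, the squared distance to the flow dominates
the (bounded) left hand side. -/
theorem exists_integral_abs_sub_le (hK : S.IsMcKean K) (hKc : S.IsContinuousAtFlow K) (n : ℕ)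
    (f : BddMeas (E (n + 1))) {ε : ℝ} (hε : 0 < ε) :
    ∃ c : ℝ, 0 ≤ c ∧ ∃ H : Finset (BddMeas (E n)), ∀ (N : ℕ), 1 ≤ N →
      ∀ (Ω : Type v) [MeasurableSpace Ω] (P : Measure Ω) [IsProbabilityMeasure P]
      (ξ : ∀ n, Fin N → Ω → E n), S.IsParticleSystem P K ξ →
      ∀ᵐ ω ∂P, (N : ℝ)⁻¹ * ∑ j, |(∫ y, f.1 y ∂(S.stepLaw K ξ n j ω))
        - ∫ y, f.1 y ∂(K n (S.mass n) (S.η n) (ξ n j ω))| ≤ ε + c * S.sqDev ξ n H ω := by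
  obtain ⟨A, hA, hA0, hcont⟩ := hKc n f
  obtain ⟨δ, hδ, H, hH⟩ := hcont ε hε
  obtain ⟨C, hC0, hC⟩ := BddMeas.exists_bound f
  refine ⟨2 * C * (δ ^ 2)⁻¹, by positivity, H, fun N hN Ω _ P _ ξ hξ => ?_⟩
  filter_upwards [ae_all_iff.2 (S.ae_notMem_of_η_eq_zero hN hK hξ n hA.compl hA0)] with ω hω
  have hemp := isProbabilityMeasure_empirical hN fun i => ξ n i ω
  have h1 := hK.isMarkov n _ (empirical fun i => ξ n i ω) (S.massN_pos hN ξ n ω) inferInstance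
  have h2 := hK.isMarkov n _ (S.η n) (S.mass_pos n) inferInstance
  have hN0 : (0 : ℝ) < N := by exact_mod_cast hN
  have hs := S.sqDev_nonneg ξ n H ω
  by_cases hnear : |S.massN ξ n ω - S.mass n| < δ ∧
      ∀ h ∈ H, |(∫ x, h.1 x ∂(empirical fun i => ξ n i ω)) - ∫ x, h.1 x ∂(S.η n)| < δ
  · have h3 := hH _ _ (S.massN_pos hN ξ n ω) hemp
      (empirical_apply_eq_zero hA.compl hω) hnear.1 hnear.2
    have hm : Measurable fun x =>
        |(∫ y, f.1 y ∂(K n (S.massN ξ n ω) (empirical fun i => ξ n i ω) x))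
          - ∫ y, f.1 y ∂(K n (S.mass n) (S.η n) x)| :=
      ((BddMeas.measurable (kernelOp (K n (S.massN ξ n ω) (empirical fun i => ξ n i ω)) f)).sub
        (BddMeas.measurable (kernelOp (K n (S.mass n) (S.η n)) f))).abs
    rw [integral_empirical _ hm] at h3
    refine h3.le.trans (le_add_of_nonneg_right (by positivity))
  · have h4 : δ ^ 2 ≤ S.sqDev ξ n H ω := by
      rw [not_and_or] at hnear
      rcases hnear with h | h
      · rw [not_lt] at h
        calc δ ^ 2 ≤ (S.massN ξ n ω - S.mass n) ^ 2 := by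
              rw [← sq_abs (S.massN ξ n ω - S.mass n)]
              gcongr
          _ ≤ _ := le_add_of_nonneg_right (by positivity)
      · push Not at h
        obtain ⟨h, hh, hle⟩ := h
        calc δ ^ 2 ≤ ((∫ x, h.1 x ∂(empirical fun i => ξ n i ω)) - ∫ x, h.1 x ∂(S.η n)) ^ 2 := by
              rw [← sq_abs (_ - _)]
              gcongr
          _ ≤ ∑ h ∈ H, ((∫ x, h.1 x ∂(empirical fun i => ξ n i ω))
                - ∫ x, h.1 x ∂(S.η n)) ^ 2 :=
              Finset.single_le_sum (f := fun h : BddMeas (E n) =>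
                ((∫ x, h.1 x ∂(empirical fun i => ξ n i ω)) - ∫ x, h.1 x ∂(S.η n)) ^ 2)
                (fun _ _ => sq_nonneg _) hh
          _ ≤ _ := le_add_of_nonneg_left (by positivity)
    have h5 : (N : ℝ)⁻¹ * ∑ j, |(∫ y, f.1 y ∂(S.stepLaw K ξ n j ω))
        - ∫ y, f.1 y ∂(K n (S.mass n) (S.η n) (ξ n j ω))| ≤ 2 * C := by
      calc _ ≤ (N : ℝ)⁻¹ * ∑ _j : Fin N, (2 * C) := by
            gcongr with j
            have := IsMcKean.isProbabilityMeasure_stepLaw S hN (ξ := ξ) hK n j ω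
            refine (abs_sub _ _).trans ?_
            linarith [BddMeas.abs_integral_le hC (S.stepLaw K ξ n j ω),
              BddMeas.abs_integral_le hC (K n (S.mass n) (S.η n) (ξ n j ω))]
        _ = 2 * C := by
            rw [Finset.sum_const, Finset.card_univ, Fintype.card_fin, nsmul_eq_mul]
            field_simp
    calc _ ≤ 2 * C := h5
      _ = 2 * C * (δ ^ 2)⁻¹ * δ ^ 2 := by field_simp
      _ ≤ 2 * C * (δ ^ 2)⁻¹ * S.sqDev ξ n H ω := by gcongr
      _ ≤ _ := le_add_of_nonneg_left hε.le

/-- The conditional variance of the local error `W_{n+1}^N(f)` given the past. -/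
noncomputable def condVar {Ω : Type v} {N : ℕ}
    (K : ∀ n, ℝ → Measure (E n) → Kernel (E n) (E (n + 1)))
    (ξ : ∀ n, Fin N → Ω → E n) (n : ℕ) (f : BddMeas (E (n + 1))) (ω : Ω) : ℝ :=
  (N : ℝ)⁻¹ * ∑ j, ∫ y, (f.1 y - ∫ z, f.1 z ∂(S.stepLaw K ξ n j ω)) ^ 2 ∂(S.stepLaw K ξ n j ω)

/-- The conditional variance of the local error at time `n + 1` is close to the limiting variance,
up to a multiple of the squared distance to the flow. The conditional variance is compared first, by
continuity of the transitions, with the empirical mean of the variance of `f` under the limiting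
transition, and then with the mean of this function under `η_n`. -/
theorem exists_abs_condVar_sub_limitCov_le (hK : S.IsMcKean K) (hKc : S.IsContinuousAtFlow K)
    (n : ℕ) (f : BddMeas (E (n + 1))) {ε : ℝ} (hε : 0 < ε) :
    ∃ c : ℝ, 0 ≤ c ∧ ∃ H : Finset (BddMeas (E n)), ∀ (N : ℕ), 1 ≤ N →
      ∀ (Ω : Type v) [MeasurableSpace Ω] (P : Measure Ω) [IsProbabilityMeasure P]
      (ξ : ∀ n, Fin N → Ω → E n), S.IsParticleSystem P K ξ →
      ∀ᵐ ω ∂P, |S.condVar K ξ n f ω - S.limitCov K (n + 1) f f|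
        ≤ ε + c * S.sqDev ξ n H ω := by
  classical
  have hM := hK.isMarkov n _ (S.η n) (S.mass_pos n) inferInstance
  obtain ⟨C, hC0, hC⟩ := BddMeas.exists_bound f
  obtain ⟨c₁, hc₁, H₁, h₁⟩ := S.exists_integral_abs_sub_le.{u, v} hK hKc n (BddMeas.mul f f)
    (ε := ε / 4) (by positivity)
  obtain ⟨c₂, hc₂, H₂, h₂⟩ := S.exists_integral_abs_sub_le.{u, v} hK hKc n f
    (ε := ε / 4 / (2 * C + 1)) (by positivity)
  let κf := kernelOp (K n (S.mass n) (S.η n)) f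
  let h : BddMeas (E n) :=
    kernelOp (K n (S.mass n) (S.η n)) (BddMeas.mul f f) - BddMeas.mul κf κf
  have hlim : S.limitCov K (n + 1) f f = ∫ x, h.1 x ∂(S.η n) := by
    refine integral_congr_ae (ae_of_all _ fun x => ?_)
    have := integral_sq_sub_integral (K n (S.mass n) (S.η n) x) f
    simp only [sq] at this
    exact this
  refine ⟨c₁ + (2 * C + 1) * c₂ + (ε / 4)⁻¹, by positivity, H₁ ∪ H₂ ∪ {h},
    fun N hN Ω _ P _ ξ hξ => ?_⟩
  filter_upwards [h₁ N hN Ω P ξ hξ, h₂ N hN Ω P ξ hξ] with ω e₁ e₂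
  have hN0 : (0 : ℝ) < N := by exact_mod_cast hN
  have hstep := IsMcKean.isProbabilityMeasure_stepLaw S hN (ξ := ξ) hK n
  set H := H₁ ∪ H₂ ∪ {h}
  have m₁ : S.sqDev ξ n H₁ ω ≤ S.sqDev ξ n H ω :=
    S.sqDev_mono ξ n (Finset.subset_union_left.trans Finset.subset_union_left) ω
  have m₂ : S.sqDev ξ n H₂ ω ≤ S.sqDev ξ n H ω :=
    S.sqDev_mono ξ n (Finset.subset_union_right.trans Finset.subset_union_left) ω
  have m₃ : ((∫ x, h.1 x ∂(empirical fun i => ξ n i ω)) - ∫ x, h.1 x ∂(S.η n)) ^ 2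
      ≤ S.sqDev ξ n H ω :=
    (Finset.single_le_sum (f := fun h : BddMeas (E n) =>
      ((∫ x, h.1 x ∂(empirical fun i => ξ n i ω)) - ∫ x, h.1 x ∂(S.η n)) ^ 2)
      (fun _ _ => sq_nonneg _) (show h ∈ H by simp [H])).trans
      (le_add_of_nonneg_left (sq_nonneg _))
  have e₃ := abs_le_add_sq_div (x := (∫ x, h.1 x ∂(empirical fun i => ξ n i ω))
    - ∫ x, h.1 x ∂(S.η n)) (ε := ε / 4) (by positivity)
  -- the conditional variance differs from the integral of `h` by the two continuity errors
  have key : |S.condVar K ξ n f ω - ∫ x, h.1 x ∂(empirical fun i => ξ n i ω)|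
      ≤ (N : ℝ)⁻¹ * ∑ j, |(∫ y, (BddMeas.mul f f).1 y ∂(S.stepLaw K ξ n j ω))
          - ∫ y, (BddMeas.mul f f).1 y ∂(K n (S.mass n) (S.η n) (ξ n j ω))|
        + (2 * C + 1) * ((N : ℝ)⁻¹ * ∑ j, |(∫ y, f.1 y ∂(S.stepLaw K ξ n j ω))
          - ∫ y, f.1 y ∂(K n (S.mass n) (S.η n) (ξ n j ω))|) := by
    rw [integral_empirical _ (BddMeas.measurable h), condVar, ← mul_sub,
      ← Finset.sum_sub_distrib, abs_mul, abs_of_nonneg (inv_nonneg.2 hN0.le), mul_left_comm,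
      ← mul_add]
    gcongr
    refine (Finset.abs_sum_le_sum_abs _ _).trans ?_
    rw [Finset.mul_sum, ← Finset.sum_add_distrib]
    refine Finset.sum_le_sum fun j _ => ?_
    have := hstep j ω
    rw [integral_sq_sub_integral]
    set a := ∫ y, f.1 y ∂(S.stepLaw K ξ n j ω) with ha
    set b := ∫ y, f.1 y ∂(K n (S.mass n) (S.η n) (ξ n j ω)) with hb
    have ha' : |a| ≤ C := BddMeas.abs_integral_le hC _
    have hb' : |b| ≤ C := BddMeas.abs_integral_le hC _
    have hh : h.1 (ξ n j ω) = (∫ y, (BddMeas.mul f f).1 y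
        ∂(K n (S.mass n) (S.η n) (ξ n j ω))) - b * b := rfl
    rw [hh]
    have e : (∫ y, (BddMeas.mul f f).1 y ∂(S.stepLaw K ξ n j ω)) - a ^ 2
        - ((∫ y, (BddMeas.mul f f).1 y ∂(K n (S.mass n) (S.η n) (ξ n j ω))) - b * b)
        = ((∫ y, (BddMeas.mul f f).1 y ∂(S.stepLaw K ξ n j ω))
          - (∫ y, (BddMeas.mul f f).1 y ∂(K n (S.mass n) (S.η n) (ξ n j ω))))
          - (a + b) * (a - b) := by ring
    rw [e]
    refine (abs_sub _ _).trans ?_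
    rw [abs_mul]
    gcongr
    exact (abs_add_le _ _).trans (by linarith)
  rw [hlim]
  have e₂' : (2 * C + 1) * ((N : ℝ)⁻¹ * ∑ j, |(∫ y, f.1 y ∂(S.stepLaw K ξ n j ω))
      - ∫ y, f.1 y ∂(K n (S.mass n) (S.η n) (ξ n j ω))|)
      ≤ ε / 4 + (2 * C + 1) * c₂ * S.sqDev ξ n H ω := by
    calc _ ≤ (2 * C + 1) * (ε / 4 / (2 * C + 1) + c₂ * S.sqDev ξ n H₂ ω) := by gcongr
      _ = ε / 4 + (2 * C + 1) * c₂ * S.sqDev ξ n H₂ ω := by field_simp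
      _ ≤ _ := by gcongr
  have e₁' := e₁.trans (add_le_add_right (mul_le_mul_of_nonneg_left m₁ hc₁) (ε / 4))
  have e₃' := e₃.trans (add_le_add_right (mul_le_mul_of_nonneg_left m₃
    (by positivity : 0 ≤ (ε / 4)⁻¹)) (ε / 4))
  calc _ ≤ |S.condVar K ξ n f ω - ∫ x, h.1 x ∂(empirical fun i => ξ n i ω)|
        + |(∫ x, h.1 x ∂(empirical fun i => ξ n i ω)) - ∫ x, h.1 x ∂(S.η n)| :=
      abs_sub_le _ _ _
    _ ≤ ε + (c₁ + (2 * C + 1) * c₂ + (ε / 4)⁻¹) * S.sqDev ξ n H ω := by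
      rw [add_mul, add_mul]
      linarith

end Continuity

section CentralLimit

/-- One step of the central limit theorem: conditionally on the past, the local error at time
`n + 1` is nearly Gaussian with a nearly deterministic variance. -/
theorem exists_norm_integral_exp_succ_sub_le (hK : S.IsMcKean K) (hKc : S.IsContinuousAtFlow K)
    (n : ℕ) (g : ∀ p, BddMeas (E p)) {ε : ℝ} (hε : 0 < ε) :
    ∃ C : ℝ, ∀ (N : ℕ), 1 ≤ N →
      ∀ (Ω : Type v) [MeasurableSpace Ω] (P : Measure Ω) [IsProbabilityMeasure P]
      (ξ : ∀ n, Fin N → Ω → E n), S.IsParticleSystem P K ξ →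
      ‖∫ ω, Complex.exp ((∑ p ∈ Finset.range (n + 2), S.WN K ξ p (g p) ω : ℝ) * Complex.I) ∂P
        - Complex.exp (-(S.limitCov K (n + 1) (g (n + 1)) (g (n + 1)) : ℂ) / 2)
          * ∫ ω, Complex.exp
            ((∑ p ∈ Finset.range (n + 1), S.WN K ξ p (g p) ω : ℝ) * Complex.I) ∂P‖
        ≤ ε + C / √(N : ℝ) := by
  obtain ⟨c, hc, H, hcH⟩ :=
    S.exists_abs_condVar_sub_limitCov_le.{u, v} hK hKc n (g (n + 1)) hε
  obtain ⟨D, hD, hDH⟩ := S.exists_integral_sqDev_le.{u, v} hK n H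
  set f := g (n + 1) with hf
  obtain ⟨B, hB0, hB⟩ := BddMeas.exists_bound f
  set σ := S.limitCov K (n + 1) f f with hσ
  have hσ0 : 0 ≤ σ := integral_nonneg fun x => integral_nonneg fun y => mul_self_nonneg _
  set R := (2 * B) ^ 3 * Real.exp (2 * B) + (2 * B) ^ 4 * Real.exp ((2 * B) ^ 2) with hR
  refine ⟨R + c * D, fun N hN Ω _ P _ ξ hξ => ?_⟩
  have hstep := IsMcKean.isProbabilityMeasure_stepLaw S hN (ξ := ξ) hK n
  have hN0 : (0 : ℝ) < N := by exact_mod_cast hN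
  have hs1 : (1 : ℝ) ≤ √(N : ℝ) := by
    rw [Real.one_le_sqrt]
    exact_mod_cast hN
  obtain ⟨hi, hle⟩ := hDH N hN Ω P ξ hξ
  -- `A` is the contribution of the past, `Z` that of the particles at time `n + 1`
  set A : Ω → ℂ := fun ω =>
    Complex.exp ((∑ p ∈ Finset.range (n + 1), S.WN K ξ p (g p) ω : ℝ) * Complex.I) with hA
  set Z : Ω → (Fin N → E (n + 1)) → ℂ := fun ω y => ∏ j, Complex.exp
    (((f.1 (y j) - ∫ z, f.1 z ∂(S.stepLaw K ξ n j ω)) / √(N : ℝ) : ℝ) * Complex.I) with hZ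
  set s : ℂ := Complex.exp (-(σ : ℂ) / 2) with hs
  have hAn : ∀ ω, ‖A ω‖ = 1 := fun ω => Complex.norm_exp_ofReal_mul_I _
  have hZn : ∀ ω y, ‖Z ω y‖ = 1 := fun ω y => by
    simp only [hZ, norm_prod, Complex.norm_exp_ofReal_mul_I, Finset.prod_const_one]
  have hsn : ‖s‖ ≤ 1 := by
    rw [hs, Complex.norm_exp, Real.exp_le_one_iff, ← Complex.ofReal_neg, ← Complex.ofReal_ofNat,
      ← Complex.ofReal_div, Complex.ofReal_re]
    linarith
  have hmA : @Measurable _ _ (history ξ n) _ A := by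
    let _ : MeasurableSpace Ω := history ξ n
    have : Measurable fun ω => ∑ p ∈ Finset.range (n + 1), S.WN K ξ p (g p) ω :=
      Finset.measurable_sum _ fun p hp => S.measurable_WN hN hK
        (fun q hq i => measurable_history (by
          have := Finset.mem_range.1 hp
          omega) i) _
    fun_prop
  have hmZ : @Measurable _ _ ((history ξ n).prod inferInstance) _
      (fun q : Ω × (Fin N → E (n + 1)) => Z q.1 q.2) := by
    let _ : MeasurableSpace Ω := history ξ n
    have hcm : ∀ j, Measurable fun ω => ∫ y, f.1 y ∂(S.stepLaw K ξ n j ω) := fun j =>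
      measurable_integral_of_measurable
        (S.measurable_stepLaw hN hK (fun p hp i => measurable_history hp i) j)
        (BddMeas.measurable f)
    refine Finset.measurable_prod _ fun j _ => ?_
    have h1 : Measurable fun q : Ω × (Fin N → E (n + 1)) =>
        (f.1 (q.2 j) - ∫ z, f.1 z ∂(S.stepLaw K ξ n j q.1)) / √(N : ℝ) :=
      (((BddMeas.measurable f).comp ((measurable_pi_apply j).comp measurable_snd)).sub
        ((hcm j).comp measurable_fst)).div_const _
    fun_prop
  have hφ : @StronglyMeasurable _ _ _ ((history ξ n).prod inferInstance)
      (fun q : Ω × (Fin N → E (n + 1)) => A q.1 * (Z q.1 q.2 - s)) := by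
    let _ : MeasurableSpace Ω := history ξ n
    exact ((hmA.comp measurable_fst).mul (hmZ.sub_const s)).stronglyMeasurable
  have htr := IsParticleSystem.integral_transition S hN hK hξ n hφ (C := 2) fun q => by
    rw [norm_mul, hAn, one_mul]
    exact (norm_sub_le _ _).trans (by rw [hZn]; linarith)
  have hle0 := history_le (n := n) hξ.measurable
  have hA' : Measurable A := hmA.mono hle0 le_rfl
  have hiA : Integrable A P :=
    Integrable.of_bound hA'.aestronglyMeasurable 1 (ae_of_all _ fun ω => (hAn ω).le)
  have hprod : ∀ ω, A ω * Z ω (fun i => ξ (n + 1) i ω)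
      = Complex.exp ((∑ p ∈ Finset.range (n + 2), S.WN K ξ p (g p) ω : ℝ) * Complex.I) :=
    fun ω => by
    simp only [hA, hZ]
    rw [← Complex.exp_sum, ← Complex.exp_add, Finset.sum_range_succ _ (n + 1),
      S.WN_succ_eq hN hK]
    congr 1
    push_cast
    rw [add_mul, Finset.sum_mul (Finset.univ : Finset (Fin N))]
  have hiAZ : Integrable (fun ω => A ω * Z ω (fun i => ξ (n + 1) i ω)) P := by
    refine Integrable.of_bound ?_ 1 (ae_of_all _ fun ω => by
      rw [norm_mul, hAn, hZn, one_mul])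
    simp_rw [hprod]
    have : Measurable fun ω => ∑ p ∈ Finset.range (n + 2), S.WN K ξ p (g p) ω :=
      Finset.measurable_sum _ fun p _ => S.measurable_WN hN hK (fun q _ => hξ.measurable q) _
    exact (by fun_prop : Measurable fun ω => Complex.exp
      ((∑ p ∈ Finset.range (n + 2), S.WN K ξ p (g p) ω : ℝ) * Complex.I)).aestronglyMeasurable
  have hlhs : ∫ ω, A ω * (Z ω (fun i => ξ (n + 1) i ω) - s) ∂P
      = ∫ ω, Complex.exp ((∑ p ∈ Finset.range (n + 2), S.WN K ξ p (g p) ω : ℝ) * Complex.I) ∂P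
        - s * ∫ ω, A ω ∂P := by
    simp_rw [mul_sub]
    rw [integral_sub hiAZ (hiA.mul_const s), integral_mul_const, mul_comm s]
    simp_rw [hprod]
  rw [← hlhs, htr]
  have hinner : ∀ ω, ∫ y, A ω * (Z ω y - s) ∂(Measure.pi fun i => S.stepLaw K ξ n i ω)
      = A ω * (∏ j, ∫ y, Complex.exp (((f.1 y - ∫ z, f.1 z ∂(S.stepLaw K ξ n j ω)) / √(N : ℝ) : ℝ)
        * Complex.I) ∂(S.stepLaw K ξ n j ω) - s) := fun ω => by
    have := fun j => hstep j ω
    have hZω : Integrable (Z ω) (Measure.pi fun i => S.stepLaw K ξ n i ω) := by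
      refine Integrable.of_bound ?_ 1 (ae_of_all _ fun y => (hZn ω y).le)
      have hfm := BddMeas.measurable f
      exact Measurable.aestronglyMeasurable (Finset.measurable_prod _ fun j _ => by fun_prop)
    rw [integral_const_mul, integral_sub hZω (integrable_const _), hZ,
      integral_fintype_prod_eq_prod (𝕜 := ℂ) (f := fun j y => Complex.exp
        (((f.1 y - ∫ z, f.1 z ∂(S.stepLaw K ξ n j ω)) / √(N : ℝ) : ℝ) * Complex.I))]
    simp
  have hbound : ∀ᵐ ω ∂P, ‖∫ y, A ω * (Z ω y - s) ∂(Measure.pi fun i => S.stepLaw K ξ n i ω)‖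
      ≤ R / √(N : ℝ) + (ε + c * S.sqDev ξ n H ω) := by
    filter_upwards [hcH N hN Ω P ξ hξ] with ω hω
    have := fun j => hstep j ω
    rw [hinner, norm_mul, hAn, one_mul]
    refine (norm_sub_le_norm_sub_add_norm_sub _ (Complex.exp (-(S.condVar K ξ n f ω : ℂ) / 2))
      _).trans (add_le_add ?_ ?_)
    · exact norm_prod_integral_exp_sub_exp_le hN (fun j => S.stepLaw K ξ n j ω)
        (BddMeas.measurable f) hB
    · refine (norm_exp_neg_half_sub_le ?_ hσ0).trans hω
      exact mul_nonneg (inv_nonneg.2 hN0.le)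
        (Finset.sum_nonneg fun j _ => integral_nonneg fun y => sq_nonneg _)
  have hi2 : Integrable (fun ω => ε + c * S.sqDev ξ n H ω) P :=
    (integrable_const _).add (hi.const_mul c)
  have hi3 : Integrable (fun ω => R / √(N : ℝ) + (ε + c * S.sqDev ξ n H ω)) P :=
    (integrable_const _).add hi2
  refine (norm_integral_le_of_norm_le hi3 hbound).trans ?_
  rw [integral_add (integrable_const _) hi2,
    integral_add (integrable_const _) (hi.const_mul c), integral_const_mul]
  have hlast : c * ∫ ω, S.sqDev ξ n H ω ∂P ≤ c * D / √(N : ℝ) := by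
    rw [mul_div_assoc]
    refine mul_le_mul_of_nonneg_left (hle.trans ?_) hc
    refine div_le_div_of_nonneg_left hD (by linarith) ?_
    calc √(N : ℝ) = √(N : ℝ) * 1 := (mul_one _).symm
      _ ≤ √(N : ℝ) * √(N : ℝ) := by gcongr
      _ = N := Real.mul_self_sqrt hN0.le
  simp only [integral_const, probReal_univ, one_smul]
  have hsplit : (R + c * D) / √(N : ℝ) = R / √(N : ℝ) + c * D / √(N : ℝ) := add_div _ _ _
  linarith

/-- The initial step of the central limit theorem. -/
theorem exists_norm_integral_exp_zero_sub_le (f : BddMeas (E 0)) :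
    ∃ C : ℝ, ∀ (N : ℕ), 1 ≤ N →
      ∀ (Ω : Type v) [MeasurableSpace Ω] (P : Measure Ω) [IsProbabilityMeasure P]
      (ξ : ∀ n, Fin N → Ω → E n), S.IsParticleSystem P K ξ →
      ‖∫ ω, Complex.exp ((S.WN K ξ 0 f ω : ℝ) * Complex.I) ∂P
        - Complex.exp (-(S.limitCov K 0 f f : ℂ) / 2)‖ ≤ C / √(N : ℝ) := by
  obtain ⟨B, hB0, hB⟩ := BddMeas.exists_bound f
  refine ⟨(2 * B) ^ 3 * Real.exp (2 * B) + (2 * B) ^ 4 * Real.exp ((2 * B) ^ 2),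
    fun N hN Ω _ P _ ξ hξ => ?_⟩
  have hN0 : (0 : ℝ) < N := by exact_mod_cast hN
  have h := norm_prod_integral_exp_sub_exp_le hN (fun _ => S.η 0) (BddMeas.measurable f) hB
  have e1 : (N : ℝ)⁻¹ * ∑ _j : Fin N, ∫ y, (f.1 y - ∫ z, f.1 z ∂(S.η 0)) ^ 2 ∂(S.η 0)
      = S.limitCov K 0 f f := by
    rw [Finset.sum_const, Finset.card_univ, Fintype.card_fin, nsmul_eq_mul, limitCov]
    field_simp
  have hm : Measurable fun ω i => ξ 0 i ω := measurable_pi_lambda _ (hξ.measurable 0)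
  have hfm := BddMeas.measurable f
  have e2 : ∫ ω, Complex.exp ((S.WN K ξ 0 f ω : ℝ) * Complex.I) ∂P
      = ∏ _j : Fin N, ∫ y, Complex.exp (((f.1 y - ∫ z, f.1 z ∂(S.η 0)) / √(N : ℝ) : ℝ) * Complex.I)
        ∂(S.η 0) := by
    have hφ : Measurable fun y : Fin N → E 0 => ∏ j, Complex.exp
        (((f.1 (y j) - ∫ z, f.1 z ∂(S.η 0)) / √(N : ℝ) : ℝ) * Complex.I) :=
      Finset.measurable_prod _ fun j _ => by fun_prop
    rw [← integral_fintype_prod_eq_prod (𝕜 := ℂ) (f := fun _ y => Complex.exp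
        (((f.1 y - ∫ z, f.1 z ∂(S.η 0)) / √(N : ℝ) : ℝ) * Complex.I)), ← hξ.initial,
      integral_map hm.aemeasurable hφ.aestronglyMeasurable]
    refine integral_congr_ae (ae_of_all _ fun ω => ?_)
    beta_reduce
    rw [← Complex.exp_sum, S.WN_zero_eq hN]
    congr 1
    push_cast
    rw [Finset.sum_mul]
  rw [e1] at h
  rw [e2]
  exact h

/-- Convergence of the joint characteristic functions of the local errors: the limit is that of
independent Gaussian variables with variances `limitCov`. -/
theorem tendsto_integral_exp_sum_WN (hK : S.IsMcKean K) (hKc : S.IsContinuousAtFlow K)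
    {Ω : ℕ → Type v} [∀ N, MeasurableSpace (Ω N)]
    {P : ∀ N, Measure (Ω N)} [∀ N, IsProbabilityMeasure (P N)]
    {ξ : ∀ N n, Fin N → Ω N → E n}
    (hξ : ∀ N, 1 ≤ N → S.IsParticleSystem (P N) K (ξ N)) (n : ℕ) (g : ∀ p, BddMeas (E p)) :
    Tendsto (fun N => ∫ ω, Complex.exp
        ((∑ p ∈ Finset.range (n + 1), S.WN K (ξ N) p (g p) ω : ℝ) * Complex.I) ∂(P N)) atTop
      (𝓝 (Complex.exp
        (-((∑ p ∈ Finset.range (n + 1), S.limitCov K p (g p) (g p) : ℝ) : ℂ) / 2))) := by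
  have hsq : Tendsto (fun N : ℕ => √(N : ℝ)) atTop atTop :=
    Real.tendsto_sqrt_atTop.comp tendsto_natCast_atTop_atTop
  induction n with
  | zero =>
    obtain ⟨C, hC⟩ := S.exists_norm_integral_exp_zero_sub_le.{u, v} (K := K) (g 0)
    rw [tendsto_iff_norm_sub_tendsto_zero]
    refine squeeze_zero' (Eventually.of_forall fun N => norm_nonneg _) ?_
      (tendsto_const_nhds.div_atTop hsq : Tendsto (fun N : ℕ => C / √(N : ℝ)) atTop (𝓝 0))
    filter_upwards [eventually_ge_atTop 1] with N hN
    simpa using hC N hN (Ω N) (P N) (ξ N) (hξ N hN)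
  | succ n ih =>
    set s := Complex.exp (-(S.limitCov K (n + 1) (g (n + 1)) (g (n + 1)) : ℂ) / 2) with hs
    have e : Complex.exp
        (-((∑ p ∈ Finset.range (n + 1 + 1), S.limitCov K p (g p) (g p) : ℝ) : ℂ) / 2)
        = s * Complex.exp
          (-((∑ p ∈ Finset.range (n + 1), S.limitCov K p (g p) (g p) : ℝ) : ℂ) / 2) := by
      rw [hs, ← Complex.exp_add, Finset.sum_range_succ]
      congr 1
      push_cast
      ring
    rw [e]
    have h0 : Tendsto (fun N => (∫ ω, Complex.exp
        ((∑ p ∈ Finset.range (n + 2), S.WN K (ξ N) p (g p) ω : ℝ) * Complex.I) ∂(P N))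
        - s * ∫ ω, Complex.exp
        ((∑ p ∈ Finset.range (n + 1), S.WN K (ξ N) p (g p) ω : ℝ) * Complex.I) ∂(P N)) atTop
        (𝓝 0) := by
      rw [Metric.tendsto_nhds]
      intro ε hε
      obtain ⟨C, hC⟩ := S.exists_norm_integral_exp_succ_sub_le.{u, v} hK hKc n g
        (ε := ε / 2) (by positivity)
      have h1 : Tendsto (fun N : ℕ => C / √(N : ℝ)) atTop (𝓝 0) :=
        tendsto_const_nhds.div_atTop hsq
      filter_upwards [eventually_ge_atTop 1, h1.eventually_lt_const (by positivity : 0 < ε / 2)]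
        with N hN hlt
      rw [dist_zero_right]
      exact (hC N hN (Ω N) (P N) (ξ N) (hξ N hN)).trans_lt (by linarith)
    simpa using h0.add (ih.const_mul s)

end CentralLimit

end Model
end SpatialBranching

/-! ### The limiting field -/

namespace SpatialBranching

section Isonormal

variable {H : Type u} [NormedAddCommGroup H] [InnerProductSpace ℝ H]
  {Ω : Type u} [MeasurableSpace Ω] {P : Measure Ω}

/-- A linear isometry into `L²` is linear on random variables, almost surely. -/
theorem coeFn_sum_smul_ae (T : H →ₗᵢ[ℝ] Lp ℝ 2 P) {κ : Type v}
    (s : Finset κ) (c : κ → ℝ) (x : κ → H) :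
    (T (∑ i ∈ s, c i • x i) : Ω → ℝ) =ᵐ[P] fun ω => ∑ i ∈ s, c i * T (x i) ω := by
  rw [map_sum]
  refine (coeFn_finset_sum_Lp _ _).trans ?_
  have : ∀ i ∈ s, ∀ᵐ ω ∂P, (T (c i • x i) : Ω → ℝ) ω = c i * T (x i) ω := by
    intro i _
    rw [map_smul]
    filter_upwards [Lp.coeFn_smul (c i) (T (x i))] with ω h1
    rw [h1, Pi.smul_apply, smul_eq_mul]
  filter_upwards [(Finset.eventually_all _).2 this] with ω hω
  exact Finset.sum_congr rfl hω

/-- The variables of an isonormal process are jointly Gaussian: their linear combinations are again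
variables of the process. -/
theorem isGaussianProcess_isonormal [IsProbabilityMeasure P] {T : H →ₗᵢ[ℝ] Lp ℝ 2 P}
    (hT : ∀ h, ∫ ω, Complex.exp (T h ω * Complex.I) ∂P
      = Complex.exp (-((‖h‖ ^ 2 : ℝ) : ℂ) / 2)) {I : Type v} (x : I → H) :
    IsGaussianProcess (fun i ω => T (x i) ω) P where
  hasGaussianLaw J := by
    classical
    refine ⟨isGaussian_of_map_eq_gaussianReal fun L => ⟨0,
      (‖∑ j : J, L (Pi.single j 1) • x j‖ ^ 2).toNNReal, ?_⟩⟩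
    have hm : Measurable fun ω => J.restrict fun i => T (x i) ω :=
      measurable_pi_lambda _ fun i => (Lp.stronglyMeasurable (T (x i))).measurable
    rw [← hasLaw_of_isonormal hT, Measure.map_map (by fun_prop) hm]
    refine Measure.map_congr ?_
    filter_upwards [coeFn_sum_smul_ae T Finset.univ (fun j : J => L (Pi.single j 1))
      (fun j => x j)] with ω hω
    rw [hω, Function.comp_apply]
    have := LinearMap.pi_apply_eq_sum_univ L.toLinearMap (J.restrict fun i => T (x i) ω)
    simp only [ContinuousLinearMap.coe_coe] at this
    rw [this]
    refine Finset.sum_congr rfl fun j _ => ?_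
    rw [smul_eq_mul, mul_comm]
    congr 2
    ext k
    simp [Pi.single_apply, eq_comm]

theorem integral_isonormal [IsProbabilityMeasure P] {T : H →ₗᵢ[ℝ] Lp ℝ 2 P}
    (hT : ∀ h, ∫ ω, Complex.exp (T h ω * Complex.I) ∂P
      = Complex.exp (-((‖h‖ ^ 2 : ℝ) : ℂ) / 2)) (h : H) : ∫ ω, T h ω ∂P = 0 := by
  have := integral_map (μ := P) (φ := T h) (f := fun x : ℝ => x)
    (Lp.aestronglyMeasurable (T h)).aemeasurable (by fun_prop)
  rw [← this, hasLaw_of_isonormal hT, integral_id_gaussianReal]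

theorem integral_mul_isonormal (T : H →ₗᵢ[ℝ] Lp ℝ 2 P) (x y : H) :
    ∫ ω, T x ω * T y ω ∂P = inner ℝ x y := by
  rw [← T.inner_map_map, MeasureTheory.L2.inner_def]
  refine integral_congr_ae (ae_of_all _ fun ω => ?_)
  simp [mul_comm]

end Isonormal

section FeatureMap

variable {E F : Type u} [MeasurableSpace E] [MeasurableSpace F]

theorem BddMeas.memLp (f : BddMeas E) (ν : Measure E) [IsFiniteMeasure ν] : MemLp f.1 2 ν := by
  obtain ⟨C, -, hC⟩ := BddMeas.exists_bound f
  exact MemLp.of_bound (BddMeas.measurable f).aestronglyMeasurable C (ae_of_all _ hC)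

/-- The class in `L²(ν)` of a bounded measurable function. -/
noncomputable def toLpLin (ν : Measure E) [IsFiniteMeasure ν] : BddMeas E →ₗ[ℝ] Lp ℝ 2 ν where
  toFun f := (BddMeas.memLp f ν).toLp f.1
  map_add' f g := MemLp.toLp_add (BddMeas.memLp f ν) (BddMeas.memLp g ν)
  map_smul' c f := MemLp.toLp_const_smul c (BddMeas.memLp f ν)

theorem inner_toLpLin (ν : Measure E) [IsFiniteMeasure ν] (f g : BddMeas E) :
    inner ℝ (toLpLin ν f) (toLpLin ν g) = ∫ x, f.1 x * g.1 x ∂ν := by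
  rw [MeasureTheory.L2.inner_def]
  refine integral_congr_ae ?_
  filter_upwards [(BddMeas.memLp f ν).coeFn_toLp, (BddMeas.memLp g ν).coeFn_toLp] with x h1 h2
  simp only [toLpLin, LinearMap.coe_mk, AddHom.coe_mk, h1, h2]
  simp [mul_comm]

/-- Composition with a measurable map, from `𝓑(F)` to `𝓑(E)`. -/
def compLin {π : E → F} (hπ : Measurable π) : BddMeas F →ₗ[ℝ] BddMeas E where
  toFun f := ⟨fun x => f.1 (π x), (BddMeas.measurable f).comp hπ, by
    obtain ⟨C, -, hC⟩ := BddMeas.exists_bound f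
    exact ⟨C, fun x => hC _⟩⟩
  map_add' _ _ := rfl
  map_smul' _ _ := rfl

end FeatureMap

namespace Model
variable {E : ℕ → Type u} [∀ n, MeasurableSpace (E n)] (S : Model E)
  {K : ∀ n, ℝ → Measure (E n) → Kernel (E n) (E (n + 1))}

/-- The limiting covariance is a Gram kernel: at time `n + 1`, it is the scalar product in
`L²(η_n(dx) K_{n+1}(x, dy))` of the functions `f(y) - K_{n+1}(f)(x)`. -/
theorem exists_featureMap (hK : S.IsMcKean K) (n : ℕ) :
    ∃ (X : Type u) (_ : MeasurableSpace X) (ν : Measure X)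
      (φ : BddMeas (E n) →ₗ[ℝ] Lp ℝ 2 ν),
      ∀ f g, inner ℝ (φ f) (φ g) = S.limitCov K n f g := by
  cases n with
  | zero =>
    let κ : Kernel (E 0) (E 0) := Kernel.const _ (S.η 0)
    refine ⟨E 0, inferInstance, S.η 0, (toLpLin (S.η 0)).comp
      (LinearMap.id - kernelLin κ), fun f g => ?_⟩
    rw [LinearMap.comp_apply, LinearMap.comp_apply, inner_toLpLin]
    rfl
  | succ n =>
    have hM := hK.isMarkov n _ (S.η n) (S.mass_pos n) inferInstance
    let ν : Measure (E n × E (n + 1)) := (S.η n) ⊗ₘ (K n (S.mass n) (S.η n))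
    let ψ : BddMeas (E (n + 1)) →ₗ[ℝ] BddMeas (E n × E (n + 1)) :=
      compLin measurable_snd
        - (compLin measurable_fst).comp (kernelLin (K n (S.mass n) (S.η n)))
    refine ⟨E n × E (n + 1), inferInstance, ν, (toLpLin ν).comp ψ, fun f g => ?_⟩
    rw [LinearMap.comp_apply, LinearMap.comp_apply, inner_toLpLin]
    exact Measure.integral_compProd (BddMeas.integrable (BddMeas.mul (ψ f) (ψ g)) ν)

/-- Existence of the limiting field: the feature maps of the times `n` are put side by side in the
Hilbert sum of their target spaces, and composed with an isonormal process. Besides the defining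
properties, the field is jointly Gaussian in `n`, and it is almost surely linear; the last assertion
gives its joint characteristic functions. -/
theorem exists_limitField (hK : S.IsMcKean K) :
    ∃ (Ω' : Type u) (_ : MeasurableSpace Ω') (P' : Measure Ω') (_ : IsProbabilityMeasure P')
      (W : ∀ n, BddMeas (E n) → Ω' → ℝ),
      S.IsLimitField P' K W ∧
      IsGaussianProcess (fun (k : Σ n, BddMeas (E n)) => W k.1 k.2) P' ∧
      (∀ (n d : ℕ) (c : Fin d → ℝ) (f : Fin d → BddMeas (E n)),
        W n (∑ i, c i • f i) =ᵐ[P'] fun ω => ∑ i, c i * W n (f i) ω) ∧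
      ∀ (n : ℕ) (g : ∀ p, BddMeas (E p)),
        ∫ ω, Complex.exp ((∑ p ∈ Finset.range n, W p (g p) ω : ℝ) * Complex.I) ∂P'
          = Complex.exp (-((∑ p ∈ Finset.range n, S.limitCov K p (g p) (g p) : ℝ) : ℂ) / 2) := by
  classical
  choose X mX ν φ hφ using S.exists_featureMap hK
  let H : ℕ → Type u := fun n => Lp ℝ 2 (ν n)
  obtain ⟨Ω', mΩ', P', hP', T, hT⟩ := exists_isonormal (lp H 2)
  let x : ∀ n, BddMeas (E n) → lp H 2 := fun n f => lp.single 2 n (φ n f)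
  have hinner : ∀ n f g, inner ℝ (x n f) (x n g) = S.limitCov K n f g := fun n f g => by
    rw [lp.inner_single_left, lp.single_apply_self, hφ]
  have hinner0 : ∀ n m f g, n ≠ m → inner ℝ (x n f) (x m g) = 0 := fun n m f g h => by
    rw [lp.inner_single_left, lp.single_apply_ne _ _ _ h, inner_zero_right]
  have hxlin : ∀ (n d : ℕ) (c : Fin d → ℝ) (f : Fin d → BddMeas (E n)),
      x n (∑ i, c i • f i) = ∑ i, c i • x n (f i) := fun n d c f => by
    simp only [x, map_sum, map_smul]
    rw [← lp.singleAddMonoidHom_apply, map_sum]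
    simp [lp.single_smul]
  let W : ∀ n, BddMeas (E n) → Ω' → ℝ := fun n f ω => T (x n f) ω
  have hmeas : ∀ n f, Measurable (W n f) := fun n f =>
    (Lp.stronglyMeasurable (T (x n f))).measurable
  have hgauss : IsGaussianProcess (fun (k : Σ n, BddMeas (E n)) => W k.1 k.2) P' :=
    isGaussianProcess_isonormal hT fun k : Σ n, BddMeas (E n) => x k.1 k.2
  refine ⟨Ω', mΩ', P', hP', W, ⟨hmeas, fun n => isGaussianProcess_isonormal hT (x n),
    fun n f => integral_isonormal hT _, ?_, fun n f g => ?_⟩, hgauss, fun n d c f => ?_,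
    fun n g => ?_⟩
  · refine IsGaussianProcess.iIndepFun_of_covariance_eq_zero hgauss
      (fun n f => (hmeas n f).aemeasurable) fun n m hnm f g => ?_
    rw [covariance_eq_sub (Lp.memLp (T (x n f))) (Lp.memLp (T (x m g)))]
    have h1 : P'[W n f] = 0 := integral_isonormal hT _
    have h2 : P'[W n f * W m g] = 0 := by
      rw [← hinner0 n m f g hnm]
      exact integral_mul_isonormal T _ _
    rw [h1, h2]
    simp
  · rw [← hinner]
    exact integral_mul_isonormal T _ _
  · simp only [W, hxlin]
    exact coeFn_sum_smul_ae T _ _ _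
  · have hae := coeFn_sum_smul_ae T (Finset.range n) (fun _ => 1) (fun p => x p (g p))
    have hnorm : ‖∑ p ∈ Finset.range n, (1 : ℝ) • x p (g p)‖ ^ 2
        = ∑ p ∈ Finset.range n, S.limitCov K p (g p) (g p) := by
      simp only [one_smul]
      rw [← real_inner_self_eq_norm_sq, sum_inner]
      refine Finset.sum_congr rfl fun p hp => ?_
      rw [inner_sum, Finset.sum_eq_single_of_mem p hp fun q _ hq => hinner0 p q _ _ hq.symm,
        hinner]
    rw [← hnorm, ← hT]
    refine integral_congr_ae ?_
    filter_upwards [hae] with ω hω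
    rw [hω]
    simp [W]

end Model
end SpatialBranching

/-! ### Convergence of the fluctuations -/

namespace SpatialBranching

/-- Variables that are close in `L¹` have close characteristic functions. -/
theorem tendsto_integral_exp_of_integral_abs_sub_le {Ω : ℕ → Type v} [∀ N, MeasurableSpace (Ω N)]
    {P : ∀ N, Measure (Ω N)} [∀ N, IsProbabilityMeasure (P N)] {X Y : ∀ N, Ω N → ℝ}
    (hX : ∀ N, Measurable (X N)) (hY : ∀ N, Measurable (Y N)) {C : ℝ}
    (h : ∀ N, 1 ≤ N → Integrable (fun ω => X N ω - Y N ω) (P N) ∧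
      ∫ ω, |X N ω - Y N ω| ∂(P N) ≤ C / √(N : ℝ)) {l : ℂ}
    (hl : Tendsto (fun N => ∫ ω, Complex.exp (Y N ω * Complex.I) ∂(P N)) atTop (𝓝 l)) :
    Tendsto (fun N => ∫ ω, Complex.exp (X N ω * Complex.I) ∂(P N)) atTop (𝓝 l) := by
  have hint : ∀ (Z : ∀ N, Ω N → ℝ), (∀ N, Measurable (Z N)) → ∀ N,
      Integrable (fun ω => Complex.exp (Z N ω * Complex.I)) (P N) := fun Z hZ N => by
    have := hZ N
    exact Integrable.of_bound (C := 1) (Measurable.aestronglyMeasurable (by fun_prop))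
      (ae_of_all _ fun ω => by rw [Complex.norm_exp_ofReal_mul_I])
  have hsq : Tendsto (fun N : ℕ => C / √(N : ℝ)) atTop (𝓝 0) :=
    tendsto_const_nhds.div_atTop (Real.tendsto_sqrt_atTop.comp tendsto_natCast_atTop_atTop)
  have h0 : Tendsto (fun N => (∫ ω, Complex.exp (X N ω * Complex.I) ∂(P N))
      - ∫ ω, Complex.exp (Y N ω * Complex.I) ∂(P N)) atTop (𝓝 0) := by
    refine squeeze_zero_norm' ?_ hsq
    filter_upwards [eventually_ge_atTop 1] with N hN
    obtain ⟨h1, h2⟩ := h N hN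
    rw [← integral_sub (hint X hX N) (hint Y hY N)]
    exact (norm_integral_le_of_norm_le h1.abs
      (ae_of_all _ fun ω => norm_exp_mul_I_sub_exp_mul_I_le _ _)).trans h2
  simpa using h0.add hl

theorem abs_mul_abs_le_of_sqrt_mul {N : ℕ} (hN : 1 ≤ N) {a v y : ℝ} (h : √(N : ℝ) * a = v) :
    |a| * |y| ≤ (√(N : ℝ))⁻¹ * (v ^ 2 + y ^ 2) := by
  have hs : 0 < √(N : ℝ) := Real.sqrt_pos.2 (by exact_mod_cast hN)
  have ha : |a| = (√(N : ℝ))⁻¹ * |v| := by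
    rw [← h, abs_mul, abs_of_pos hs]
    field_simp
  rw [ha, mul_assoc]
  gcongr
  nlinarith [sq_abs v, sq_abs y, two_mul_le_add_sq |v| |y|, sq_nonneg v, sq_nonneg y]

theorem map_sum_smul_of_isLinearMap {V : Type u} [AddCommGroup V] [Module ℝ V] {L : V → ℝ}
    (hL : IsLinearMap ℝ L) {d : ℕ} (c : Fin d → ℝ) (f : Fin d → V) :
    L (∑ i, c i • f i) = ∑ i, c i * L (f i) := by
  have h := map_sum (hL.mk' L) (fun i => c i • f i) Finset.univ
  simp only [map_smul, IsLinearMap.mk'_apply, smul_eq_mul] at h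
  exact h

namespace Model
variable {E : ℕ → Type u} [∀ n, MeasurableSpace (E n)] (S : Model E)
  {K : ∀ n, ℝ → Measure (E n) → Kernel (E n) (E (n + 1))}

section Linearization

-- With no particles, the fields vanish because of the factor `√0`.

theorem WN_of_isEmpty {Ω : Type v} (ξ : ∀ n, Fin 0 → Ω → E n) (n : ℕ) (f : BddMeas (E n)) :
    S.WN K ξ n f = fun _ => 0 := by
  funext ω
  cases n <;> simp [WN]

theorem VγN_of_isEmpty {Ω : Type v} (ξ : ∀ n, Fin 0 → Ω → E n) (n : ℕ) (f : BddMeas (E n)) :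
    S.VγN ξ n f = fun _ => 0 := by
  funext ω
  simp [VγN]

theorem VηN_of_isEmpty {Ω : Type v} (ξ : ∀ n, Fin 0 → Ω → E n) (n : ℕ) (f : BddMeas (E n)) :
    S.VηN ξ n f = fun _ => 0 := by
  funext ω
  simp [VηN]

/-- Replacing the particle masses by their limits in the decomposition of the fluctuations of the
unnormalised measures costs `O(N ^ (-1/2))` in `L¹`. -/
theorem exists_integral_abs_VγN_sub_le (hK : S.IsMcKean K) (n : ℕ) (f : BddMeas (E n)) :
    ∃ C : ℝ, ∀ (N : ℕ), 1 ≤ N →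
      ∀ (Ω : Type v) [MeasurableSpace Ω] (P : Measure Ω) [IsProbabilityMeasure P]
      (ξ : ∀ n, Fin N → Ω → E n), S.IsParticleSystem P K ξ →
      Integrable (fun ω => S.VγN ξ n f ω
        - ∑ p ∈ Finset.range (n + 1), S.WN K ξ p (S.mass p • S.Qsg p n f) ω) P ∧
      ∫ ω, |S.VγN ξ n f ω
        - ∑ p ∈ Finset.range (n + 1), S.WN K ξ p (S.mass p • S.Qsg p n f) ω| ∂P
        ≤ C / √(N : ℝ) := by
  choose D hD hDp using fun p =>
    S.exists_integral_VγN_sq_le.{u, v} hK p (BddMeas.const (E p) 1)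
  choose B hB0 hB using fun p => BddMeas.exists_bound (S.Qsg p n f)
  refine ⟨∑ p ∈ Finset.range (n + 1), (D p + B p ^ 2), fun N hN Ω _ P _ ξ hξ => ?_⟩
  have hs : 0 < √(N : ℝ) := Real.sqrt_pos.2 (by exact_mod_cast hN)
  have e : ∀ ω, S.VγN ξ n f ω
      - ∑ p ∈ Finset.range (n + 1), S.WN K ξ p (S.mass p • S.Qsg p n f) ω
      = ∑ p ∈ Finset.range (n + 1), (S.massN ξ p ω - S.mass p) * S.WN K ξ p (S.Qsg p n f) ω :=
    fun ω => by
    rw [S.VγN_eq_sum hN ξ hK, ← Finset.sum_sub_distrib]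
    refine Finset.sum_congr rfl fun p _ => ?_
    rw [(S.isLinearMap_WN hN ξ hK p ω).map_smul, smul_eq_mul]
    ring
  have i1 := fun p => (hDp p N hN Ω P ξ hξ).1
  have e1 := fun p => (hDp p N hN Ω P ξ hξ).2
  have i2 := fun p => (S.memLp_WN hN hK hξ p (S.Qsg p n f)).integrable_sq
  have hR : Integrable (fun ω => (√(N : ℝ))⁻¹ * ∑ p ∈ Finset.range (n + 1),
      (S.VγN ξ p (BddMeas.const (E p) 1) ω ^ 2 + S.WN K ξ p (S.Qsg p n f) ω ^ 2)) P :=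
    (integrable_finsetSum _ fun p _ => (i1 p).add (i2 p)).const_mul _
  have hle : ∀ ω, |S.VγN ξ n f ω
      - ∑ p ∈ Finset.range (n + 1), S.WN K ξ p (S.mass p • S.Qsg p n f) ω|
      ≤ (√(N : ℝ))⁻¹ * ∑ p ∈ Finset.range (n + 1),
      (S.VγN ξ p (BddMeas.const (E p) 1) ω ^ 2 + S.WN K ξ p (S.Qsg p n f) ω ^ 2) := fun ω => by
    rw [e, Finset.mul_sum]
    refine (Finset.abs_sum_le_sum_abs _ _).trans (Finset.sum_le_sum fun p _ => ?_)
    rw [abs_mul]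
    exact abs_mul_abs_le_of_sqrt_mul hN (S.massN_sub_mass hN ξ p ω)
  have hm : Measurable fun ω => S.VγN ξ n f ω
      - ∑ p ∈ Finset.range (n + 1), S.WN K ξ p (S.mass p • S.Qsg p n f) ω :=
    (S.measurable_VγN (fun p _ => hξ.measurable p) f).sub
      (Finset.measurable_sum _ fun p _ => S.measurable_WN hN hK (fun q _ => hξ.measurable q) _)
  refine ⟨hR.mono' hm.aestronglyMeasurable (ae_of_all _ hle), ?_⟩
  refine (integral_mono_of_nonneg (ae_of_all _ fun ω => abs_nonneg _) hR
    (ae_of_all _ hle)).trans ?_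
  have i3 : ∀ p, Integrable (fun ω => S.VγN ξ p (BddMeas.const (E p) 1) ω ^ 2
      + S.WN K ξ p (S.Qsg p n f) ω ^ 2) P := fun p => (i1 p).add (i2 p)
  rw [integral_const_mul, integral_finsetSum _ fun p _ => i3 p, div_eq_inv_mul]
  refine mul_le_mul_of_nonneg_left (Finset.sum_le_sum fun p _ => ?_) (inv_nonneg.2 hs.le)
  rw [integral_add (i1 p) (i2 p)]
  exact add_le_add (e1 p) (S.integral_WN_sq_le hN hK hξ p (hB p))

/-- The fluctuations of the normalised measures are, up to `O(N ^ (-1/2))` in `L¹`, the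
fluctuations of the unnormalised measures tested on the centered normalised function. -/
theorem exists_integral_abs_VηN_sub_le (hK : S.IsMcKean K) (n : ℕ) (f : BddMeas (E n)) :
    ∃ C : ℝ, ∀ (N : ℕ), 1 ≤ N →
      ∀ (Ω : Type v) [MeasurableSpace Ω] (P : Measure Ω) [IsProbabilityMeasure P]
      (ξ : ∀ n, Fin N → Ω → E n), S.IsParticleSystem P K ξ →
      Integrable (fun ω => S.VηN ξ n f ω - S.VγN ξ n (S.normalised n f) ω) P ∧
      ∫ ω, |S.VηN ξ n f ω - S.VγN ξ n (S.normalised n f) ω| ∂P ≤ C / √(N : ℝ) := by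
  obtain ⟨a, b, ha, hab⟩ := S.exists_massN_bounds.{u, v} n
  obtain ⟨D, hD, hD1⟩ := S.exists_integral_VγN_sq_le.{u, v} hK n (BddMeas.const (E n) 1)
  obtain ⟨D', hD', hD1'⟩ := S.exists_integral_VγN_sq_le.{u, v} hK n (S.normalised n f)
  refine ⟨a⁻¹ * (D + D'), fun N hN Ω _ P _ ξ hξ => ?_⟩
  have hs : 0 < √(N : ℝ) := Real.sqrt_pos.2 (by exact_mod_cast hN)
  obtain ⟨i1, e1⟩ := hD1 N hN Ω P ξ hξ
  obtain ⟨i2, e2⟩ := hD1' N hN Ω P ξ hξ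
  have hR : Integrable (fun ω => a⁻¹ * ((√(N : ℝ))⁻¹ * (S.VγN ξ n (BddMeas.const (E n) 1) ω ^ 2
      + S.VγN ξ n (S.normalised n f) ω ^ 2))) P := ((i1.add i2).const_mul _).const_mul _
  have hle : ∀ ω, |S.VηN ξ n f ω - S.VγN ξ n (S.normalised n f) ω|
      ≤ a⁻¹ * ((√(N : ℝ))⁻¹ * (S.VγN ξ n (BddMeas.const (E n) 1) ω ^ 2
      + S.VγN ξ n (S.normalised n f) ω ^ 2)) := fun ω => by
    have hp := S.massN_pos hN ξ n ω
    have h1 : S.VηN ξ n f ω - S.VγN ξ n (S.normalised n f) ω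
        = -((S.massN ξ n ω)⁻¹ * ((S.massN ξ n ω - S.mass n)
          * S.VγN ξ n (S.normalised n f) ω)) := by
      rw [S.VηN_eq hN]
      field_simp
      ring
    rw [h1, abs_neg, abs_mul, abs_mul, abs_of_pos (inv_pos.2 hp)]
    have h2 := abs_mul_abs_le_of_sqrt_mul hN (y := S.VγN ξ n (S.normalised n f) ω)
      (S.massN_sub_mass hN ξ n ω)
    have h3 := (hab N hN Ω ξ ω).1
    gcongr
  have hm : Measurable fun ω => S.VηN ξ n f ω - S.VγN ξ n (S.normalised n f) ω :=
    (S.measurable_VηN (fun p _ => hξ.measurable p) f).sub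
      (S.measurable_VγN (fun p _ => hξ.measurable p) _)
  refine ⟨hR.mono' hm.aestronglyMeasurable (ae_of_all _ hle), ?_⟩
  refine (integral_mono_of_nonneg (ae_of_all _ fun ω => abs_nonneg _) hR
    (ae_of_all _ hle)).trans ?_
  rw [integral_const_mul, integral_const_mul, integral_add i1 i2, mul_div_assoc,
    div_eq_inv_mul (D + D')]
  gcongr

end Linearization

section Convergence

/-- The function `k.2` if its time `k.1` is `p`, and zero otherwise. -/
noncomputable def timeComponent (p : ℕ) (k : Σ n, BddMeas (E n)) : BddMeas (E p) :=
  if h : k.1 = p then h ▸ k.2 else 0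

/-- A combination of values of fields at functions of various times, sorted by the times. -/
theorem sum_timeComponent (F : ∀ p, BddMeas (E p) → ℝ) {n d : ℕ}
    (s : Fin d → Σ n, BddMeas (E n)) (hs : ∀ i, (s i).1 < n) (t : Fin d → ℝ) :
    ∑ p ∈ Finset.range n, ∑ i, (if (s i).1 = p then t i else 0) * F p (timeComponent p (s i))
      = ∑ i, t i * F (s i).1 (s i).2 := by
  rw [Finset.sum_comm]
  refine Finset.sum_congr rfl fun i _ => ?_
  rw [Finset.sum_eq_single_of_mem (s i).1 (Finset.mem_range.2 (hs i))]
  · simp [timeComponent]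
  · intro q _ hq
    simp [hq.symm]

variable {Ω' : Type w} [MeasurableSpace Ω'] {P' : Measure Ω'}
  {W : ∀ n, BddMeas (E n) → Ω' → ℝ}

theorem measurable_Vγ (hWm : ∀ n f, Measurable (W n f)) (n : ℕ) (f : BddMeas (E n)) :
    Measurable (S.Vγ W n f) :=
  Finset.measurable_sum _ fun p _ => (hWm p _).const_mul _

theorem integral_Vγ [IsProbabilityMeasure P'] (hW : S.IsLimitField P' K W) (n : ℕ)
    (f : BddMeas (E n)) : ∫ ω, S.Vγ W n f ω ∂P' = 0 := by
  simp only [Vγ]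
  rw [integral_finsetSum _ fun p _ =>
    (((hW.gaussian p).hasGaussianLaw_eval _).integrable).const_mul _]
  exact Finset.sum_eq_zero fun p _ => by rw [integral_const_mul, hW.centered, mul_zero]

omit [MeasurableSpace Ω'] in
/-- The two limits `V^γ` and `V^η` are values of `V^γ`. -/
theorem sumElim_Vγ_Vη (n : ℕ) (k : BddMeas (E n) ⊕ BddMeas (E n)) :
    Sum.elim (S.Vγ W n) (S.Vη W n) k = S.Vγ W n (Sum.elim id (S.normalised n) k) := by
  cases k <;> rfl

theorem isGaussianProcess_Vγ_Vη
    (hWg : IsGaussianProcess (fun (k : Σ n, BddMeas (E n)) => W k.1 k.2) P') (n : ℕ) :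
    IsGaussianProcess (Sum.elim (S.Vγ W n) (S.Vη W n)) P' := by
  classical
  refine IsGaussianProcess.of_isGaussianProcess hWg fun k => ?_
  let f : BddMeas (E n) := Sum.elim id (S.normalised n) k
  let k' : ℕ → Σ n, BddMeas (E n) := fun p => ⟨p, S.Qsg p n f⟩
  have hk' : ∀ p : Finset.range (n + 1), k' p ∈ (Finset.range (n + 1)).image k' :=
    fun p => Finset.mem_image_of_mem k' p.2
  refine ⟨(Finset.range (n + 1)).image k', ∑ p : Finset.range (n + 1),
    S.mass p • ContinuousLinearMap.proj (⟨k' p, hk' p⟩ : (Finset.range (n + 1)).image k'),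
    fun ω => ?_⟩
  rw [sumElim_Vγ_Vη, Vγ, ← Finset.sum_coe_sort]
  simp [k', f]

/-- If `W` is almost surely linear, every combination of values of `V^γ` is almost surely a sum of
values of the fields `W_p`. -/
theorem sum_mul_Vγ_ae_eq
    (hWlin : ∀ (n d : ℕ) (c : Fin d → ℝ) (f : Fin d → BddMeas (E n)),
      W n (∑ i, c i • f i) =ᵐ[P'] fun ω => ∑ i, c i * W n (f i) ω)
    (n : ℕ) {d : ℕ} (t : Fin d → ℝ) (f : Fin d → BddMeas (E n)) :
    ∀ᵐ ω ∂P', ∑ i, t i * S.Vγ W n (f i) ω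
      = ∑ p ∈ Finset.range (n + 1), W p (S.mass p • S.Qsg p n (∑ i, t i • f i)) ω := by
  have h : ∀ p ∈ Finset.range (n + 1), ∀ᵐ ω ∂P',
      W p (S.mass p • S.Qsg p n (∑ i, t i • f i)) ω
        = ∑ i, (S.mass p * t i) * W p (S.Qsg p n (f i)) ω := by
    intro p hp
    have hL := S.isLinearMap_Qsg (p := p) (n := n) (by simpa [Nat.lt_succ_iff] using hp)
    have e : S.mass p • S.Qsg p n (∑ i, t i • f i)
        = ∑ i, (S.mass p * t i) • S.Qsg p n (f i) := by
      have h1 := map_sum (hL.mk' _) (fun i => t i • f i) Finset.univ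
      simp only [map_smul, IsLinearMap.mk'_apply] at h1
      rw [h1, Finset.smul_sum]
      simp only [smul_smul]
    rw [e]
    exact hWlin p d _ _
  filter_upwards [(Finset.eventually_all _).2 h] with ω hω
  rw [Finset.sum_congr rfl hω, Finset.sum_comm]
  refine Finset.sum_congr rfl fun i _ => ?_
  rw [Vγ, Finset.mul_sum]
  exact Finset.sum_congr rfl fun p _ => by ring

variable (hK : S.IsMcKean K) (hKc : S.IsContinuousAtFlow K)
  {Ω : ℕ → Type v} [∀ N, MeasurableSpace (Ω N)]
  {P : ∀ N, Measure (Ω N)} {ξ : ∀ N n, Fin N → Ω N → E n}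
  (hξ : ∀ N, 1 ≤ N → S.IsParticleSystem (P N) K (ξ N))
include hK hξ

theorem IsParticleSystem.measurable_WN (N n : ℕ) (f : BddMeas (E n)) :
    Measurable (S.WN K (ξ N) n f) := by
  rcases Nat.eq_zero_or_pos N with rfl | hN
  · rw [S.WN_of_isEmpty]
    exact measurable_const
  · exact S.measurable_WN hN hK (fun q _ => (hξ N hN).measurable q) f

omit hK in
theorem IsParticleSystem.measurable_VγN (N n : ℕ) (f : BddMeas (E n)) :
    Measurable (S.VγN (ξ N) n f) := by
  rcases Nat.eq_zero_or_pos N with rfl | hN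
  · rw [S.VγN_of_isEmpty]
    exact measurable_const
  · exact S.measurable_VγN (fun q _ => (hξ N hN).measurable q) f

omit hK in
theorem IsParticleSystem.measurable_VηN (N n : ℕ) (f : BddMeas (E n)) :
    Measurable (S.VηN (ξ N) n f) := by
  rcases Nat.eq_zero_or_pos N with rfl | hN
  · rw [S.VηN_of_isEmpty]
    exact measurable_const
  · exact S.measurable_VηN (fun q _ => (hξ N hN).measurable q) f

variable [∀ N, IsProbabilityMeasure (P N)] [IsProbabilityMeasure P']
  (hWm : ∀ n f, Measurable (W n f))
  (hWlin : ∀ (n d : ℕ) (c : Fin d → ℝ) (f : Fin d → BddMeas (E n)),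
    W n (∑ i, c i • f i) =ᵐ[P'] fun ω => ∑ i, c i * W n (f i) ω)
  (hWchar : ∀ (n : ℕ) (g : ∀ p, BddMeas (E p)),
    ∫ ω, Complex.exp ((∑ p ∈ Finset.range n, W p (g p) ω : ℝ) * Complex.I) ∂P'
      = Complex.exp (-((∑ p ∈ Finset.range n, S.limitCov K p (g p) (g p) : ℝ) : ℂ) / 2))
include hKc hWm hWlin hWchar

/-- Joint convergence of the local error fields of all times. -/
theorem fieldsTendstoInLaw_WN :
    FieldsTendstoInLaw (I := Σ n, BddMeas (E n))
      (fun N k => S.WN K (ξ N) k.1 k.2) (fun k => W k.1 k.2) P P' := by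
  refine fieldsTendstoInLaw_of_integral_exp
    (fun N k => IsParticleSystem.measurable_WN S hK hξ N k.1 k.2) (fun k => hWm k.1 k.2)
    fun d s t => ?_
  let n := Finset.univ.sup fun i => (s i).1
  have hn : ∀ i, (s i).1 < n + 1 := fun i =>
    Nat.lt_succ_of_le (Finset.le_sup (f := fun i => (s i).1) (Finset.mem_univ i))
  let g : ∀ p, BddMeas (E p) := fun p =>
    ∑ i, (if (s i).1 = p then t i else 0) • timeComponent p (s i)
  have hlim : ∫ ω, Complex.exp ((∑ i, t i * W (s i).1 (s i).2 ω : ℝ) * Complex.I) ∂P'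
      = Complex.exp
        (-((∑ p ∈ Finset.range (n + 1), S.limitCov K p (g p) (g p) : ℝ) : ℂ) / 2) := by
    rw [← hWchar]
    refine integral_congr_ae ?_
    have h : ∀ p ∈ Finset.range (n + 1), ∀ᵐ ω ∂P', W p (g p) ω
        = ∑ i, (if (s i).1 = p then t i else 0) * W p (timeComponent p (s i)) ω :=
      fun p _ => hWlin p d _ _
    filter_upwards [(Finset.eventually_all _).2 h] with ω hω
    rw [Finset.sum_congr rfl hω, sum_timeComponent (fun p f => W p f ω) s hn t]
  rw [hlim]
  refine (S.tendsto_integral_exp_sum_WN hK hKc hξ n g).congr' ?_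
  filter_upwards [eventually_ge_atTop 1] with N hN
  refine integral_congr_ae (ae_of_all _ fun ω => ?_)
  beta_reduce
  rw [← sum_timeComponent (fun p f => S.WN K (ξ N) p f ω) s hn t]
  congr 3
  refine Finset.sum_congr rfl fun p _ => ?_
  exact map_sum_smul_of_isLinearMap (S.isLinearMap_WN hN (ξ N) hK p ω) _ _

/-- Joint convergence of the fluctuations of the unnormalised and of the normalised measures. A
combination of their values is, up to `O(N ^ (-1/2))` in `L¹`, a sum of local errors tested on the
functions `γ_p(1) Q_{p,n}(F)`, for a single function `F`. -/
theorem fieldsTendstoInLaw_VγN_VηN (n : ℕ) :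
    FieldsTendstoInLaw (I := BddMeas (E n) ⊕ BddMeas (E n))
      (fun N => Sum.elim (S.VγN (ξ N) n) (S.VηN (ξ N) n))
      (Sum.elim (S.Vγ W n) (S.Vη W n)) P P' := by
  have hmN : ∀ N k, Measurable (Sum.elim (S.VγN (ξ N) n) (S.VηN (ξ N) n) k) := fun N k => by
    cases k
    · exact IsParticleSystem.measurable_VγN S hξ N n _
    · exact IsParticleSystem.measurable_VηN S hξ N n _
  have hm : ∀ k, Measurable (Sum.elim (S.Vγ W n) (S.Vη W n) k) := fun k => by
    rw [sumElim_Vγ_Vη]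
    exact S.measurable_Vγ hWm n _
  refine fieldsTendstoInLaw_of_integral_exp hmN hm fun d s t => ?_
  let f : Fin d → BddMeas (E n) := fun i => Sum.elim id (S.normalised n) (s i)
  let F : BddMeas (E n) := ∑ i, t i • f i
  have hlim : ∫ ω, Complex.exp
      ((∑ i, t i * Sum.elim (S.Vγ W n) (S.Vη W n) (s i) ω : ℝ) * Complex.I) ∂P'
      = Complex.exp (-((∑ p ∈ Finset.range (n + 1), S.limitCov K p
        (S.mass p • S.Qsg p n F) (S.mass p • S.Qsg p n F) : ℝ) : ℂ) / 2) := by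
    rw [← hWchar]
    refine integral_congr_ae ?_
    filter_upwards [S.sum_mul_Vγ_ae_eq hWlin n t f] with ω hω
    rw [← hω]
    simp_rw [sumElim_Vγ_Vη]
    rfl
  rw [hlim]
  obtain ⟨C, hC⟩ := S.exists_integral_abs_VγN_sub_le.{u, v} hK n F
  have hk : ∀ k : BddMeas (E n) ⊕ BddMeas (E n), ∃ D : ℝ, ∀ N, 1 ≤ N →
      Integrable (fun ω => Sum.elim (S.VγN (ξ N) n) (S.VηN (ξ N) n) k ω
        - S.VγN (ξ N) n (Sum.elim id (S.normalised n) k) ω) (P N) ∧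
      ∫ ω, |Sum.elim (S.VγN (ξ N) n) (S.VηN (ξ N) n) k ω
        - S.VγN (ξ N) n (Sum.elim id (S.normalised n) k) ω| ∂(P N) ≤ D / √(N : ℝ) := by
    rintro (h | h)
    · exact ⟨0, fun N hN => by simp⟩
    · obtain ⟨D, hD⟩ := S.exists_integral_abs_VηN_sub_le.{u, v} hK n h
      exact ⟨D, fun N hN => hD N hN (Ω N) (P N) (ξ N) (hξ N hN)⟩
  choose D hD using hk
  refine tendsto_integral_exp_of_integral_abs_sub_le (C := C + ∑ i, |t i| * D (s i))
    (fun N => Finset.measurable_sum _ fun i _ => (hmN N (s i)).const_mul _)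
    (fun N => Finset.measurable_sum _ fun p _ => IsParticleSystem.measurable_WN S hK hξ N p _)
    (fun N hN => ?_)
    (S.tendsto_integral_exp_sum_WN hK hKc hξ n fun p => S.mass p • S.Qsg p n F)
  obtain ⟨i1, e1⟩ := hC N hN (Ω N) (P N) (ξ N) (hξ N hN)
  have i2 := fun i => (hD (s i) N hN).1
  have e2 := fun i => (hD (s i) N hN).2
  have hsplit : ∀ ω, ∑ i, t i * Sum.elim (S.VγN (ξ N) n) (S.VηN (ξ N) n) (s i) ω
      - ∑ p ∈ Finset.range (n + 1), S.WN K (ξ N) p (S.mass p • S.Qsg p n F) ω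
      = (S.VγN (ξ N) n F ω
        - ∑ p ∈ Finset.range (n + 1), S.WN K (ξ N) p (S.mass p • S.Qsg p n F) ω)
        + ∑ i, t i * (Sum.elim (S.VγN (ξ N) n) (S.VηN (ξ N) n) (s i) ω
          - S.VγN (ξ N) n (f i) ω) := fun ω => by
    have h1 : S.VγN (ξ N) n F ω = ∑ i, t i * S.VγN (ξ N) n (f i) ω :=
      map_sum_smul_of_isLinearMap (S.isLinearMap_VγN hN (ξ N) n ω) _ _
    simp only [mul_sub, Finset.sum_sub_distrib]
    rw [h1]
    ring
  simp_rw [hsplit]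
  have i3 : ∀ i, Integrable (fun ω => t i * (Sum.elim (S.VγN (ξ N) n) (S.VηN (ξ N) n) (s i) ω
      - S.VγN (ξ N) n (f i) ω)) (P N) := fun i => (i2 i).const_mul _
  have i4 : Integrable (fun ω => ∑ i, |t i * (Sum.elim (S.VγN (ξ N) n) (S.VηN (ξ N) n) (s i) ω
      - S.VγN (ξ N) n (f i) ω)|) (P N) := integrable_finsetSum _ fun i _ => (i3 i).abs
  refine ⟨i1.add (integrable_finsetSum _ fun i _ => i3 i), ?_⟩
  have i5 : Integrable (fun ω => |S.VγN (ξ N) n F ω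
        - ∑ p ∈ Finset.range (n + 1), S.WN K (ξ N) p (S.mass p • S.Qsg p n F) ω|
        + ∑ i, |t i * (Sum.elim (S.VγN (ξ N) n) (S.VηN (ξ N) n) (s i) ω
          - S.VγN (ξ N) n (f i) ω)|) (P N) := i1.abs.add i4
  refine (integral_mono_of_nonneg (ae_of_all _ fun ω => abs_nonneg _) i5
    (ae_of_all _ fun ω => (abs_add_le _ _).trans
      (add_le_add_right (Finset.abs_sum_le_sum_abs _ _) _))).trans ?_
  rw [integral_add i1.abs i4, integral_finsetSum _ fun i _ => (i3 i).abs, add_div,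
    Finset.sum_div]
  refine add_le_add e1 (Finset.sum_le_sum fun i _ => ?_)
  simp_rw [abs_mul]
  rw [integral_const_mul, mul_div_assoc]
  exact mul_le_mul_of_nonneg_left (e2 i) (abs_nonneg _)

end Convergence

end Model
end SpatialBranching

theorem mainTheorem3
    (E : ℕ → Type u) [∀ n, MeasurableSpace (E n)]
    (S : SpatialBranching.Model E)
    (K : ∀ n, ℝ → Measure (E n) → Kernel (E n) (E (n + 1)))
    (hK : S.IsMcKean K) (hKc : S.IsContinuousAtFlow K)
    (Ω : ℕ → Type v) [∀ N, MeasurableSpace (Ω N)]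
    (P : ∀ N, Measure (Ω N)) [∀ N, IsProbabilityMeasure (P N)]
    (ξ : ∀ N n, Fin N → Ω N → E n)
    (hξ : ∀ N, 1 ≤ N → S.IsParticleSystem (P N) K (ξ N)) :
    ∃ (Ω' : Type u) (_ : MeasurableSpace Ω') (P' : Measure Ω') (_ : IsProbabilityMeasure P')
      (W : ∀ n, SpatialBranching.BddMeas (E n) → Ω' → ℝ),
      S.IsLimitField P' K W ∧
      SpatialBranching.FieldsTendstoInLaw
        (I := Σ n, SpatialBranching.BddMeas (E n))
        (fun N k => S.WN K (ξ N) k.1 k.2) (fun k => W k.1 k.2) P P' ∧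
      ∀ n,
        IsGaussianProcess (Sum.elim (S.Vγ W n) (S.Vη W n)) P' ∧
        (∀ f, ∫ ω, S.Vγ W n f ω ∂P' = 0) ∧ (∀ f, ∫ ω, S.Vη W n f ω ∂P' = 0) ∧
        SpatialBranching.FieldsTendstoInLaw
          (I := SpatialBranching.BddMeas (E n) ⊕ SpatialBranching.BddMeas (E n))
          (fun N => Sum.elim (S.VγN (ξ N) n) (S.VηN (ξ N) n))
          (Sum.elim (S.Vγ W n) (S.Vη W n)) P P' := by
  obtain ⟨Ω', mΩ', P', hP', W, hW, hWg, hWlin, hWchar⟩ := S.exists_limitField hK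
  exact ⟨Ω', mΩ', P', hP', W, hW,
    S.fieldsTendstoInLaw_WN hK hKc hξ hW.measurable hWlin hWchar, fun n =>
    ⟨S.isGaussianProcess_Vγ_Vη hWg n, S.integral_Vγ hW n, fun f => S.integral_Vγ hW n _,
      S.fieldsTendstoInLaw_VγN_VηN hK hKc hξ hW.measurable hWlin hWchar n⟩⟩
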